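/- **Setting.** For $n \ge 1$, a turnstile stream over $\mathbb{Z}^n$ is a finite sequence $\sigma$ of updates $(i,\Delta) \in [n]\times\mathbb{Z}$, of any length and with integers $\Delta$ of any size; its final state is $\operatorname{freq}\sigma = \sum_{(i,\Delta)\in\sigma}\Delta\, e_i \in \mathbb{Z}^n$. A streaming problem is an arbitrary relation $P \subseteq \mathbb{Z}^n\times\mathbb{Z}$. A deterministic streaming algorithm consists of three programs, which compute the initial state (from $n$), the new state (from $n$, the current state and an update $(i,\Delta)$), and the output (from $n$ and the final state). The programs do not depend on $n$. They run on a machine whose registers hold natural numbers, with two-way access to a read-only tape that holds $\Delta$, and with a write-only output tape; $n$, $i$ and the state are given in registers. The space in use is the total number of bits in all registers; the two tapes are not counted. The algorithm *solves* $P$ if on every stream $\sigma$ all its programs halt and its output $z$ satisfies $(\operatorname{freq}\sigma, z)\in P$. It *uses $s$ bits between updates and $S$ bits during updates and recovery* (over $\mathbb{Z}^n$) if, for every stream, each state that it reaches is an $s$-bit string and no run of its programs ever has more than $S$ bits in use; the computation of the initial state is counted in $S$ too. The algorithm is a *linear sketching algorithm with an $s$-bit sketch* (over $\mathbb{Z}^n$)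 if there are a $\mathbb{Z}$-module $M$ with $|M|\le 2^s$, whose elements are represented by distinct $s$-bit strings, and a $\mathbb{Z}$-module homomorphism $\phi:\mathbb{Z}^n\to M$, such that after every stream $\sigma$ its state is the representation of $\phi(\operatorname{freq}\sigma)$. **Theorem.** There is an absolute constant $C$ such that for every deterministic streaming algorithm $A$ there is a deterministic streaming algorithm $B$ with the following property. For all $n \ge 1$, all $s, S \in \mathbb{N}$ and every streaming problem $P \subseteq \mathbb{Z}^n\times\mathbb{Z}$: if $A$ solves $P$ on streams of all lengths and uses $s$ bits between updates and $S$ bits during updates and recovery, then $B$ is a linear sketching algorithm over $\mathbb{Z}^n$ with an $s$-bit sketch, $B$ solves $P$ on streams of all lengths, and $B$ uses $s$ bits between updates and at most $C\,(S + s\lfloor\log_2 n\rfloor)$ bits during updates and recovery. (In particular $B$ depends only on $A$, not on $n$, $s$, $S$ or $P$, and it computes all the data of its sketch within this space.) -/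

import Mathlib

/-! ## Streams and streaming problems -/

/-- A turnstile stream of updates `(i, Δ)` to a vector of `ℤ^n`. -/
abbrev TurnstileStream (n : ℕ) : Type := List (Fin n × ℤ)

/-- The final state `∑ Δ • e_i` of a stream. -/
def TurnstileStream.freq {n : ℕ} (σ : TurnstileStream n) : Fin n → ℤ :=
  (σ.map fun u => Pi.single u.1 u.2).sum

/-- A data stream problem is a relation between input vectors and integer outputs. -/
abbrev StreamProblem (n : ℕ) : Type := Set ((Fin n → ℤ) × ℤ)

/-! ## The machine model

A program works on registers that hold natural numbers.  It also has a two-way read-only input tape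
and a write-only output tape.  As usual for space complexity, the space in use is the total
number of bits in the work memory, that is, in all registers; the two tapes are not counted. -/

/-- Binary arithmetic operations on registers (subtraction truncates at `0`). -/
inductive ArithOp
  | add | sub | mul | div | mod

/-- The value of an arithmetic operation. -/
def ArithOp.eval : ArithOp → ℕ → ℕ → ℕ
  | .add, a, b => a + b
  | .sub, a, b => a - b
  | .mul, a, b => a * b
  | .div, a, b => a / b
  | .mod, a, b => a % b

/-- Elementary instructions; registers are named by natural numbers. -/
inductive Instr
  /-- `const x k`: put the constant `k` into register `x`. -/
  | const (x k : ℕ)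
  /-- `copy x y`: copy register `y` to register `x`. -/
  | copy (x y : ℕ)
  /-- `arith o x y z`: put the result of `o` on registers `y`, `z` into register `x`. -/
  | arith (o : ArithOp) (x y z : ℕ)
  /-- `read x`: put the symbol under the input head into register `x`. -/
  | read (x : ℕ)
  /-- Move the input head one cell to the left. -/
  | moveLeft
  /-- Move the input head one cell to the right. -/
  | moveRight
  /-- Append a bit (`1` if register `x` is nonzero, `0` otherwise) to the output tape. -/
  | write (x : ℕ)

/-- Programs. -/
inductive Cmd
  | instr (a : Instr)
  | seq (c d : Cmd)
  /-- Run `c` if register `x` is nonzero, and `d` otherwise. -/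
  | ite (x : ℕ) (c d : Cmd)
  /-- Run `c` as long as register `x` is nonzero. -/
  | loop (x : ℕ) (c : Cmd)

/-- A configuration: the registers (all but finitely many hold `0`), the position of the input head,
and the bits written on the output tape so far. -/
structure Config where
  reg : ℕ →₀ ℕ
  head : ℕ
  out : List Bool

/-- The number of bits of work memory in use. -/
def Config.space (c : Config) : ℕ := c.reg.sum fun _ v => v.size

/-- Put `v` into register `x`. -/
noncomputable def Config.set (c : Config) (x v : ℕ) : Config :=
  { c with reg := c.reg.update x v }

/-- The contents of the input tape for the integer `Δ`: cell `0` holds the sign (`3` for `Δ ≥ 0`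
and `4` for `Δ < 0`), the next `Δ.natAbs.size` cells hold the binary digits `0`, `1` of `|Δ|`, least
significant first, and the cell after them holds the end marker `2`. -/
def inputSymbol (Δ : ℤ) (h : ℕ) : ℕ :=
  if h = 0 then (if Δ < 0 then 4 else 3)
  else if h ≤ Δ.natAbs.size then (Δ.natAbs.testBit (h - 1)).toNat else 2

/-- The effect of an instruction when the input tape holds the integer `Δ`.  The head stays between
the sign and the end marker. -/
noncomputable def Instr.step (Δ : ℤ) : Instr → Config → Config
  | .const x k, c => c.set x k
  | .copy x y, c => c.set x (c.reg y)
  | .arith o x y z, c => c.set x (o.eval (c.reg y) (c.reg z))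
  | .read x, c => c.set x (inputSymbol Δ c.head)
  | .moveLeft, c => { c with head := c.head - 1 }
  | .moveRight, c => { c with head := min (c.head + 1) (Δ.natAbs.size + 1) }
  | .write x, c => { c with out := c.out ++ [decide (c.reg x ≠ 0)] }

/-- `Runs Δ S p c c'`: on the input tape `Δ`, the program `p` started in the configuration `c` halts
in the configuration `c'`, and at most `S` bits of work memory are in use at all times. -/
inductive Runs (Δ : ℤ) (S : ℕ) : Cmd → Config → Config → Prop
  | instr {a : Instr} {c : Config} (h : c.space ≤ S) (h' : (a.step Δ c).space ≤ S) :
      Runs Δ S (.instr a) c (a.step Δ c)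
  | seq {p q : Cmd} {c c' c'' : Config} (h : Runs Δ S p c c') (h' : Runs Δ S q c' c'') :
      Runs Δ S (.seq p q) c c''
  | ite_true {x : ℕ} {p q : Cmd} {c c' : Config} (hx : c.reg x ≠ 0) (h : Runs Δ S p c c') :
      Runs Δ S (.ite x p q) c c'
  | ite_false {x : ℕ} {p q : Cmd} {c c' : Config} (hx : c.reg x = 0) (h : Runs Δ S q c c') :
      Runs Δ S (.ite x p q) c c'
  | loop_true {x : ℕ} {p : Cmd} {c c' c'' : Config} (hx : c.reg x ≠ 0)
      (h : Runs Δ S p c c') (h' : Runs Δ S (.loop x p) c' c'') :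
      Runs Δ S (.loop x p) c c''
  | loop_false {x : ℕ} {p : Cmd} {c : Config} (hx : c.reg x = 0) (h : c.space ≤ S) :
      Runs Δ S (.loop x p) c c

/-! ## Deterministic streaming algorithms -/

/-- A deterministic data stream algorithm: one program each for the initial state, for the
transition function and for the post-processing function.  The programs do not depend on the
dimension `n`, which they receive as an input. -/
structure StreamAlg where
  start : Cmd
  update : Cmd
  recover : Cmd

/-- The initial configuration of a program: register `0` holds the dimension `n`, register `1` the
state `y` (a bit string, read as a natural number), register `2` the index `i`. -/
noncomputable def startConfig (n y i : ℕ) : Config where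
  reg := Finsupp.single 0 n + Finsupp.single 1 y + Finsupp.single 2 i
  head := 0
  out := []

/-- The integer denoted by the contents of the output tape: the sign bit, followed by the binary
digits of the absolute value, least significant first. -/
def outputValue : List Bool → ℤ
  | [] => 0
  | neg :: bits =>
      if neg then -(Nat.ofDigits 2 (bits.map Bool.toNat) : ℤ)
      else (Nat.ofDigits 2 (bits.map Bool.toNat) : ℤ)

namespace StreamAlg

/-- `A.Reaches n S σ y`: having processed the stream `σ` over `ℤ^n`, the algorithm is in the state
`y`, and it never used more than `S` bits of work memory on the way.  Nothing but the state, which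
a program leaves in register `1`, is carried over from one update to the next. -/
inductive Reaches (A : StreamAlg) (n S : ℕ) : TurnstileStream n → ℕ → Prop
  | nil {c : Config} (h : Runs 0 S A.start (startConfig n 0 0) c) :
      Reaches A n S [] (c.reg 1)
  | snoc {σ : TurnstileStream n} {y : ℕ} {i : Fin n} {Δ : ℤ} {c : Config}
      (h : Reaches A n S σ y) (h' : Runs Δ S A.update (startConfig n y i) c) :
      Reaches A n S (σ ++ [(i, Δ)]) (c.reg 1)

/-- `A.Recovers n S y z`: post-processing of the state `y` returns the integer `z`, and uses at most
`S` bits of work memory. -/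
def Recovers (A : StreamAlg) (n S y : ℕ) (z : ℤ) : Prop :=
  ∃ c : Config, Runs 0 S A.recover (startConfig n y 0) c ∧ outputValue c.out = z

/-- `A` solves the problem `P` over `ℤ^n` on all streams, of every length. -/
def Solves (A : StreamAlg) (n : ℕ) (P : StreamProblem n) : Prop :=
  ∀ σ : TurnstileStream n, ∃ (S y : ℕ) (z : ℤ),
    A.Reaches n S σ y ∧ A.Recovers n S y z ∧ (σ.freq, z) ∈ P

/-- On all streams over `ℤ^n`, `A` uses `s` bits of space between updates (every state that it
reaches is an `s`-bit number), and `S` bits during updates and recovery. -/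
def UsesSpace (A : StreamAlg) (n s S : ℕ) : Prop :=
  ∀ σ : TurnstileStream n, ∃ (y : ℕ) (z : ℤ),
    y < 2 ^ s ∧ A.Reaches n S σ y ∧ A.Recovers n S y z

/-- `A` is a linear sketching algorithm over `ℤ^n` with an `s`-bit sketch: there are a `ℤ`-module
`M`, the elements of which are represented by pairwise different `s`-bit strings (so that `M` has
at most `2^s` elements), and a `ℤ`-module homomorphism `φ : ℤ^n → M`, such that the state of `A`
after any stream `σ` is (the representation of) `φ (freq σ)`. -/
def IsLinearSketching (A : StreamAlg) (n s : ℕ) : Prop :=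
  ∃ (M : Type) (_ : AddCommGroup M) (φ : (Fin n → ℤ) →ₗ[ℤ] M) (code : M ↪ Fin (2 ^ s)),
    ∀ σ : TurnstileStream n, ∃ S : ℕ, A.Reaches n S σ (code (φ σ.freq))

end StreamAlg

/-! ## Runs of programs -/

/-! Restricted to the unit updates ±e_i, the algorithm A is a finite automaton with states below T =
2 ^ min s S. Say that x reaches y if some stream of frequency x leads A to y. One vector may reach
many states, but A answers correctly for x in each of them, because it solves P on streams of every
length. So it is enough to find a state p and a subgroup H of ℤ^n all of whose elements reach p. If
L ≤ H has index at most T, the coset of x modulo L can serve as the sketch: walking from p along a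
small representative of the coset ends in a state that x itself reaches (`Machine.R_of_code`), and
there the recovery program of A is run.

The source of H is the pigeonhole principle. Among the words 0, …, T, read as vectors of digits in a
mixed radix, two lead from a state y to the same state. Walk along the larger one and back with
opposite letters: the frequency is unchanged, but the same walk of states is also compatible with a
frequency that differs by the difference v of the two words (`Machine.R_nxt_collision`). If y lies
on a cycle of this operation, going round repeatedly shows that the states reached are insensitive
to -v, -2v, … (`Machine.Inv.R_cyc_sub`). Positive multiples come for free once H contains N ℤ^n for
some N ≥ 1, and a preliminary tour of all letters in both directions achieves that
(`Machine.exists_prelim`).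

Each collision found in this way gives a relation with a leading letter t and a positive leading
coefficient. The coefficient becomes the radix of t, and the relations with larger leading letters
are thrown away. The product of the radices never exceeds T (`Machine.Inv.mstep_rprod_le`), and the
sequence of radices decreases lexicographically (`Machine.msize_mstep`). At the end every letter
leads one relation. These triangular relations generate L, the index is the product of the radices,
and the reduced digit vectors are normal forms (`exists_reduced`, `eq_zero_of_mem_relGroup`).

For the space, collisions are found by exhaustive search with counters, and cycles by Floyd's
algorithm. The n relations together do not fit into memory. Only the radices different from 1 are
stored, about s log n bits in all because their product is at most 2 ^ s, together with a single
relation; any other relation is obtained by repeating the whole construction. An update reads Δ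
modulo the index, adds e_i that many times, and reduces after each addition by one relation at a
time (`Machine.rels`, `Env.reduceCmd_ht`, `Env.updateCmd_ht`). A small Hoare logic `Ht` with a
built-in space bound, and a simulation of A in shifted registers, turn this into programs. -/

theorem Runs.mono {Δ : ℤ} {S S' : ℕ} {p : Cmd} {c c' : Config} (h : Runs Δ S p c c')
    (hS : S ≤ S') : Runs Δ S' p c c' := by
  induction h with
  | instr h h' => exact .instr (h.trans hS) (h'.trans hS)
  | seq _ _ ih ih' => exact .seq ih ih'
  | ite_true hx _ ih => exact .ite_true hx ih
  | ite_false hx _ ih => exact .ite_false hx ih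
  | loop_true hx _ _ ih ih' => exact .loop_true hx ih ih'
  | loop_false hx h => exact .loop_false hx (h.trans hS)

theorem Runs.det {Δ : ℤ} {S S' : ℕ} {p : Cmd} {c c₁ c₂ : Config} (h : Runs Δ S p c c₁)
    (h' : Runs Δ S' p c c₂) : c₁ = c₂ := by
  induction h generalizing c₂ with
  | instr => cases h'; rfl
  | seq _ _ ih ih' => cases h' with | seq g g' => cases ih g; exact ih' g'
  | ite_true hx _ ih =>
    cases h' with
    | ite_true _ g => exact ih g
    | ite_false hx' _ => exact absurd hx' hx
  | ite_false hx _ ih =>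
    cases h' with
    | ite_true hx' g => exact absurd hx hx'
    | ite_false _ g => exact ih g
  | loop_true hx _ _ ih ih' =>
    cases h' with
    | loop_true _ g g' => cases ih g; exact ih' g'
    | loop_false hx' _ => exact absurd hx' hx
  | loop_false hx _ =>
    cases h' with
    | loop_true hx' _ _ => exact absurd hx hx'
    | loop_false _ _ => rfl

theorem Runs.space_start_le {Δ : ℤ} {S : ℕ} {p : Cmd} {c c' : Config} (h : Runs Δ S p c c') :
    c.space ≤ S := by
  induction h <;> assumption

theorem Config.set_reg (c : Config) (x v r : ℕ) :
    (c.set x v).reg r = if r = x then v else c.reg r := by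
  simp [Config.set, Function.update_apply]

@[simp] theorem Config.set_out (c : Config) (x v : ℕ) : (c.set x v).out = c.out := rfl

/-- The space of a configuration whose registers from `58` on hold a copy of the registers of
another configuration. -/
theorem Config.space_le {c a : Config} {b : ℕ} (hlo : ∀ r < 58, c.reg r ≤ b)
    (hhi : ∀ r, c.reg (58 + r) = a.reg r) : c.space ≤ 58 * b.size + a.space := by
  obtain ⟨m, hm⟩ : ∃ m, ∀ r, m ≤ r → a.reg r = 0 := by
    refine ⟨a.reg.support.sup id + 1, fun r hr => ?_⟩
    by_contra h
    have := Finset.le_sup (f := id) (Finsupp.mem_support_iff.2 h)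
    simp only [id] at this
    omega
  have h1 : c.space = ∑ r ∈ Finset.range (58 + m), (c.reg r).size := by
    refine Finsupp.sum_of_support_subset _ (fun r hr => ?_) _ (by simp)
    rw [Finset.mem_range]
    by_contra h
    refine Finsupp.mem_support_iff.1 hr ?_
    rw [show r = 58 + (r - 58) by omega, hhi]
    exact hm _ (by omega)
  have h2 : a.space = ∑ r ∈ Finset.range m, (a.reg r).size := by
    refine Finsupp.sum_of_support_subset _ (fun r hr => ?_) _ (by simp)
    rw [Finset.mem_range]
    by_contra h
    exact Finsupp.mem_support_iff.1 hr (hm _ (by omega))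
  rw [h1, h2, Finset.sum_range_add]
  simp only [hhi]
  refine Nat.add_le_add_right ?_ _
  refine (Finset.sum_le_card_nsmul _ _ b.size fun r hr => ?_).trans (by simp)
  exact Nat.size_le_size (hlo r (Finset.mem_range.1 hr))

theorem startConfig_reg (n y i r : ℕ) :
    (startConfig n y i).reg r = if r = 0 then n else if r = 1 then y else if r = 2 then i else 0 := by
  simp only [startConfig, Finsupp.add_apply, Finsupp.single_apply]
  rcases r with _ | _ | _ | r <;> simp

/-- The dimension and the state sit in registers when a program starts, so `S` bounds both of their
lengths. This is what allows terms in log n and in the state length to be charged to `S`. -/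
theorem size_add_size_le_space (n y i : ℕ) : n.size + y.size ≤ (startConfig n y i).space := by
  have h : (startConfig n y i).space =
      ∑ r ∈ Finset.range 3, ((startConfig n y i).reg r).size := by
    refine Finsupp.sum_of_support_subset _ (fun r hr => ?_) _ (by simp)
    rw [Finset.mem_range]
    by_contra h
    refine Finsupp.mem_support_iff.1 hr ?_
    rw [startConfig_reg]
    simp only [show r ≠ 0 by omega, show r ≠ 1 by omega, show r ≠ 2 by omega, if_false]
  rw [h]
  simp [Finset.sum_range_succ, startConfig_reg]

/-! ## Simulation of a program on a short input tape -/

/-- `p ;; q` runs `p` and then `q`. -/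
infixr:60 " ;; " => Cmd.seq

/-- Register `56` holds the simulated head, register `57` is scratch, and the registers of the
simulated program are shifted by `58`. -/
def simInstr (Δ₀ : ℤ) (w : Bool) : Instr → Cmd
  | .const x k => .instr (.const (58 + x) k)
  | .copy x y => .instr (.copy (58 + x) (58 + y))
  | .arith o x y z => .instr (.arith o (58 + x) (58 + y) (58 + z))
  | .read x =>
      .ite 56
        (.instr (.const 57 1) ;; .instr (.arith .sub 57 56 57) ;;
          .ite 57 (.instr (.const (58 + x) 2)) (.instr (.const (58 + x) (inputSymbol Δ₀ 1))))
        (.instr (.const (58 + x) (inputSymbol Δ₀ 0)))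
  | .moveLeft => .instr (.const 57 1) ;; .instr (.arith .sub 56 56 57)
  | .moveRight =>
      .instr (.const 57 1) ;; .instr (.arith .add 56 56 57) ;;
        .instr (.const 57 (Δ₀.natAbs.size + 1)) ;; .instr (.arith .sub 57 56 57) ;;
          .instr (.arith .sub 56 56 57)
  | .write x => if w then .instr (.write (58 + x)) else .instr (.copy 57 57)

/-- The simulated input `Δ₀` is hard-wired into the code, so the real input head is never touched.
With `w = false` the output of the simulated program is suppressed. -/
def simCmd (Δ₀ : ℤ) (w : Bool) : Cmd → Cmd
  | .instr a => simInstr Δ₀ w a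
  | .seq p q => .seq (simCmd Δ₀ w p) (simCmd Δ₀ w q)
  | .ite x p q => .ite (58 + x) (simCmd Δ₀ w p) (simCmd Δ₀ w q)
  | .loop x p => .loop (58 + x) (simCmd Δ₀ w p)

/-- The configuration `c` simulates the configuration `a`. -/
structure Simulates (b : ℕ) (w : Bool) (base : ℕ → ℕ) (h₀ : ℕ) (c a : Config) : Prop where
  lo : ∀ r < 56, c.reg r = base r
  head_reg : c.reg 56 = a.head
  scratch : c.reg 57 ≤ b
  hi : ∀ r, c.reg (58 + r) = a.reg r
  head : c.head = h₀
  out : c.out = if w then a.out else []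
  head_le : a.head ≤ 2

section Simulation

variable {Δ Δ₀ : ℤ} {b S : ℕ} {w : Bool} {base : ℕ → ℕ} {h₀ : ℕ}

theorem Simulates.space_le (hb : 3 ≤ b) (hbase : ∀ r < 56, base r ≤ b) {c a : Config}
    (h : Simulates b w base h₀ c a) : c.space ≤ 58 * b.size + a.space := by
  refine Config.space_le (fun r hr => ?_) h.hi
  rcases (by omega : r < 56 ∨ r = 56 ∨ r = 57) with h' | rfl | rfl
  · rw [h.lo r h']; exact hbase r h'
  · rw [h.head_reg]; have := h.head_le; omega
  · exact h.scratch

theorem runs_instr_of_le {a : Instr} {c c' : Config} (hc : a.step Δ c = c') (h : c.space ≤ S)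
    (h' : c'.space ≤ S) : Runs Δ S (.instr a) c c' := by
  subst hc; exact .instr h h'

theorem simulates_set {c a : Config} (h : Simulates b w base h₀ c a) (x v : ℕ) :
    Simulates b w base h₀ (c.set (58 + x) v) (a.set x v) where
  lo r hr := by rw [Config.set_reg, if_neg (by omega)]; exact h.lo r hr
  head_reg := by rw [Config.set_reg, if_neg (by omega)]; exact h.head_reg
  scratch := by rw [Config.set_reg, if_neg (by omega)]; exact h.scratch
  hi r := by simp only [Config.set_reg, Nat.add_left_cancel_iff, h.hi]
  head := h.head
  out := h.out
  head_le := h.head_le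

theorem simulates_scratch {c a : Config} (h : Simulates b w base h₀ c a) {v : ℕ} (hv : v ≤ b) :
    Simulates b w base h₀ (c.set 57 v) a where
  lo r hr := by rw [Config.set_reg, if_neg (by omega)]; exact h.lo r hr
  head_reg := by rw [Config.set_reg, if_neg (by omega)]; exact h.head_reg
  scratch := by rw [Config.set_reg, if_pos rfl]; exact hv
  hi r := by rw [Config.set_reg, if_neg (by omega)]; exact h.hi r
  head := h.head
  out := h.out
  head_le := h.head_le

theorem simulates_head {c a : Config} (h : Simulates b w base h₀ c a) {v : ℕ} (hv : v ≤ 2) :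
    Simulates b w base h₀ (c.set 56 v) { a with head := v } where
  lo r hr := by rw [Config.set_reg, if_neg (by omega)]; exact h.lo r hr
  head_reg := by rw [Config.set_reg, if_pos rfl]
  scratch := by rw [Config.set_reg, if_neg (by omega)]; exact h.scratch
  hi r := by rw [Config.set_reg, if_neg (by omega)]; exact h.hi r
  head := h.head
  out := h.out
  head_le := hv

theorem inputSymbol_two (hΔ : Δ₀.natAbs ≤ 1) {h : ℕ} (hh : 2 ≤ h) : inputSymbol Δ₀ h = 2 := by
  have : Δ₀.natAbs.size ≤ 1 := by
    rw [Nat.size_le]; omega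
  rw [inputSymbol, if_neg (by omega), if_neg (by omega)]

theorem simInstr_runs (hΔ : Δ₀.natAbs ≤ 1) (hb : 3 ≤ b) (hbase : ∀ r < 56, base r ≤ b)
    {i : Instr} {a c : Config} (hs : a.space ≤ S) (hs' : (i.step Δ₀ a).space ≤ S)
    (h : Simulates b w base h₀ c a) :
    ∃ c', Runs Δ (58 * b.size + S) (simInstr Δ₀ w i) c c' ∧
      Simulates b w base h₀ c' (i.step Δ₀ a) := by
  have hsize : Δ₀.natAbs.size ≤ 1 := by rw [Nat.size_le]; omega
  have key : ∀ {c a : Config}, Simulates b w base h₀ c a → a.space ≤ S →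
      c.space ≤ 58 * b.size + S := fun h hs =>
    (h.space_le hb hbase).trans (Nat.add_le_add_left hs _)
  have one : ∀ {j : Instr} {c c' a a' : Config}, Simulates b w base h₀ c a → a.space ≤ S →
      Simulates b w base h₀ c' a' → a'.space ≤ S → j.step Δ c = c' →
      Runs Δ (58 * b.size + S) (.instr j) c c' := fun h hs h' hs' e =>
    runs_instr_of_le e (key h hs) (key h' hs')
  have hl := h.head_le
  cases i with
  | const x k =>
    exact ⟨_, one h hs (simulates_set h x k) hs' rfl, simulates_set h x k⟩
  | copy x y =>
    refine ⟨_, one h hs (simulates_set h x (a.reg y)) hs' ?_, simulates_set h x _⟩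
    simp [Instr.step, h.hi]
  | arith o x y z =>
    refine ⟨_, one h hs (simulates_set h x (o.eval (a.reg y) (a.reg z))) hs' ?_,
      simulates_set h x _⟩
    simp [Instr.step, h.hi]
  | read x =>
    have h2 := simulates_set h x (inputSymbol Δ₀ a.head)
    by_cases h0 : a.head = 0
    · refine ⟨_, .ite_false (by rw [h.head_reg, h0]) (one h hs h2 hs' ?_), h2⟩
      simp [Instr.step, h0]
    · have g1 := simulates_scratch h (v := 1) (by omega)
      have g2 := simulates_scratch g1 (v := a.head - 1) (by omega)
      have g3 := simulates_set g2 x (inputSymbol Δ₀ a.head)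
      refine ⟨_, .ite_true (by rw [h.head_reg]; exact h0) (.seq (one h hs g1 hs rfl)
        (.seq (one g1 hs g2 hs ?_) ?_)), g3⟩
      · simp [Instr.step, ArithOp.eval, Config.set_reg, h.head_reg]
      · by_cases h1 : a.head = 1
        · refine .ite_false (by simp [Config.set_reg, h1]) (one g2 hs g3 hs' ?_)
          simp [Instr.step, h1]
        · refine .ite_true ?_ (one g2 hs g3 hs' ?_)
          · simp [Config.set_reg]; omega
          · simp [Instr.step, inputSymbol_two hΔ (show 2 ≤ a.head by omega)]
  | moveLeft =>
    have g1 := simulates_scratch h (v := 1) (by omega)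
    have g2 := simulates_head g1 (v := a.head - 1) (by omega)
    refine ⟨_, .seq (one h hs g1 hs rfl) (one g1 hs g2 hs' ?_), g2⟩
    simp [Instr.step, ArithOp.eval, Config.set_reg, h.head_reg]
  | moveRight =>
    set m := Δ₀.natAbs.size + 1 with hm
    have g1 := simulates_scratch h (v := 1) (by omega)
    -- Between the increment and its truncation the simulated head may stand at 3. Such
    -- configurations simulate nothing, so their space is bounded directly.
    have sp : ∀ v₁ v₂ : ℕ, v₁ ≤ 3 → v₂ ≤ b →
        ((c.set 56 v₁).set 57 v₂).space ≤ 58 * b.size + S := by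
      intro v₁ v₂ h1 h2
      refine (Config.space_le (a := a) (fun r hr => ?_) fun r => ?_).trans
        (Nat.add_le_add_left hs _)
      · rw [Config.set_reg, Config.set_reg]
        split_ifs with e1 e2
        · exact h2
        · omega
        · rw [h.lo r (by omega)]; exact hbase r (by omega)
      · simp only [Config.set_reg]
        rw [if_neg (by omega), if_neg (by omega)]
        exact h.hi r
    have swap : ∀ v₁ v₂ v₃ : ℕ, ((c.set 57 v₁).set 56 v₂).set 57 v₃ = (c.set 56 v₂).set 57 v₃ := by
      intro v₁ v₂ v₃
      simp only [Config.set, Config.mk.injEq, and_self, and_true]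
      ext r
      simp only [Finsupp.coe_update, Function.update_apply]
      split_ifs <;> rfl
    have swap' : ∀ v₁ v₂ : ℕ, (c.set 57 v₁).set 56 v₂ = (c.set 56 v₂).set 57 v₁ := by
      intro v₁ v₂
      simp only [Config.set, Config.mk.injEq, and_self, and_true]
      ext r
      simp only [Finsupp.coe_update, Function.update_apply]
      split_ifs <;> first | rfl | omega
    have g3 := simulates_scratch (simulates_head h (v := min (a.head + 1) m) (by omega))
      (v := a.head + 1 - m) (by omega)
    refine ⟨_, .seq (one h hs g1 hs rfl) (.seq (c' := (c.set 57 1).set 56 (a.head + 1))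
      (runs_instr_of_le ?_ (key g1 hs) ?_)
      (.seq (c' := (c.set 56 (a.head + 1)).set 57 m) (runs_instr_of_le ?_ ?_ (sp _ _ ?_ ?_))
      (.seq (c' := (c.set 56 (a.head + 1)).set 57 (a.head + 1 - m)) (runs_instr_of_le ?_
        (sp _ _ ?_ ?_) (sp _ _ ?_ ?_))
      (runs_instr_of_le (c' := (c.set 56 (min (a.head + 1) m)).set 57 (a.head + 1 - m)) ?_
        (sp _ _ ?_ ?_) (sp _ _ ?_ ?_))))), g3⟩
    any_goals omega
    · simp [Instr.step, ArithOp.eval, Config.set_reg, h.head_reg]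
    · rw [swap']; exact sp _ _ (by omega) (by omega)
    · simp only [Instr.step, ← hm]; rw [swap]
    · rw [swap']; exact sp _ _ (by omega) (by omega)
    · simp only [Instr.step, ArithOp.eval, Config.set_reg]
      simp only [Config.set, Config.mk.injEq, and_true]
      ext r
      simp only [Finsupp.coe_update, Function.update_apply]
      split_ifs <;> first | rfl | omega
    · simp only [Instr.step, ArithOp.eval, Config.set_reg]
      simp only [Config.set, Config.mk.injEq, and_true]
      ext r
      simp only [Finsupp.coe_update, Function.update_apply]
      split_ifs <;> first | rfl | omega
  | write x =>
    cases w with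
    | false =>
      refine ⟨_, one h hs (simulates_scratch h h.scratch) hs rfl, ?_⟩
      have g := simulates_scratch h h.scratch
      exact { g with }
    | true =>
      have g : Simulates b true base h₀ { c with out := c.out ++ [decide (c.reg (58 + x) ≠ 0)] }
          { a with out := a.out ++ [decide (a.reg x ≠ 0)] } :=
        { h with out := by rw [h.out, h.hi]; rfl }
      exact ⟨_, one h hs g hs' rfl, g⟩

theorem simCmd_runs (hΔ : Δ₀.natAbs ≤ 1) (hb : 3 ≤ b) (hbase : ∀ r < 56, base r ≤ b)
    {p : Cmd} {a a' c : Config} (hp : Runs Δ₀ S p a a') (h : Simulates b w base h₀ c a) :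
    ∃ c', Runs Δ (58 * b.size + S) (simCmd Δ₀ w p) c c' ∧ Simulates b w base h₀ c' a' := by
  induction hp generalizing c with
  | instr hs hs' => exact simInstr_runs hΔ hb hbase hs hs' h
  | seq _ _ ih ih' =>
    obtain ⟨c₁, r₁, h₁⟩ := ih h
    obtain ⟨c₂, r₂, h₂⟩ := ih' h₁
    exact ⟨c₂, .seq r₁ r₂, h₂⟩
  | ite_true hx _ ih =>
    obtain ⟨c₁, r₁, h₁⟩ := ih h
    exact ⟨c₁, .ite_true (by rwa [h.hi]) r₁, h₁⟩
  | ite_false hx _ ih =>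
    obtain ⟨c₁, r₁, h₁⟩ := ih h
    exact ⟨c₁, .ite_false (by rwa [h.hi]) r₁, h₁⟩
  | loop_true hx _ _ ih ih' =>
    obtain ⟨c₁, r₁, h₁⟩ := ih h
    obtain ⟨c₂, r₂, h₂⟩ := ih' h₁
    exact ⟨c₂, .loop_true (by rwa [h.hi]) r₁ r₂, h₂⟩
  | loop_false hx hs =>
    exact ⟨c, .loop_false (by rwa [h.hi])
      ((h.space_le hb hbase).trans (Nat.add_le_add_left hs _)), h⟩

end Simulation

/-- A strict bound on the registers that a program may change. -/
def Cmd.regBound : Cmd → ℕ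
  | .instr (.const x _) => x + 1
  | .instr (.copy x _) => x + 1
  | .instr (.arith _ x _ _) => x + 1
  | .instr (.read x) => x + 1
  | .instr _ => 0
  | .seq p q => max p.regBound q.regBound
  | .ite _ p q => max p.regBound q.regBound
  | .loop _ p => p.regBound

/-- A syntactic bound suffices to know which registers a call may leave dirty, so that finitely many
instructions can clean up after it. -/
theorem Runs.reg_eq {Δ : ℤ} {S : ℕ} {p : Cmd} {c c' : Config} (h : Runs Δ S p c c') {r : ℕ}
    (hr : p.regBound ≤ r) : c'.reg r = c.reg r := by
  induction h with
  | @instr i c _ _ =>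
    cases i <;> simp only [Cmd.regBound] at hr <;>
      simp only [Instr.step, Config.set_reg] <;> try rw [if_neg (by omega)]
  | seq _ _ ih ih' =>
    simp only [Cmd.regBound, max_le_iff] at hr
    rw [ih' hr.2, ih hr.1]
  | ite_true _ _ ih => exact ih (le_of_max_le_left hr)
  | ite_false _ _ ih => exact ih (le_of_max_le_right hr)
  | loop_true _ _ _ ih ih' => rw [ih' hr, ih hr]
  | loop_false => rfl

/-! ## Expressions and a program logic -/

/-- Arithmetic expressions in registers. -/
inductive Ex
  | reg (x : ℕ)
  | const (k : ℕ)
  | op (o : ArithOp) (a b : Ex)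

namespace Ex

instance : Add Ex := ⟨op .add⟩
instance : Sub Ex := ⟨op .sub⟩
instance : Mul Ex := ⟨op .mul⟩
instance : Div Ex := ⟨op .div⟩
instance : Mod Ex := ⟨op .mod⟩
instance (k : ℕ) : OfNat Ex k := ⟨const k⟩

def eval (σ : ℕ → ℕ) : Ex → ℕ
  | reg x => σ x
  | const k => k
  | op o a b => o.eval (a.eval σ) (b.eval σ)

section
variable (σ : ℕ → ℕ) (a b : Ex)
@[simp] theorem eval_reg (x : ℕ) : (reg x).eval σ = σ x := rfl
@[simp] theorem eval_zero : (0 : Ex).eval σ = 0 := rfl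
@[simp] theorem eval_one : (1 : Ex).eval σ = 1 := rfl
@[simp] theorem eval_two : (2 : Ex).eval σ = 2 := rfl
@[simp] theorem eval_three : (3 : Ex).eval σ = 3 := rfl
@[simp] theorem eval_add : (a + b).eval σ = a.eval σ + b.eval σ := rfl
@[simp] theorem eval_sub : (a - b).eval σ = a.eval σ - b.eval σ := rfl
@[simp] theorem eval_mul : (a * b).eval σ = a.eval σ * b.eval σ := rfl
@[simp] theorem eval_div : (a / b).eval σ = a.eval σ / b.eval σ := rfl
@[simp] theorem eval_mod : (a % b).eval σ = a.eval σ % b.eval σ := rfl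
end

/-- Code that evaluates an expression into register `d`, with the registers above `d` as scratch. -/
def code : Ex → ℕ → Cmd
  | reg x, d => .instr (.copy d x)
  | const k, d => .instr (.const d k)
  | op o a b, d => a.code d ;; b.code (d + 1) ;; .instr (.arith o d d (d + 1))

/-- All values in the evaluation of `e` are at most `Z ^ e.deg` if the registers are at most `Z`. -/
def deg : Ex → ℕ
  | reg x => if x = 3 ∨ 48 ≤ x then 9 else 1
  | const k => if k ≤ 4 then 1 else 9
  | op .add a b => max a.deg b.deg + 1
  | op .mul a b => a.deg + b.deg
  | op _ a b => max a.deg b.deg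

/-- The number of scratch registers in use. -/
def depth : Ex → ℕ
  | op _ a b => max a.depth (1 + b.depth)
  | _ => 1

/-- Intermediate values stay below `Z ^ 4` and the scratch registers used from 48 on stay below 56.
Being Boolean, the condition is discharged by `rfl` for each concrete program. -/
def ok (e : Ex) : Bool := decide (e.deg ≤ 4) && decide (e.depth ≤ 8)

end Ex

open Ex (reg)

def upd (σ : ℕ → ℕ) (x v : ℕ) : ℕ → ℕ := fun y => if y = x then v else σ y

/-- The registers below `48`, except `3`, have the values `σ`, and `σ 3` is the position of the
head.  Registers from `48` to `57` are scratch, and those from `58` on are empty. -/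
structure Holds (Z : ℕ) (c : Config) (σ : ℕ → ℕ) : Prop where
  val : ∀ v < 48, v ≠ 3 → c.reg v = σ v
  le : ∀ v < 48, v ≠ 3 → σ v ≤ Z
  three : c.reg 3 = 0
  tmp : ∀ v, 48 ≤ v → v < 58 → c.reg v ≤ Z ^ 4
  hi : ∀ r, c.reg (58 + r) = 0
  head : c.head = σ 3
  out : c.out = []

/-- Started from registers `σ`, the program `p` halts with registers that satisfy `Q`. -/
def Ht (Δ : ℤ) (Z S : ℕ) (p : Cmd) (σ : ℕ → ℕ) (Q : (ℕ → ℕ) → Prop) : Prop :=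
  ∀ c, Holds Z c σ → ∃ c' σ', Runs Δ (58 * (Z ^ 4).size + S) p c c' ∧ Holds Z c' σ' ∧ Q σ'

section Logic

variable {Δ : ℤ} {Z S : ℕ} {σ : ℕ → ℕ} {p q : Cmd} {Q Q' : (ℕ → ℕ) → Prop}

theorem Holds.le_pow {c : Config} (h : Holds Z c σ) {r : ℕ} (hr : r < 58) :
    c.reg r ≤ Z ^ 4 := by
  have h1 : Z ≤ Z ^ 4 := Nat.le_self_pow (by norm_num) Z
  by_cases h3 : r = 3
  · rw [h3, h.three]; exact Nat.zero_le _
  · by_cases h48 : r < 48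
    · rw [h.val r h48 h3]; exact (h.le r h48 h3).trans h1
    · exact h.tmp r (by omega) hr

theorem Holds.space_le {c : Config} (h : Holds Z c σ) :
    c.space ≤ 58 * (Z ^ 4).size + S := by
  refine (Config.space_le (a := ⟨0, 0, []⟩) (fun r hr => h.le_pow hr) fun r => ?_).trans ?_
  · simpa using h.hi r
  · simp [Config.space]

theorem Holds.runs {σ' : ℕ → ℕ} {c : Config} {i : Instr} (h : Holds Z c σ)
    (h' : Holds Z (i.step Δ c) σ') :
    Runs Δ (58 * (Z ^ 4).size + S) (.instr i) c (i.step Δ c) :=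
  .instr h.space_le h'.space_le

theorem Holds.set_tmp {c : Config} (h : Holds Z c σ) {d v : ℕ} (hd : 48 ≤ d) (hd' : d < 58)
    (hv : v ≤ Z ^ 4) : Holds Z (c.set d v) σ where
  val r hr h3 := by rw [Config.set_reg, if_neg (by omega)]; exact h.val r hr h3
  le := h.le
  three := by rw [Config.set_reg, if_neg (by omega)]; exact h.three
  tmp r hr hr' := by
    rw [Config.set_reg]; split_ifs
    · exact hv
    · exact h.tmp r hr hr'
  hi r := by rw [Config.set_reg, if_neg (by omega)]; exact h.hi r
  head := h.head
  out := h.out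

theorem Holds.set {c : Config} (h : Holds Z c σ) {x v : ℕ} (hx : x < 48) (h3 : x ≠ 3)
    (hv : v ≤ Z) : Holds Z (c.set x v) (upd σ x v) where
  val r hr h3 := by
    rw [Config.set_reg, upd]; split_ifs
    · rfl
    · exact h.val r hr h3
  le r hr h3 := by
    rw [upd]; split_ifs
    · exact hv
    · exact h.le r hr h3
  three := by rw [Config.set_reg, if_neg (by omega)]; exact h.three
  tmp r hr hr' := by rw [Config.set_reg, if_neg (by omega)]; exact h.tmp r hr hr'
  hi r := by rw [Config.set_reg, if_neg (by omega)]; exact h.hi r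
  head := by rw [upd, if_neg (by omega)]; exact h.head
  out := h.out

theorem Ex.eval_le (hZ : 4 ≤ Z) (hσ : ∀ v < 48, v ≠ 3 → σ v ≤ Z) :
    ∀ e : Ex, e.deg < 9 → e.eval σ ≤ Z ^ e.deg
  | reg x, h => by
    simp only [deg] at h ⊢
    split_ifs at h ⊢ with hx
    · omega
    · simpa using hσ x (by omega) (by omega)
  | const k, h => by
    simp only [deg] at h ⊢
    split_ifs at h ⊢ with hk
    · simpa [eval] using hk.trans hZ
    · omega
  | op o a b, h => by
    have hmax : ∀ {d : ℕ}, d ≤ max a.deg b.deg → Z ^ d ≤ Z ^ max a.deg b.deg := fun h =>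
      Nat.pow_le_pow_right (by omega) h
    have left : a.deg < 9 → a.eval σ ≤ Z ^ max a.deg b.deg := fun ha =>
      (eval_le hZ hσ a ha).trans (hmax (le_max_left _ _))
    cases o with
    | add =>
      simp only [deg] at h ⊢
      have ha := left (by omega)
      have hb := (eval_le hZ hσ b (by omega)).trans (hmax (le_max_right a.deg b.deg))
      calc a.eval σ + b.eval σ ≤ Z ^ max a.deg b.deg * 2 := by omega
        _ ≤ Z ^ (max a.deg b.deg + 1) := by
          rw [pow_succ]; exact Nat.mul_le_mul_left _ (by omega)
    | mul =>
      simp only [deg] at h ⊢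
      rw [pow_add]
      exact Nat.mul_le_mul (eval_le hZ hσ a (by omega)) (eval_le hZ hσ b (by omega))
    | sub => exact (Nat.sub_le _ _).trans (left (by simp only [deg] at h; omega))
    | div => exact (Nat.div_le_self _ _).trans (left (by simp only [deg] at h; omega))
    | mod => exact (Nat.mod_le _ _).trans (left (by simp only [deg] at h; omega))

theorem Ex.deg_left_le (o : ArithOp) (a b : Ex) : a.deg ≤ (op o a b).deg := by
  cases o <;> simp only [deg] <;> omega

theorem Ex.deg_right_le (o : ArithOp) (a b : Ex) : b.deg ≤ (op o a b).deg := by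
  cases o <;> simp only [deg] <;> omega

/-- The last conjunct makes the induction work: the right operand is evaluated from `d + 1` on and
leaves the left value in `d` alone. -/
theorem Ex.code_runs (hZ : 4 ≤ Z) : ∀ (e : Ex) (d : ℕ) (c : Config), e.deg ≤ 4 → 48 ≤ d →
    d + e.depth ≤ 56 → Holds Z c σ → ∃ c', Runs Δ (58 * (Z ^ 4).size + S) (e.code d) c c' ∧
      Holds Z c' σ ∧ c'.reg d = e.eval σ ∧ ∀ r, r < d → c'.reg r = c.reg r
  | reg x, d, c, hdeg, hd, hd', h => by
    simp only [deg] at hdeg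
    simp only [depth] at hd'
    split_ifs at hdeg with hx
    · omega
    have hv := h.val x (by omega) (by omega)
    have h' := h.set_tmp hd (by omega) (h.le_pow (show x < 58 by omega))
    refine ⟨_, h.runs (i := .copy d x) h', h', ?_, fun r hr => ?_⟩
    · simp [Instr.step, Config.set_reg, eval, hv]
    · simp only [Instr.step, Config.set_reg]; rw [if_neg (by omega)]
  | const k, d, c, hdeg, hd, hd', h => by
    simp only [deg] at hdeg
    simp only [depth] at hd'
    split_ifs at hdeg with hk
    · have h' := h.set_tmp hd (by omega)
        ((hk.trans hZ).trans (Nat.le_self_pow (by norm_num : (4 : ℕ) ≠ 0) Z))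
      refine ⟨_, h.runs (i := .const d k) h', h', ?_, fun r hr => ?_⟩
      · simp [Instr.step, Config.set_reg, eval]
      · simp only [Instr.step, Config.set_reg]; rw [if_neg (by omega)]
    · omega
  | op o a b, d, c, hdeg, hd, hd', h => by
    have hev : (op o a b).eval σ ≤ Z ^ 4 := (eval_le hZ h.le _ (by omega)).trans
      (Nat.pow_le_pow_right (by omega) hdeg)
    simp only [depth] at hd'
    obtain ⟨c₁, r₁, h₁, v₁, f₁⟩ := code_runs hZ a d c ((deg_left_le o a b).trans hdeg) hd
      (by omega) h
    obtain ⟨c₂, r₂, h₂, v₂, f₂⟩ := code_runs hZ b (d + 1) c₁ ((deg_right_le o a b).trans hdeg)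
      (by omega) (by omega) h₁
    have e : o.eval (c₂.reg d) (c₂.reg (d + 1)) = (op o a b).eval σ := by
      rw [v₂, f₂ d (by omega), v₁]; rfl
    have hb : 1 ≤ b.depth := by cases b <;> simp only [depth] <;> omega
    have h' := h₂.set_tmp hd (by omega) (e ▸ hev)
    refine ⟨_, .seq r₁ (.seq r₂ (h₂.runs (i := .arith o d d (d + 1)) h')), h', ?_,
      fun r hr => ?_⟩
    · simp only [Instr.step, Config.set_reg, if_pos]; exact e
    · simp only [Instr.step, Config.set_reg]
      rw [if_neg (by omega), f₂ r (by omega), f₁ r hr]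

theorem Ex.code_runs_of_ok (hZ : 4 ≤ Z) {e : Ex} (he : e.ok = true) {c : Config}
    (h : Holds Z c σ) : ∃ c', Runs Δ (58 * (Z ^ 4).size + S) (e.code 48) c c' ∧
      Holds Z c' σ ∧ c'.reg 48 = e.eval σ := by
  simp only [ok, Bool.and_eq_true, decide_eq_true_eq] at he
  obtain ⟨c', r, h', v, _⟩ := code_runs hZ e 48 c he.1 le_rfl (by omega) h
  exact ⟨c', r, h', v⟩

/-- Assignment of the value of an expression to a register. -/
def asg (x : ℕ) (e : Ex) : Cmd := e.code 48 ;; .instr (.copy x 48)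

/-- Conditional execution. -/
def branch (e : Ex) (p q : Cmd) : Cmd := e.code 48 ;; .ite 48 p q

/-- Run `p` as long as the value of `e` is not zero. -/
def whl (e : Ex) (p : Cmd) : Cmd := e.code 48 ;; .loop 48 (p ;; e.code 48)

def nop : Cmd := .instr (.const 57 0)

theorem Ht.mono (h : Ht Δ Z S p σ Q) (hQ : ∀ σ', Q σ' → Q' σ') : Ht Δ Z S p σ Q' := by
  intro c hc
  obtain ⟨c', σ', r, h', q⟩ := h c hc
  exact ⟨c', σ', r, h', hQ _ q⟩

theorem Ht.seq (h : Ht Δ Z S p σ fun σ' => Ht Δ Z S q σ' Q) : Ht Δ Z S (p ;; q) σ Q := by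
  intro c hc
  obtain ⟨c₁, σ₁, r₁, h₁, q₁⟩ := h c hc
  obtain ⟨c₂, σ₂, r₂, h₂, q₂⟩ := q₁ c₁ h₁
  exact ⟨c₂, σ₂, .seq r₁ r₂, h₂, q₂⟩

theorem Ht.nop (h : Q σ) : Ht Δ Z S nop σ Q := fun c hc =>
  have hc' := hc.set_tmp (d := 57) (by norm_num) (by norm_num) (Nat.zero_le (Z ^ 4))
  ⟨_, σ, hc.runs (i := .const 57 0) hc', hc', h⟩

theorem Ht.asg (hZ : 4 ≤ Z) {x : ℕ} {e : Ex} (he : (e.ok && decide (x < 48 ∧ x ≠ 3)) = true)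
    (hv : (∀ v < 48, v ≠ 3 → σ v ≤ Z) → e.eval σ ≤ Z) (hQ : Q (upd σ x (e.eval σ))) :
    Ht Δ Z S (asg x e) σ Q := by
  intro c hc
  rw [Bool.and_eq_true, decide_eq_true_eq] at he
  obtain ⟨c', r, h', v⟩ := Ex.code_runs_of_ok (Δ := Δ) (S := S) hZ he.1 hc
  have h'' := h'.set he.2.1 he.2.2 (hv hc.le)
  rw [← v] at h''
  exact ⟨_, _, .seq r (h'.runs (i := .copy x 48) h''), h'', v ▸ hQ⟩

theorem Ht.branch (hZ : 4 ≤ Z) {e : Ex} (he : e.ok = true)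
    (hp : e.eval σ ≠ 0 → Ht Δ Z S p σ Q) (hq : e.eval σ = 0 → Ht Δ Z S q σ Q) :
    Ht Δ Z S (branch e p q) σ Q := by
  intro c hc
  obtain ⟨c', r, h', v⟩ := Ex.code_runs_of_ok (Δ := Δ) (S := S) hZ he hc
  by_cases h0 : e.eval σ = 0
  · obtain ⟨c₂, σ₂, r₂, h₂, q₂⟩ := hq h0 c' h'
    exact ⟨c₂, σ₂, .seq r (.ite_false (v.trans h0) r₂), h₂, q₂⟩
  · obtain ⟨c₂, σ₂, r₂, h₂, q₂⟩ := hp h0 c' h'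
    exact ⟨c₂, σ₂, .seq r (.ite_true (v ▸ h0) r₂), h₂, q₂⟩

theorem Ht.whl_done (hZ : 4 ≤ Z) {e : Ex} (he : e.ok = true) (h0 : e.eval σ = 0) (hQ : Q σ) :
    Ht Δ Z S (whl e p) σ Q := by
  intro c hc
  obtain ⟨c', r, h', v⟩ := Ex.code_runs_of_ok (Δ := Δ) (S := S) hZ he hc
  exact ⟨c', σ, .seq r (.loop_false (v.trans h0) h'.space_le), h', hQ⟩

theorem Ht.whl_step (hZ : 4 ≤ Z) {e : Ex} (he : e.ok = true) (h0 : e.eval σ ≠ 0)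
    (h : Ht Δ Z S p σ fun σ' => Ht Δ Z S (whl e p) σ' Q) : Ht Δ Z S (whl e p) σ Q := by
  intro c hc
  obtain ⟨c', r, h', v⟩ := Ex.code_runs_of_ok (Δ := Δ) (S := S) hZ he hc
  obtain ⟨c₁, σ₁, r₁, h₁, q₁⟩ := h c' h'
  obtain ⟨c₂, σ₂, r₂, h₂, q₂⟩ := q₁ c₁ h₁
  cases r₂ with
  | seq s s' => exact ⟨c₂, σ₂, .seq r (.loop_true (v ▸ h0) (.seq r₁ s) s'), h₂, q₂⟩

/-- A loop with an invariant `I` and a variant. -/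
theorem Ht.whl (hZ : 4 ≤ Z) {e : Ex} (he : e.ok = true) (I : ℕ → (ℕ → ℕ) → Prop) {m : ℕ}
    (hI : I m σ)
    (hp : ∀ m σ, I m σ → e.eval σ ≠ 0 → Ht Δ Z S p σ fun σ' => ∃ m' < m, I m' σ')
    (hQ : ∀ m σ, I m σ → e.eval σ = 0 → Q σ) : Ht Δ Z S (whl e p) σ Q := by
  induction m using Nat.strong_induction_on generalizing σ with
  | _ m ih =>
    by_cases h0 : e.eval σ = 0
    · exact .whl_done hZ he h0 (hQ m σ hI h0)
    · refine .whl_step hZ he h0 ((hp m σ hI h0).mono ?_)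
      rintro σ' ⟨m', hm', hI'⟩
      exact ih m' hm' hI'

/-- The real register 3 is always empty; its slot in `σ` is a ghost variable for the head. -/
theorem Ht.moveLeft (hQ : Q (upd σ 3 (σ 3 - 1))) :
    Ht Δ Z S (.instr .moveLeft) σ Q := by
  intro c hc
  have h' : Holds Z (Instr.moveLeft.step Δ c) (upd σ 3 (σ 3 - 1)) :=
    { val := fun r hr h3 => by rw [upd, if_neg h3]; exact hc.val r hr h3
      le := fun r hr h3 => by rw [upd, if_neg h3]; exact hc.le r hr h3
      three := hc.three
      tmp := hc.tmp
      hi := hc.hi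
      head := by simp [Instr.step, upd, hc.head]
      out := hc.out }
  exact ⟨_, _, hc.runs h', h', hQ⟩

theorem Ht.moveRight (hQ : Q (upd σ 3 (min (σ 3 + 1) (Δ.natAbs.size + 1)))) :
    Ht Δ Z S (.instr .moveRight) σ Q := by
  intro c hc
  have h' : Holds Z (Instr.moveRight.step Δ c)
      (upd σ 3 (min (σ 3 + 1) (Δ.natAbs.size + 1))) :=
    { val := fun r hr h3 => by rw [upd, if_neg h3]; exact hc.val r hr h3
      le := fun r hr h3 => by rw [upd, if_neg h3]; exact hc.le r hr h3
      three := hc.three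
      tmp := hc.tmp
      hi := hc.hi
      head := by simp [Instr.step, upd, hc.head]
      out := hc.out }
  exact ⟨_, _, hc.runs h', h', hQ⟩

theorem inputSymbol_le (Δ : ℤ) (h : ℕ) : inputSymbol Δ h ≤ 4 := by
  unfold inputSymbol
  split_ifs <;> first | omega | exact (Bool.toNat_le _).trans (by norm_num)

theorem Ht.read (hZ : 4 ≤ Z) {x : ℕ} (hx : x < 48 ∧ x ≠ 3)
    (hQ : Q (upd σ x (inputSymbol Δ (σ 3)))) : Ht Δ Z S (.instr (.read x)) σ Q := by
  intro c hc
  have h' := hc.set hx.1 hx.2 ((inputSymbol_le Δ c.head).trans hZ)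
  exact ⟨_, _, hc.runs (i := .read x) h', h', hc.head ▸ hQ⟩

/-! ### Calls of a simulated program -/

/-- Prepare the registers of the simulated program. -/
def enter : Cmd :=
  .instr (.copy 58 0) ;; .instr (.copy 59 42) ;; .instr (.copy 60 41) ;; .instr (.const 56 0)

/-- Empty the first `m` registers of the simulated program. -/
def clear : ℕ → Cmd
  | 0 => nop
  | m + 1 => .instr (.const (58 + m) 0) ;; clear m

/-- Simulate `p` on dimension, state and index in registers `0`, `42`, `41`, and put the new state
into register `42`. -/
def call (Δ₀ : ℤ) (p : Cmd) : Cmd :=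
  enter ;; simCmd Δ₀ false p ;; .instr (.copy 42 59) ;; clear (max 3 p.regBound)

theorem Config.space_mono {a a' : Config} (h : ∀ r, a.reg r ≤ a'.reg r) : a.space ≤ a'.space := by
  have h1 : a.space = ∑ r ∈ a'.reg.support, (a.reg r).size := by
    refine Finsupp.sum_of_support_subset _ (fun r hr => ?_) _ (by simp)
    rw [Finsupp.mem_support_iff] at hr ⊢
    exact fun h0 => hr (Nat.le_zero.1 (h0 ▸ h r))
  rw [h1]
  exact Finset.sum_le_sum fun r _ => Nat.size_le_size (h r)

/-- While the arguments are copied one by one, the high registers are pointwise below those of the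
start configuration of the simulated program, whose space is at most `S`. -/
theorem enter_runs (w : Bool) {c : Config} (hc : Holds Z c σ)
    (hS : (startConfig (σ 0) (σ 42) (σ 41)).space ≤ S) :
    ∃ c', Runs Δ (58 * (Z ^ 4).size + S) enter c c' ∧
      Simulates (Z ^ 4) w c.reg c.head c' (startConfig (σ 0) (σ 42) (σ 41)) := by
  have e0 := hc.val 0 (by norm_num) (by norm_num)
  have e1 := hc.val 42 (by norm_num) (by norm_num)
  have e2 := hc.val 41 (by norm_num) (by norm_num)
  have key : ∀ d : Config, (∀ r < 58, d.reg r ≤ Z ^ 4) →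
      (∀ r, d.reg (58 + r) ≤ (startConfig (σ 0) (σ 42) (σ 41)).reg r) →
      d.space ≤ 58 * (Z ^ 4).size + S := by
    intro d h h'
    refine (Config.space_le (a := ⟨d.reg.comapDomain (58 + ·) (by simp), 0, []⟩) h
      fun r => by simp).trans ?_
    refine Nat.add_le_add_left ((Config.space_mono fun r => ?_).trans hS) _
    simpa using h' r
  have hp := fun r (hr : r < 58) => hc.le_pow hr
  refine ⟨_, .seq (.instr (key _ ?_ ?_) (key _ ?_ ?_)) (.seq (.instr (key _ ?_ ?_) (key _ ?_ ?_))
    (.seq (.instr (key _ ?_ ?_) (key _ ?_ ?_)) (.instr (key _ ?_ ?_) (key _ ?_ ?_)))), ?_⟩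
  case refine_17 =>
    constructor
    · intro r hr
      simp only [Instr.step, Config.set_reg]
      rw [if_neg (by omega), if_neg (by omega), if_neg (by omega), if_neg (by omega)]
    · simp [Instr.step, Config.set_reg, startConfig]
    · simp only [Instr.step, Config.set_reg]
      exact hp 57 (by norm_num)
    · intro r
      rcases r with _ | _ | _ | r <;>
        simp [Instr.step, Config.set_reg, startConfig_reg, e0, e1, e2]
      intro _
      split_ifs <;> first | omega | exact hc.hi _
    · rfl
    · simp [Instr.step, startConfig, hc.out]
    · simp [startConfig]
  any_goals exact hp
  all_goals intro r
  any_goals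
    intro hr
    simp only [Instr.step, Config.set_reg]
    split_ifs <;> first | omega | exact hp _ (by omega)
  all_goals
    rw [startConfig_reg]
    try simp only [Instr.step, Config.set_reg]
    split_ifs <;> first
      | omega | exact e0.le | exact e1.le | exact e2.le | exact (hc.hi _).le.trans (Nat.zero_le _)

/-- Clearing only lowers registers of the simulated configuration, so the bound `S` on its space
persists. -/
theorem clear_runs (hZ : 4 ≤ Z) {w : Bool} {base : ℕ → ℕ} {h₀ : ℕ}
    (hbase : ∀ r < 56, base r ≤ Z ^ 4) (m : ℕ) {c a : Config}
    (h : Simulates (Z ^ 4) w base h₀ c a) (hS : a.space ≤ S) :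
    ∃ c' a', Runs Δ (58 * (Z ^ 4).size + S) (clear m) c c' ∧
      Simulates (Z ^ 4) w base h₀ c' a' ∧ ∀ r, a'.reg r = if r < m then 0 else a.reg r := by
  have hZ3 : 3 ≤ Z ^ 4 := (by omega : 3 ≤ Z).trans (Nat.le_self_pow (by norm_num) Z)
  induction m generalizing c a with
  | zero =>
    have h' := simulates_scratch h (Nat.zero_le (Z ^ 4))
    exact ⟨_, a, .instr ((h.space_le hZ3 hbase).trans (Nat.add_le_add_left hS _))
      ((h'.space_le hZ3 hbase).trans (Nat.add_le_add_left hS _)), h', by simp⟩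
  | succ m ih =>
    have h' := simulates_set h m 0
    have hS' : (a.set m 0).space ≤ S := by
      refine (Config.space_mono fun r => ?_).trans hS
      rw [Config.set_reg]; split_ifs <;> omega
    obtain ⟨c', a', r, h'', e⟩ := ih h' hS'
    refine ⟨c', a', .seq (.instr ((h.space_le hZ3 hbase).trans (Nat.add_le_add_left hS _))
      ((h'.space_le hZ3 hbase).trans (Nat.add_le_add_left hS' _))) r, h'', fun r => ?_⟩
    rw [e, Config.set_reg]
    split_ifs <;> first | rfl | omega

theorem Runs.space_end_le {p : Cmd} {c c' : Config} (h : Runs Δ S p c c') : c'.space ≤ S := by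
  induction h <;> assumption

/-- The high registers are empty before and after a call: those that `p` can write, and the three
arguments, are cleared, and the others were never filled. Hence all calls share the same `S` bits.
-/
theorem Ht.call (hZ : 4 ≤ Z) {Δ₀ : ℤ} (hΔ : Δ₀.natAbs ≤ 1) {a : Config}
    (hp : Runs Δ₀ S p (startConfig (σ 0) (σ 42) (σ 41)) a) (ha : a.reg 1 ≤ Z)
    (hQ : Q (upd σ 42 (a.reg 1))) : Ht Δ Z S (call Δ₀ p) σ Q := by
  intro c hc
  have hZ3 : 3 ≤ Z ^ 4 := (by omega : 3 ≤ Z).trans (Nat.le_self_pow (by norm_num) Z)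
  have hbase : ∀ r < 56, c.reg r ≤ Z ^ 4 := fun r hr => hc.le_pow (by omega)
  obtain ⟨c₁, r₁, h₁⟩ := enter_runs (Δ := Δ) false hc hp.space_start_le
  obtain ⟨c₂, r₂, h₂⟩ := simCmd_runs (Δ := Δ) hΔ hZ3 hbase hp h₁
  have hv := (ha.trans (Nat.le_self_pow (by norm_num : (4 : ℕ) ≠ 0) Z))
  have hbase' : ∀ r < 56, upd c.reg 42 (a.reg 1) r ≤ Z ^ 4 := fun r hr => by
    unfold upd; split_ifs
    exacts [hv, hbase r hr]
  have h₃ : Simulates (Z ^ 4) false (upd c.reg 42 (a.reg 1)) c.head (c₂.set 42 (a.reg 1)) a :=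
    { lo := fun r hr => by
        rw [Config.set_reg, upd]; split_ifs
        exacts [rfl, h₂.lo r hr]
      head_reg := by rw [Config.set_reg, if_neg (by omega)]; exact h₂.head_reg
      scratch := by rw [Config.set_reg, if_neg (by omega)]; exact h₂.scratch
      hi := fun r => by rw [Config.set_reg, if_neg (by omega)]; exact h₂.hi r
      head := h₂.head
      out := h₂.out
      head_le := h₂.head_le }
  have haS := hp.space_end_le
  obtain ⟨c₄, a', r₄, h₄, e₄⟩ := clear_runs (Δ := Δ) hZ hbase' (max 3 p.regBound) h₃ haS
  have step : (Instr.copy 42 59).step Δ c₂ = c₂.set 42 (a.reg 1) := by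
    simp only [Instr.step]; rw [h₂.hi 1]
  refine ⟨c₄, upd σ 42 (a.reg 1), .seq r₁ (.seq r₂ (.seq (runs_instr_of_le step
    ((h₂.space_le hZ3 hbase).trans (Nat.add_le_add_left haS _))
    ((h₃.space_le hZ3 hbase').trans (Nat.add_le_add_left haS _))) r₄)), ?_, hQ⟩
  constructor
  · intro v hv h3
    rw [h₄.lo v (by omega), upd, upd]
    split_ifs
    exacts [rfl, hc.val v hv h3]
  · intro v hv h3
    rw [upd]
    split_ifs
    exacts [ha, hc.le v hv h3]
  · rw [h₄.lo 3 (by omega), upd, if_neg (by omega)]; exact hc.three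
  · intro v hv hv'
    rcases (by omega : v < 56 ∨ v = 56 ∨ v = 57) with h | rfl | rfl
    · rw [h₄.lo v h]; exact hbase' v h
    · rw [h₄.head_reg]; have := h₄.head_le; omega
    · exact h₄.scratch
  · intro r
    rw [h₄.hi, e₄]
    split_ifs with h
    · rfl
    · rw [hp.reg_eq (r := r) (by omega), startConfig_reg, if_neg (by omega), if_neg (by omega),
        if_neg (by omega)]
  · rw [h₄.head, hc.head, upd, if_neg (by omega)]
  · rw [h₄.out]; rfl

end Logic

/-! ## Digits in a mixed radix, and walks -/

/-- The product of the first `t` radices. -/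
def rprod (μ : ℕ → ℕ) (t : ℕ) : ℕ := ∏ i ∈ Finset.range t, μ i

theorem rprod_zero (μ : ℕ → ℕ) : rprod μ 0 = 1 := by simp [rprod]

theorem rprod_succ (μ : ℕ → ℕ) (t : ℕ) : rprod μ (t + 1) = rprod μ t * μ t :=
  Finset.prod_range_succ _ _

theorem rprod_pos {μ : ℕ → ℕ} (hμ : ∀ j, 1 ≤ μ j) (t : ℕ) : 0 < rprod μ t :=
  Finset.prod_pos fun i _ => hμ i

theorem rprod_congr {μ ν : ℕ → ℕ} {t : ℕ} (h : ∀ j < t, μ j = ν j) : rprod μ t = rprod ν t :=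
  Finset.prod_congr rfl fun j hj => h j (Finset.mem_range.1 hj)

theorem rprod_mono {μ : ℕ → ℕ} (hμ : ∀ j, 1 ≤ μ j) {s t : ℕ} (h : s ≤ t) :
    rprod μ s ≤ rprod μ t :=
  Finset.prod_le_prod_of_subset_of_one_le' (by simpa using h) fun j _ _ => hμ j

theorem div_rprod_succ (μ : ℕ → ℕ) (X t : ℕ) : X / rprod μ (t + 1) = X / rprod μ t / μ t := by
  rw [rprod_succ, Nat.div_div_eq_div_mul]

/-- Digit `t` of `X`, where the digits below `k` have the radices `μ`, and digit `k` is not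
bounded. -/
def dgt (μ : ℕ → ℕ) (k X t : ℕ) : ℕ :=
  if t < k then X / rprod μ t % μ t else if t = k then X / rprod μ t else 0

/-- The vector of the digits of `X`. -/
def wv (μ : ℕ → ℕ) (k X : ℕ) : ℕ → ℤ := fun t => dgt μ k X t

/-- The walk with letters `0, …, t - 1`, as often as the digits of `X` say. -/
def walkTo (stp : ℕ → ℕ → ℕ → ℕ) (b : ℕ) (μ : ℕ → ℕ) (k X y : ℕ) : ℕ → ℕ
  | 0 => y
  | t + 1 => (stp b t)^[dgt μ k X t] (walkTo stp b μ k X y t)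

def walk (stp : ℕ → ℕ → ℕ → ℕ) (b : ℕ) (μ : ℕ → ℕ) (k X y : ℕ) : ℕ :=
  walkTo stp b μ k X y (k + 1)

/-- The least word that leads from `y` to the same state as `X`. -/
noncomputable def leastIdx (stp : ℕ → ℕ → ℕ → ℕ) (b : ℕ) (μ : ℕ → ℕ) (k y X : ℕ) : ℕ :=
  sInf {X' | walk stp b μ k X' y = walk stp b μ k X y}

/-- The first word that leads from `y` to the same state as a smaller one. -/
noncomputable def collX (stp : ℕ → ℕ → ℕ → ℕ) (b : ℕ) (μ : ℕ → ℕ) (k y : ℕ) : ℕ :=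
  sInf {X | leastIdx stp b μ k y X < X}

/-- Walk along the first collision and back with the opposite letters. -/
noncomputable def nxt (stp : ℕ → ℕ → ℕ → ℕ) (b : ℕ) (μ : ℕ → ℕ) (k y : ℕ) : ℕ :=
  walk stp (1 - b) μ k (collX stp b μ k y) (walk stp b μ k (collX stp b μ k y) y)

/-- The number of steps of Floyd's cycle finding algorithm. -/
noncomputable def floydIdx (f : ℕ → ℕ) (p : ℕ) : ℕ := sInf {j | 1 ≤ j ∧ f^[j] p = f^[2 * j] p}

/-- The highest digit at which `X` and `X'` differ. -/
noncomputable def topIdx (μ : ℕ → ℕ) (k X X' : ℕ) : ℕ := by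
  classical exact Nat.findGreatest (fun t => X / rprod μ t ≠ X' / rprod μ t) k

/-- The relation that is given by a collision with highest digit `t`. -/
def rv (μ : ℕ → ℕ) (t : ℕ) (r : ℕ × ℕ) : ℕ → ℤ := fun j =>
  if j < t then ((r.1 / rprod μ j % μ j : ℕ) : ℤ) - (r.2 / rprod μ j % μ j : ℕ)
  else if j = t then ((r.1 / rprod μ t : ℕ) : ℤ) - (r.2 / rprod μ t : ℕ) else 0

/-- The signs of the letters. -/
def sg (b : ℕ) : ℤ := if b = 0 then 1 else -1

/-- A finite automaton on the letters `± e_i`, with the set of all pairs of a vector and a state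
that it reaches on a stream of this frequency. -/
structure Machine (n T : ℕ) where
  stp : ℕ → ℕ → ℕ → ℕ
  init : ℕ
  R : (ℕ → ℤ) → ℕ → Prop
  R_zero : R 0 init
  R_step : ∀ {x y b i}, i < n → R x y → R (x + Pi.single i (sg b)) (stp b i y)
  R_lt : ∀ {x y}, R x y → y < T
  R_congr : ∀ {x x' y}, (∀ i < n, x i = x' i) → R x y → R x' y

theorem sg_one_sub {b : ℕ} (hb : b ≤ 1) : sg (1 - b) = -sg b := by
  interval_cases b <;> simp [sg]

/-- The orbit is finite, hence eventually periodic. A positive multiple of the period beyond the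
preperiod, here (a + 1) times the period, is an index at which Floyd's two pointers meet. -/
theorem exists_floydIdx {f : ℕ → ℕ} {p T : ℕ} (h : ∀ j, f^[j] p < T) :
    ∃ j, 1 ≤ j ∧ f^[j] p = f^[2 * j] p := by
  obtain ⟨a, -, c, -, hne, he⟩ := Finset.exists_ne_map_eq_of_card_lt_of_maps_to
    (s := Finset.range (T + 1)) (t := Finset.range T) (f := fun j => f^[j] p) (by simp)
    (fun j _ => by simpa using h j)
  wlog hac : a < c generalizing a c
  · exact this c a hne.symm he.symm (by omega)
  obtain ⟨e, rfl⟩ := Nat.exists_eq_add_of_lt hac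
  set c := e + 1 with hc
  have h1 : ∀ i, a ≤ i → f^[i + c] p = f^[i] p := by
    intro i hi
    obtain ⟨u, rfl⟩ := Nat.exists_eq_add_of_le hi
    rw [show a + u + c = u + (a + e + 1) by omega, Function.iterate_add_apply f u, ← he,
      ← Function.iterate_add_apply, add_comm]
  have h2 : ∀ m i, a ≤ i → f^[i + m * c] p = f^[i] p := by
    intro m
    induction m with
    | zero => intro i _; simp
    | succ m ih =>
      intro i hi
      rw [show i + (m + 1) * c = i + m * c + c by ring, h1 _ (by omega), ih i hi]
  refine ⟨(a + 1) * c, Nat.mul_pos (by omega) (by omega), ?_⟩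
  rw [show 2 * ((a + 1) * c) = (a + 1) * c + (a + 1) * c by ring, h2]
  calc a ≤ (a + 1) * 1 := by omega
    _ ≤ _ := Nat.mul_le_mul_left _ (by omega)

theorem floydIdx_spec {f : ℕ → ℕ} {p T : ℕ} (h : ∀ j, f^[j] p < T) :
    1 ≤ floydIdx f p ∧ f^[floydIdx f p] p = f^[2 * floydIdx f p] p :=
  Nat.sInf_mem (s := {j | 1 ≤ j ∧ f^[j] p = f^[2 * j] p}) (exists_floydIdx h)

theorem dgt_zero (μ : ℕ → ℕ) (k t : ℕ) : dgt μ k 0 t = 0 := by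
  simp [dgt]

theorem walk_zero (stp : ℕ → ℕ → ℕ → ℕ) (b : ℕ) (μ : ℕ → ℕ) (k y : ℕ) :
    walk stp b μ k 0 y = y := by
  have : ∀ t, walkTo stp b μ k 0 y t = y := by
    intro t
    induction t with
    | zero => rfl
    | succ t ih => rw [walkTo, dgt_zero, ih]; rfl
  exact this _

namespace Machine

variable {n T : ℕ} (M : Machine n T)

theorem R_iterate {x : ℕ → ℤ} {y b i : ℕ} (hi : i < n) (h : M.R x y) (c : ℕ) :
    M.R (x + Pi.single i (sg b * c)) ((M.stp b i)^[c] y) := by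
  induction c with
  | zero => simpa using h
  | succ c ih =>
    rw [Function.iterate_succ_apply']
    convert M.R_step hi ih using 1
    rw [add_assoc, ← Pi.single_add]
    push_cast
    ring_nf

theorem R_walk {x : ℕ → ℤ} {y b k X : ℕ} {μ : ℕ → ℕ} (hk : ∀ t, dgt μ k X t ≠ 0 → t < n)
    (h : M.R x y) : M.R (x + sg b • wv μ k X) (walk M.stp b μ k X y) := by
  have key : ∀ t, M.R (x + fun j => if j < t then sg b * dgt μ k X j else 0)
      (walkTo M.stp b μ k X y t) := by
    intro t
    induction t with
    | zero =>
      convert h using 1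
      · ext; simp
      · rfl
    | succ t ih =>
      rw [walkTo]
      by_cases h0 : dgt μ k X t = 0
      · rw [h0]
        convert ih using 1
        · ext j
          rcases lt_trichotomy j t with hj | rfl | hj
          · simp [hj, hj.le]
          · simp [h0]
          · simp [hj.not_gt, hj.not_ge]
        · rfl
      · convert M.R_iterate (b := b) (hk t h0) ih (dgt μ k X t) using 1
        ext j
        rcases lt_trichotomy j t with hj | rfl | hj
        · simp [hj, hj.le, hj.ne]
        · simp
        · simp [hj.not_gt, hj.not_ge, hj.ne']
  convert key (k + 1) using 1
  · ext j
    by_cases hj : j < k + 1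
    · simp [Nat.lt_succ_iff.1 hj, wv]
    · simp [wv, dgt, show ¬ j < k by omega, show j ≠ k by omega, show ¬ j ≤ k by omega]
  · rfl

theorem lt_of_dgt_ne_zero {k X t : ℕ} {μ : ℕ → ℕ} (hk : k < n) (h : dgt μ k X t ≠ 0) : t < n := by
  unfold dgt at h
  split_ifs at h
  all_goals omega

/-! ### Collisions of words and the return along them -/

section Collision

variable {b k y : ℕ} {μ : ℕ → ℕ} {x : ℕ → ℤ}

theorem walk_leastIdx (stp : ℕ → ℕ → ℕ → ℕ) (b : ℕ) (μ : ℕ → ℕ) (k y X : ℕ) :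
    walk stp b μ k (leastIdx stp b μ k y X) y = walk stp b μ k X y :=
  Nat.sInf_mem (s := {X' | walk stp b μ k X' y = walk stp b μ k X y}) ⟨X, rfl⟩

/-- Pigeonhole on the `T + 1` words up to `T`. The bound on `X` later bounds the product of the
radices. -/
theorem exists_collX (hk : k < n) (h : M.R x y) : ∃ X ≤ T, leastIdx M.stp b μ k y X < X := by
  obtain ⟨a, ha, c, hc, hne, he⟩ := Finset.exists_ne_map_eq_of_card_lt_of_maps_to
    (s := Finset.range (T + 1)) (t := Finset.range T) (f := fun X => walk M.stp b μ k X y)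
    (by simp) (fun X _ => Finset.mem_coe.2 (Finset.mem_range.2
      (M.R_lt (M.R_walk (fun t => lt_of_dgt_ne_zero hk) h))))
  rw [Finset.mem_range] at ha hc
  wlog hac : a < c generalizing a c
  · exact this c hc a ha hne.symm he.symm (by omega)
  refine ⟨c, by omega, lt_of_le_of_lt ?_ hac⟩
  exact Nat.sInf_le (s := {X' | walk M.stp b μ k X' y = walk M.stp b μ k c y}) he

theorem leastIdx_collX_lt (hk : k < n) (h : M.R x y) :
    leastIdx M.stp b μ k y (collX M.stp b μ k y) < collX M.stp b μ k y :=
  Nat.sInf_mem (s := {X | leastIdx M.stp b μ k y X < X})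
    (let ⟨X, _, hX⟩ := M.exists_collX hk h; ⟨X, hX⟩)

theorem collX_le (hk : k < n) (h : M.R x y) : collX M.stp b μ k y ≤ T :=
  let ⟨_, hT, hX⟩ := M.exists_collX hk h
  (Nat.sInf_le (s := {X | leastIdx M.stp b μ k y X < X}) hX).trans hT

/-- The way back cancels the way out, so the frequency is unchanged although the state may change.
-/
theorem R_nxt (hb : b ≤ 1) (hk : k < n) (h : M.R x y) : M.R x (nxt M.stp b μ k y) := by
  have hd : ∀ {X t}, dgt μ k X t ≠ 0 → t < n := lt_of_dgt_ne_zero hk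
  unfold nxt
  convert M.R_walk (b := 1 - b) (fun t => hd) (M.R_walk (b := b) (fun t => hd) h) using 1
  rw [sg_one_sub hb, neg_smul, add_neg_cancel_right]

/-- Go out along the smaller word of the collision and back along the larger one. The intermediate
state is the same as for the larger word, so the final state is too, but the frequency has moved by
the difference of the words. -/
theorem R_nxt_collision (hb : b ≤ 1) (hk : k < n) (h : M.R x y) :
    M.R (x - sg b • (wv μ k (collX M.stp b μ k y) -
      wv μ k (leastIdx M.stp b μ k y (collX M.stp b μ k y)))) (nxt M.stp b μ k y) := by
  have hd : ∀ {X t}, dgt μ k X t ≠ 0 → t < n := lt_of_dgt_ne_zero hk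
  have h1 := M.R_walk (b := b) (μ := μ) (k := k)
    (X := leastIdx M.stp b μ k y (collX M.stp b μ k y)) (fun t => hd) h
  rw [walk_leastIdx] at h1
  conv_rhs => unfold nxt
  convert M.R_walk (b := 1 - b) (fun t => hd) h1 using 1
  rw [sg_one_sub hb, neg_smul, smul_sub]
  abel

end Collision

theorem R_iterate_nxt {b k y : ℕ} {μ : ℕ → ℕ} {x : ℕ → ℤ} (hb : b ≤ 1) (hk : k < n)
    (h : M.R x y) (j : ℕ) : M.R x ((nxt M.stp b μ k)^[j] y) := by
  induction j with
  | zero => exact h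
  | succ j ih => rw [Function.iterate_succ_apply']; exact M.R_nxt hb hk ih

/-! ### Preliminary walks -/

/-- Walks along the collisions of single letters. -/
noncomputable def prelim : ℕ → ℕ
  | 0 => M.init
  | i + 1 => nxt M.stp 1 (fun _ => 1) i (nxt M.stp 0 (fun _ => 1) i (prelim i))

/-- With all radices 1 only the unbounded digit is left, so words are powers of one letter and the
general collision search serves the preliminary walks too. -/
theorem walk_one (b i X y : ℕ) : walk M.stp b (fun _ => 1) i X y = (M.stp b i)^[X] y := by
  have h : ∀ t ≤ i, walkTo M.stp b (fun _ => 1) i X y t = y := by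
    intro t
    induction t with
    | zero => intro _; rfl
    | succ t ih =>
      intro ht
      rw [walkTo, ih (by omega), dgt, if_pos (by omega), Nat.mod_one]
      rfl
  rw [walk, walkTo, h i le_rfl, dgt, if_neg (lt_irrefl i), if_pos rfl]
  simp [rprod]

theorem wv_one (i X : ℕ) : wv (fun _ => 1) i X = Pi.single i (X : ℤ) := by
  ext t
  rcases lt_trichotomy t i with h | rfl | h
  · simp [wv, dgt, h, h.ne, Nat.mod_one]
  · simp [wv, dgt, rprod]
  · simp [wv, dgt, h.ne', show ¬ t < i by omega]

/-- The powers of one letter run into a cycle, and the length `l` of a collision is a period from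
there on. Insert `j` extra periods on the way out and return as usual. The period depends on the
state `y` only, so it works simultaneously for all vectors that reach `y`. -/
theorem exists_period {i y b : ℕ} (hb : b ≤ 1) (hi : i < n) {x : ℕ → ℤ} (hx : M.R x y) :
    ∃ l : ℕ, 1 ≤ l ∧ ∀ x' (j : ℕ), M.R x' y →
      M.R (x' + Pi.single i (sg b * (l * j))) (nxt M.stp b (fun _ => 1) i y) := by
  set X := collX M.stp b (fun _ => 1) i y with hX
  set X' := leastIdx M.stp b (fun _ => 1) i y X with hX'
  have hlt : X' < X := M.leastIdx_collX_lt hi hx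
  have heq := walk_leastIdx M.stp b (fun _ => 1) i y X
  rw [← hX', walk_one, walk_one] at heq
  have hper : ∀ j, (M.stp b i)^[X + (X - X') * j] y = (M.stp b i)^[X] y := by
    intro j
    induction j with
    | zero => simp
    | succ j ih =>
      rw [show X + (X - X') * (j + 1) = (X - X') * j + (X - X') + X by ring,
        Function.iterate_add_apply, ← heq, ← Function.iterate_add_apply,
        show (X - X') * j + (X - X') + X' = X + (X - X') * j by omega, ih, heq]
  refine ⟨X - X', by omega, fun x' j h => ?_⟩
  have h1 := M.R_iterate (b := b) hi h (X + (X - X') * j)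
  rw [hper, ← walk_one] at h1
  unfold nxt
  rw [← hX]
  convert M.R_walk (b := 1 - b) (fun t => lt_of_dgt_ne_zero hi) h1 using 1
  rw [sg_one_sub hb, wv_one, add_assoc, neg_smul, ← Pi.single_smul, ← Pi.single_neg,
    ← Pi.single_add]
  congr 2
  push_cast [Nat.cast_sub hlt.le]
  simp only [smul_eq_mul]
  ring

/-- A tour with both signs lets each coordinate be raised and lowered by multiples of a period
without changing the final state. -/
theorem exists_prelim (i : ℕ) (hi : i ≤ n) : ∃ N : ℕ, 1 ≤ N ∧
    ∀ c : ℕ → ℤ, (∀ j, i ≤ j → c j = 0) → M.R ((N : ℤ) • c) (M.prelim i) := by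
  induction i with
  | zero =>
    refine ⟨1, le_rfl, fun c hc => ?_⟩
    rw [show c = 0 from funext fun j => hc j (Nat.zero_le _), smul_zero]
    exact M.R_zero
  | succ i ih =>
    obtain ⟨N, hN, h⟩ := ih (by omega)
    have h0 := h 0 (fun _ _ => rfl)
    obtain ⟨l, hl, h1⟩ := M.exists_period (b := 0) (by omega) (show i < n by omega) h0
    obtain ⟨l', hl', h2⟩ := M.exists_period (b := 1) le_rfl (show i < n by omega)
      (M.R_nxt (b := 0) (k := i) (μ := fun _ => 1) (by omega) (by omega) h0)
    refine ⟨N * l * l', Nat.mul_pos (Nat.mul_pos hN hl) hl', fun c hc => ?_⟩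
    -- Both periods divide the new modulus `N * l * l'`. The lower coordinates come from the
    -- induction hypothesis scaled by `l * l'`; coordinate `i` comes from `N * l' * u.1` periods
    -- upward and `N * l * u.2` downward.
    have h3 := h (fun j => if j < i then (l : ℤ) * l' * c j else 0)
      (fun j hj => if_neg (by omega))
    obtain ⟨u, hu⟩ : ∃ u : ℕ × ℕ, ((u.1 : ℤ) - u.2) = c i := ⟨((c i).toNat, (-c i).toNat), by
      simp only; omega⟩
    rw [prelim]
    convert h2 _ (N * l * u.2) (h1 _ (N * l' * u.1) h3) using 1
    ext j
    rcases lt_trichotomy j i with hj | rfl | hj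
    · simp [hj, hj.ne]; ring
    · simp [sg, ← hu]; ring
    · simp [hj.ne', show ¬ j < i by omega, hc j (by omega)]

theorem exists_subgroup_prelim : ∃ (H : AddSubgroup (ℕ → ℤ)) (N : ℕ), 1 ≤ N ∧
    (∀ x, (N : ℤ) • x ∈ H) ∧ ∀ h ∈ H, M.R h (M.prelim n) := by
  obtain ⟨N, hN, h⟩ := M.exists_prelim n le_rfl
  refine ⟨(zsmulAddGroupHom (N : ℤ)).range, N, hN, fun x => ⟨x, rfl⟩, ?_⟩
  rintro _ ⟨x, rfl⟩
  refine M.R_congr (x := (N : ℤ) • fun j => if j < n then x j else 0) (fun i hi => ?_)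
    (h _ fun j hj => if_neg (by omega))
  simp [hi]

end Machine

/-! ## The construction of the relations -/

section Top

variable {μ : ℕ → ℕ} {k X X' : ℕ}

theorem topIdx_le (μ : ℕ → ℕ) (k X X' : ℕ) : topIdx μ k X X' ≤ k := by
  classical exact Nat.findGreatest_le k

/-- The maximum that defines `topIdx` exists because at position 0 the quotients are the words
themselves. -/
theorem div_topIdx_lt (h : X' < X) :
    X' / rprod μ (topIdx μ k X X') < X / rprod μ (topIdx μ k X X') := by
  classical
  refine lt_of_le_of_ne (Nat.div_le_div_right h.le) (Ne.symm ?_)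
  exact Nat.findGreatest_spec (P := fun t => X / rprod μ t ≠ X' / rprod μ t) (Nat.zero_le k)
    (by simpa [rprod_zero] using h.ne')

theorem div_eq_of_topIdx_lt {t : ℕ} (h : topIdx μ k X X' < t) (ht : t ≤ k) :
    X / rprod μ t = X' / rprod μ t := by
  classical
  by_contra hne
  exact Nat.findGreatest_is_greatest (P := fun t => X / rprod μ t ≠ X' / rprod μ t) h ht hne

theorem topIdx_eq {t : ℕ} (ht : t ≤ k) (hne : X / rprod μ t ≠ X' / rprod μ t)
    (h : ∀ u, t < u → u ≤ k → X / rprod μ u = X' / rprod μ u) : topIdx μ k X X' = t := by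
  classical
  exact Nat.findGreatest_eq_iff.2 ⟨ht, fun _ => hne, fun u h1 h2 => not_not.2 (h u h1 h2)⟩

/-- The difference of the digits at `topIdx`. -/
noncomputable def topDiff (μ : ℕ → ℕ) (k X X' : ℕ) : ℕ :=
  X / rprod μ (topIdx μ k X X') - X' / rprod μ (topIdx μ k X X')

theorem one_le_topDiff (h : X' < X) : 1 ≤ topDiff μ k X X' :=
  Nat.sub_pos_of_lt (div_topIdx_lt h)

/-- The quotients one position higher agree, so this is a difference of two residues modulo the old
radix. It is the reason for termination. -/
theorem topDiff_lt (hμ : ∀ j, 1 ≤ μ j) (ht : topIdx μ k X X' < k) :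
    topDiff μ k X X' < μ (topIdx μ k X X') := by
  have h := div_eq_of_topIdx_lt (Nat.lt_succ_self _) (Nat.succ_le_of_lt ht)
  rw [Nat.succ_eq_add_one, div_rprod_succ, div_rprod_succ] at h
  unfold topDiff
  set t := topIdx μ k X X'
  have h1 := Nat.div_add_mod (X / rprod μ t) (μ t)
  have h2 := Nat.div_add_mod (X' / rprod μ t) (μ t)
  have h3 := Nat.mod_lt (X / rprod μ t) (hμ t)
  rw [h] at h1
  omega

/-- Above the top position the digits cancel. At the top the digits may be replaced by the unreduced
quotients, which differ from them by the same multiple of the radix. -/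
theorem wv_sub_wv (μ : ℕ → ℕ) (k X X' : ℕ) :
    wv μ k X - wv μ k X' = rv μ (topIdx μ k X X') (X, X') := by
  ext j
  have hk := topIdx_le μ k X X'
  simp only [Pi.sub_apply, wv, rv]
  set t := topIdx μ k X X' with ht
  rcases lt_trichotomy j t with hj | rfl | hj
  · simp [dgt, hj, hj.trans_le hk]
  · rw [if_neg (lt_irrefl _), if_pos rfl]
    rcases hk.lt_or_eq with hk | hk
    · simp only [dgt, if_pos hk]
      have e := div_eq_of_topIdx_lt (Nat.lt_succ_self _) (Nat.succ_le_of_lt hk)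
      rw [Nat.succ_eq_add_one, div_rprod_succ, div_rprod_succ, ← ht] at e
      have h1 := Nat.div_add_mod (X / rprod μ t) (μ t)
      have h2 := Nat.div_add_mod (X' / rprod μ t) (μ t)
      rw [e] at h1
      omega
    · simp [dgt, hk]
  · rw [if_neg hj.not_gt, if_neg hj.ne', sub_eq_zero]
    norm_cast
    unfold dgt
    split_ifs with h1 h2
    · rw [div_eq_of_topIdx_lt hj h1.le]
    · exact div_eq_of_topIdx_lt hj h2.le
    · rfl

end Top

/-- A relation depends only on the radices strictly below its leading letter, so the retained pairs
of words keep their meaning when a higher radix changes. -/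
theorem rv_congr {μ ν : ℕ → ℕ} {t : ℕ} (h : ∀ j < t, μ j = ν j) (r : ℕ × ℕ) :
    rv μ t r = rv ν t r := by
  ext j
  unfold rv
  split_ifs with h1 h2
  · rw [rprod_congr fun i hi => h i (hi.trans h1), h j h1]
  · rw [rprod_congr h]
  · rfl

/-- The state of the construction: a state of the automaton, the radices below `k`, and the
collisions that yield the relations. -/
structure MState where
  p : ℕ
  μ : ℕ → ℕ
  k : ℕ
  rows : ℕ → ℕ × ℕ

namespace Machine

variable {n T : ℕ} (M : Machine n T)

/-- The state on a cycle that Floyd's algorithm finds. -/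
noncomputable def cyc (s : MState) : ℕ :=
  (nxt M.stp 0 s.μ s.k)^[floydIdx (nxt M.stp 0 s.μ s.k) s.p] s.p

/-- The collision at the state on a cycle. -/
noncomputable def coll (s : MState) : ℕ × ℕ :=
  (collX M.stp 0 s.μ s.k (M.cyc s),
    leastIdx M.stp 0 s.μ s.k (M.cyc s) (collX M.stp 0 s.μ s.k (M.cyc s)))

/-- Relations with a leading letter above that of the new one are discarded by lowering `k`; their
entries in `rows` become stale and are ignored. -/
noncomputable def mstep (s : MState) : MState where
  p := M.cyc s
  μ j := if j < topIdx s.μ s.k (M.coll s).1 (M.coll s).2 then s.μ j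
    else if j = topIdx s.μ s.k (M.coll s).1 (M.coll s).2 then
      topDiff s.μ s.k (M.coll s).1 (M.coll s).2 else 1
  k := topIdx s.μ s.k (M.coll s).1 (M.coll s).2 + 1
  rows := Function.update s.rows (topIdx s.μ s.k (M.coll s).1 (M.coll s).2) (M.coll s)

noncomputable def mstart : MState where
  p := M.prelim n
  μ _ := 1
  k := 0
  rows _ := (0, 0)

/-- The group `H` need not be generated by the rows: it also contains discarded relations and all
multiples of `N`. These multiples are what makes negative multiples of a relation expressible by
positive ones. -/
structure Inv (s : MState) : Prop where
  k_le : s.k ≤ n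
  one_le : ∀ j, 1 ≤ s.μ j
  eq_one : ∀ j, s.k ≤ j → s.μ j = 1
  rprod_le : rprod s.μ s.k ≤ T
  row_diag : ∀ t < s.k, rv s.μ t (s.rows t) t = s.μ t
  row_le : ∀ t < s.k, (s.rows t).1 ≤ T ∧ (s.rows t).2 ≤ T
  exists_subgroup : ∃ (H : AddSubgroup (ℕ → ℤ)) (N : ℕ), 1 ≤ N ∧ (∀ x, (N : ℤ) • x ∈ H) ∧
    (∀ h ∈ H, M.R h s.p) ∧ ∀ t < s.k, rv s.μ t (s.rows t) ∈ H

include M in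
theorem one_le_T : 1 ≤ T := (Nat.zero_le _).trans_lt (M.R_lt M.R_zero)

theorem inv_mstart : M.Inv M.mstart where
  k_le := Nat.zero_le _
  one_le _ := le_rfl
  eq_one _ _ := rfl
  rprod_le := by simpa [mstart, rprod] using M.one_le_T
  row_diag t ht := absurd ht (Nat.not_lt_zero t)
  row_le t ht := absurd ht (Nat.not_lt_zero t)
  exists_subgroup := by
    obtain ⟨H, N, h1, h2, h3⟩ := M.exists_subgroup_prelim
    exact ⟨H, N, h1, h2, h3, fun t ht => absurd ht (Nat.not_lt_zero t)⟩

theorem R_cyc {s : MState} (hk : s.k < n) {x : ℕ → ℤ} (h : M.R x s.p) : M.R x (M.cyc s) :=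
  M.R_iterate_nxt (by norm_num) hk h _

/-! ### One step of the construction preserves the invariant -/

section Step

variable {M} {s : MState} (hs : M.Inv s) (hk : s.k < n)
include hs

theorem Inv.R_p : M.R 0 s.p := by
  obtain ⟨H, N, -, -, h, -⟩ := hs.exists_subgroup
  exact h 0 H.zero_mem

include hk

theorem Inv.floydIdx_spec : 1 ≤ floydIdx (nxt M.stp 0 s.μ s.k) s.p ∧
    (nxt M.stp 0 s.μ s.k)^[floydIdx (nxt M.stp 0 s.μ s.k) s.p] s.p =
      (nxt M.stp 0 s.μ s.k)^[2 * floydIdx (nxt M.stp 0 s.μ s.k) s.p] s.p :=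
  _root_.floydIdx_spec (T := T) fun j => M.R_lt (M.R_iterate_nxt (by norm_num) hk hs.R_p j)

theorem Inv.coll_lt : (M.coll s).2 < (M.coll s).1 :=
  M.leastIdx_collX_lt hk (M.R_cyc hk hs.R_p)

theorem Inv.coll_le : (M.coll s).1 ≤ T :=
  M.collX_le hk (M.R_cyc hk hs.R_p)

/-- Go round the cycle `j` times. The first application of `nxt` in each round is charged with the
collision at the base state, the others with frequency 0, and the round ends where it began. -/
theorem Inv.R_cyc_sub {x : ℕ → ℤ} (h : M.R x (M.cyc s)) (j : ℕ) :
    M.R (x - (j : ℤ) • rv s.μ (topIdx s.μ s.k (M.coll s).1 (M.coll s).2) (M.coll s))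
      (M.cyc s) := by
  set f := nxt M.stp 0 s.μ s.k with hf
  obtain ⟨h1, h2⟩ := hs.floydIdx_spec hk
  rw [← hf] at h1 h2
  have hcyc : f^[floydIdx f s.p - 1] (f (M.cyc s)) = M.cyc s := by
    rw [← Function.iterate_succ_apply, Nat.succ_eq_add_one, Nat.sub_add_cancel h1]
    unfold cyc
    rw [← hf, ← Function.iterate_add_apply, ← two_mul, ← h2]
  induction j with
  | zero => simpa using h
  | succ j ih =>
    have h3 := M.R_nxt_collision (b := 0) (μ := s.μ) (by norm_num) hk ih
    have h4 := M.R_iterate_nxt (b := 0) (μ := s.μ) (by norm_num) hk h3 (floydIdx f s.p - 1)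
    rw [← hf, hcyc] at h4
    convert h4 using 1
    rw [show sg 0 = 1 from rfl, one_smul, sub_sub]
    congr 1
    rw [← wv_sub_wv]
    push_cast
    rw [add_smul, one_smul]
    rfl

/-- If the top letter is below `k`, its radix shrinks and higher ones are dropped. If it is `k`, the
new radix is at most the leading quotient of a word that is at most `T`. -/
theorem Inv.mstep_rprod_le : rprod (M.mstep s).μ (M.mstep s).k ≤ T := by
  set t := topIdx s.μ s.k (M.coll s).1 (M.coll s).2 with ht
  have e : rprod (M.mstep s).μ (M.mstep s).k =
      rprod s.μ t * topDiff s.μ s.k (M.coll s).1 (M.coll s).2 := by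
    change rprod (M.mstep s).μ (t + 1) = _
    rw [rprod_succ]
    congr 1
    · exact rprod_congr fun j hj => if_pos hj
    · simp [mstep, ht]
  rw [e]
  rcases (topIdx_le s.μ s.k (M.coll s).1 (M.coll s).2).lt_or_eq with h | h
  · have h1 := topDiff_lt hs.one_le h
    calc _ ≤ rprod s.μ t * s.μ t := Nat.mul_le_mul_left _ h1.le
      _ = rprod s.μ (t + 1) := (rprod_succ _ _).symm
      _ ≤ _ := rprod_mono hs.one_le h
      _ ≤ T := hs.rprod_le
  · calc _ ≤ rprod s.μ t * ((M.coll s).1 / rprod s.μ t) :=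
          Nat.mul_le_mul_left _ (Nat.sub_le _ _)
      _ ≤ (M.coll s).1 := Nat.mul_div_le _ _
      _ ≤ T := hs.coll_le hk

theorem Inv.mstep : M.Inv (M.mstep s) := by
  have hlt := hs.coll_lt hk
  have htk := topIdx_le s.μ s.k (M.coll s).1 (M.coll s).2
  have hrv : ∀ u ≤ topIdx s.μ s.k (M.coll s).1 (M.coll s).2, ∀ r,
      rv (M.mstep s).μ u r = rv s.μ u r := fun u hu r =>
    rv_congr (fun j hj => if_pos (hj.trans_le hu)) r
  have hrow : ∀ u, (M.mstep s).rows u =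
      if u = topIdx s.μ s.k (M.coll s).1 (M.coll s).2 then M.coll s else s.rows u := fun u => by
    simp [Machine.mstep, Function.update_apply]
  have hrp := hs.mstep_rprod_le hk
  set t := topIdx s.μ s.k (M.coll s).1 (M.coll s).2 with ht
  have hk' : (M.mstep s).k = t + 1 := rfl
  have hμ : ∀ j, (M.mstep s).μ j = if j < t then s.μ j else if j = t then
    topDiff s.μ s.k (M.coll s).1 (M.coll s).2 else 1 := fun j => rfl
  refine ⟨by omega, fun j => ?_, fun j hj => ?_, hrp, fun u hu => ?_, fun u hu => ?_, ?_⟩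
  · rw [hμ]
    split_ifs
    · exact hs.one_le j
    · exact one_le_topDiff hlt
    · exact le_rfl
  · rw [hμ, if_neg (by omega), if_neg (by omega)]
  · rw [hrv u (by omega), hrow, hμ]
    split_ifs with h1 h2 h3
    · omega
    · rw [rv, if_neg (lt_irrefl _), if_pos rfl, h1, topDiff, ← ht,
        Nat.cast_sub (div_topIdx_lt hlt).le]
    · exact hs.row_diag u (by omega)
    · omega
  · rw [hrow]
    split_ifs with h1
    · exact ⟨hs.coll_le hk, hlt.le.trans (hs.coll_le hk)⟩
    · exact hs.row_le u (by omega)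
  · obtain ⟨H, N, hN, hNH, hR, hrows⟩ := hs.exists_subgroup
    refine ⟨H ⊔ AddSubgroup.zmultiples (rv s.μ t (M.coll s)), N, hN,
      fun x => AddSubgroup.mem_sup_left (hNH x), fun _ hmem => ?_, fun u hu => ?_⟩
    · obtain ⟨h, hh, _, ⟨z, rfl⟩, rfl⟩ := AddSubgroup.mem_sup.1 hmem
      have hN0 : (N : ℤ) ≠ 0 := by positivity
      -- Only subtraction of natural multiples is available, so `z` times the relation is written as
      -- `q * N` times it, an element of `H`, minus `j` times it.
      obtain ⟨j, q, hj⟩ : ∃ (j : ℕ) (q : ℤ), z + j = q * N := by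
        refine ⟨((-z) % N).toNat, -((-z) / N), ?_⟩
        rw [Int.toNat_of_nonneg (Int.emod_nonneg _ hN0)]
        linarith [Int.emod_add_mul_ediv (-z) N]
      have h1 : h + q • (N : ℤ) • rv s.μ t (M.coll s) ∈ H :=
        H.add_mem hh (H.zsmul_mem (hNH _) q)
      convert hs.R_cyc_sub hk (M.R_cyc hk (hR _ h1)) j using 1
      · rw [← ht, smul_smul, ← hj, add_smul]
        simp only
        abel
      · rfl
    · rw [hrv u (by omega), hrow]
      split_ifs with h1
      · exact AddSubgroup.mem_sup_right (h1 ▸ AddSubgroup.mem_zmultiples _)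
      · exact AddSubgroup.mem_sup_left (hrows u (by omega))

end Step

/-- The value of a string of digits, the most significant digit first. -/
def horner (Q : ℕ) (m : ℕ → ℕ) : ℕ → ℕ
  | 0 => 0
  | j + 1 => horner Q m j * Q + m j

/-- Comparison of digit strings is lexicographic; only the smaller string needs digits below the
base. -/
theorem horner_lt {Q t : ℕ} {m m' : ℕ → ℕ} (heq : ∀ j < t, m' j = m j)
    (hlt : m' t < m t) (hQ : ∀ j, m' j < Q) (j : ℕ) (hj : t < j) :
    horner Q m' j < horner Q m j := by
  induction j with
  | zero => omega
  | succ j ih =>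
    rcases Nat.lt_succ_iff_lt_or_eq.1 hj with h | rfl
    · have h1 := ih h
      have h2 := hQ j
      calc horner Q m' j * Q + m' j < (horner Q m' j + 1) * Q := by rw [add_mul]; omega
        _ ≤ horner Q m j * Q := Nat.mul_le_mul_right _ h1
        _ ≤ _ := Nat.le_add_right _ _
    · have : horner Q m' t = horner Q m t := by
        have h : ∀ u ≤ t, horner Q m' u = horner Q m u := by
          intro u
          induction u with
          | zero => intro _; rfl
          | succ u ihu => intro hu; rw [horner, horner, ihu (by omega), heq u (by omega)]
        exact h t le_rfl
      rw [horner, horner, this]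
      omega

/-- A measure that decreases in each step of the construction. -/
def msize (n T : ℕ) (s : MState) : ℕ :=
  -- A missing radix counts as `T + 1`, more than any actual radix, so that creating a radix is a
  -- decrease as well.
  horner (T + 2) (fun j => if j < s.k then s.μ j else T + 1) n

theorem msize_mstep {s : MState} (hs : M.Inv s) (hk : s.k < n) :
    msize n T (M.mstep s) < msize n T s := by
  have hlt := hs.coll_lt hk
  have htk := topIdx_le s.μ s.k (M.coll s).1 (M.coll s).2
  have hs' := hs.mstep hk
  have hle : ∀ j < (M.mstep s).k, (M.mstep s).μ j ≤ T := by
    intro j hj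
    refine le_trans ?_ hs'.rprod_le
    exact Finset.single_le_prod' (f := (M.mstep s).μ) (fun i _ => hs'.one_le i)
      (Finset.mem_range.2 hj)
  have hk' : (M.mstep s).k = topIdx s.μ s.k (M.coll s).1 (M.coll s).2 + 1 := rfl
  have hμ : ∀ j, (M.mstep s).μ j = if j < topIdx s.μ s.k (M.coll s).1 (M.coll s).2 then s.μ j
    else if j = topIdx s.μ s.k (M.coll s).1 (M.coll s).2 then
    topDiff s.μ s.k (M.coll s).1 (M.coll s).2 else 1 := fun j => rfl
  refine horner_lt (t := topIdx s.μ s.k (M.coll s).1 (M.coll s).2) (fun j hj => ?_) ?_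
    (fun j => ?_) n (by omega)
  · rw [hk', if_pos (by omega), if_pos (by omega), hμ, if_pos hj]
  · have h1 := hle (topIdx s.μ s.k (M.coll s).1 (M.coll s).2) (by omega)
    rw [if_pos (by omega)]
    split_ifs with h
    · rw [hμ, if_neg (lt_irrefl _), if_pos rfl]
      exact topDiff_lt hs.one_le h
    · omega
  · split_ifs with h
    · have := hle j h; omega
    · omega

theorem exists_iterate_mstep : ∃ m, (M.mstep^[m] M.mstart).k = n := by
  suffices h : ∀ c s, M.Inv s → msize n T s ≤ c → ∃ m, (M.mstep^[m] s).k = n from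
    h _ _ M.inv_mstart le_rfl
  intro c
  induction c with
  | zero =>
    intro s hs hc
    refine ⟨0, le_antisymm hs.k_le (not_lt.1 fun hk => ?_)⟩
    have := M.msize_mstep hs hk
    omega
  | succ c ih =>
    intro s hs hc
    rcases hs.k_le.lt_or_eq with hk | hk
    · obtain ⟨m, hm⟩ := ih _ (hs.mstep hk) (by have := M.msize_mstep hs hk; omega)
      exact ⟨m + 1, hm⟩
    · exact ⟨0, hk⟩

open Classical in
/-- The number of steps of the construction. -/
noncomputable def msteps : ℕ := Nat.find M.exists_iterate_mstep

/-- The result of the construction. -/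
noncomputable def fin : MState := M.mstep^[M.msteps] M.mstart

theorem fin_k : M.fin.k = n := by
  classical exact Nat.find_spec M.exists_iterate_mstep

theorem inv_iterate {j : ℕ} (hj : j ≤ M.msteps) : M.Inv (M.mstep^[j] M.mstart) := by
  classical
  induction j with
  | zero => exact M.inv_mstart
  | succ j ih =>
    rw [Function.iterate_succ_apply']
    have h := ih (by omega)
    exact h.mstep (lt_of_le_of_ne h.k_le (Nat.find_min M.exists_iterate_mstep hj))

theorem iterate_k_lt {j : ℕ} (hj : j < M.msteps) : (M.mstep^[j] M.mstart).k < n := by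
  classical
  exact lt_of_le_of_ne (M.inv_iterate hj.le).k_le (Nat.find_min M.exists_iterate_mstep hj)

theorem inv_fin : M.Inv M.fin := M.inv_iterate le_rfl

end Machine

/-! ## Normal forms modulo triangular relations -/

/-- Digit `j` of `V` in the mixed radix `ρ`. -/
def dig (ρ : ℕ → ℕ) (V j : ℕ) : ℕ := V / rprod ρ j % ρ j

/-- The number with digits `d`. -/
def dsum (ρ d : ℕ → ℕ) (t : ℕ) : ℕ := ∑ j ∈ Finset.range t, d j * rprod ρ j

theorem dsum_succ (ρ d : ℕ → ℕ) (t : ℕ) : dsum ρ d (t + 1) = dsum ρ d t + d t * rprod ρ t :=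
  Finset.sum_range_succ _ _

theorem dsum_lt {ρ d : ℕ → ℕ} {t : ℕ} (h : ∀ j < t, d j < ρ j) : dsum ρ d t < rprod ρ t := by
  induction t with
  | zero => simp [dsum, rprod]
  | succ t ih =>
    rw [dsum_succ, rprod_succ]
    have h1 := ih fun j hj => h j (by omega)
    calc _ < (d t + 1) * rprod ρ t := by rw [add_mul]; omega
      _ ≤ ρ t * rprod ρ t := Nat.mul_le_mul_right _ (h t (by omega))
      _ = _ := mul_comm _ _

theorem dig_dsum {ρ d : ℕ → ℕ} {t j : ℕ} (h : ∀ j < t, d j < ρ j) (hj : j < t) :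
    dig ρ (dsum ρ d t) j = d j := by
  have hpos : 0 < rprod ρ j := Finset.prod_pos fun i hi => by
    have := h i (by simp at hi; omega); omega
  have key : ∀ u, j < u → u ≤ t → ∃ a, dsum ρ d u = dsum ρ d j + rprod ρ j * (d j + ρ j * a) := by
    intro u hu
    induction u with
    | zero => omega
    | succ u ih =>
      intro hut
      rcases Nat.lt_succ_iff_lt_or_eq.1 hu with h1 | rfl
      · obtain ⟨a, ha⟩ := ih h1 (by omega)
        obtain ⟨c, hc⟩ : rprod ρ (j + 1) ∣ rprod ρ u :=
          Finset.prod_dvd_prod_of_subset _ _ _ (by simpa using h1)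
        refine ⟨a + d u * c, ?_⟩
        rw [dsum_succ, ha, hc, rprod_succ]
        ring
      · exact ⟨0, by rw [dsum_succ]; ring⟩
  obtain ⟨a, ha⟩ := key t hj le_rfl
  rw [dig, ha, Nat.add_mul_div_left _ _ hpos, Nat.div_eq_of_lt (dsum_lt fun i hi => h i (by omega)),
    zero_add, Nat.add_mul_mod_self_left, Nat.mod_eq_of_lt (h j hj)]

theorem dgt_eq_dig {μ : ℕ → ℕ} {n X : ℕ} (hX : X < rprod μ n) (j : ℕ) :
    dgt μ n X j = if j < n then dig μ X j else 0 := by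
  unfold dgt
  split_ifs with h1 h2
  · rfl
  · rw [h2, Nat.div_eq_of_lt hX]
  · rfl

section Relations

variable (μ : ℕ → ℕ) (rows : ℕ → ℕ × ℕ)

/-- The subgroup that is generated by the first `t` relations. -/
def relGroup : ℕ → AddSubgroup (ℕ → ℤ)
  | 0 => ⊥
  | t + 1 => relGroup t ⊔ AddSubgroup.zmultiples (rv μ t (rows t))

variable {μ rows}

theorem rv_eq_zero {t j : ℕ} (h : t < j) (r : ℕ × ℕ) : rv μ t r j = 0 := by
  rw [rv, if_neg h.not_gt, if_neg h.ne']

theorem rv_of_lt {t j : ℕ} (h : j < t) (r : ℕ × ℕ) :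
    rv μ t r j = (dig μ r.1 j : ℤ) - dig μ r.2 j := by
  rw [rv, if_pos h]; rfl

theorem relGroup_le {H : AddSubgroup (ℕ → ℤ)} {t : ℕ} (h : ∀ u < t, rv μ u (rows u) ∈ H) :
    relGroup μ rows t ≤ H := by
  induction t with
  | zero => exact bot_le
  | succ t ih =>
    exact sup_le (ih fun u hu => h u (by omega))
      ((AddSubgroup.zmultiples_le_of_mem (h t (by omega))))

theorem relGroup_mono {s t : ℕ} (h : s ≤ t) : relGroup μ rows s ≤ relGroup μ rows t := by
  induction h with
  | refl => exact le_rfl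
  | step _ ih => exact ih.trans le_sup_left

theorem rv_mem_relGroup {u t : ℕ} (h : u < t) : rv μ u (rows u) ∈ relGroup μ rows t :=
  relGroup_mono (Nat.succ_le_of_lt h) (AddSubgroup.mem_sup_right (AddSubgroup.mem_zmultiples _))

theorem apply_eq_zero_of_mem_relGroup {t : ℕ} {h : ℕ → ℤ} (hh : h ∈ relGroup μ rows t) {j : ℕ}
    (hj : t ≤ j) : h j = 0 := by
  induction t generalizing h with
  | zero => rw [relGroup, AddSubgroup.mem_bot] at hh; simp [hh]
  | succ t ih =>
    obtain ⟨g, hg, _, ⟨z, rfl⟩, rfl⟩ := AddSubgroup.mem_sup.1 hh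
    simp [ih hg (by omega), rv_eq_zero (show t < j by omega)]

/-- In the highest coordinate only the last relation contributes, with a multiple of its radix. The
size condition forces that multiple to vanish, and induction does the rest; hence normal forms are
unique. -/
theorem eq_zero_of_mem_relGroup {t : ℕ} (hdiag : ∀ u < t, rv μ u (rows u) u = μ u) {h : ℕ → ℤ}
    (hh : h ∈ relGroup μ rows t) (hlt : ∀ j < t, |h j| < μ j) : h = 0 := by
  induction t generalizing h with
  | zero => rwa [relGroup, AddSubgroup.mem_bot] at hh
  | succ t ih =>
    obtain ⟨g, hg, _, ⟨z, rfl⟩, rfl⟩ := AddSubgroup.mem_sup.1 hh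
    have h1 := hlt t (by omega)
    simp only [Pi.add_apply, apply_eq_zero_of_mem_relGroup hg le_rfl, Pi.smul_apply, smul_eq_mul,
      hdiag t (by omega), zero_add, abs_mul, Nat.abs_cast] at h1
    have hz : z = 0 := by
      by_contra hz
      have h2 := Int.one_le_abs hz
      nlinarith
    subst hz
    simp only [zero_smul, add_zero] at hlt ⊢
    exact ih (fun u hu => hdiag u (by omega)) hg fun j hj => hlt j (by omega)

/-- Multiplication by the top radix lets the top relation clear the top coordinate; then induct. So
the product of the radices annihilates the quotient, and `Δ` matters only modulo it. -/
theorem rprod_smul_mem_relGroup {t : ℕ} (hdiag : ∀ u < t, rv μ u (rows u) u = μ u) {x : ℕ → ℤ}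
    (hx : ∀ j, t ≤ j → x j = 0) : (rprod μ t : ℤ) • x ∈ relGroup μ rows t := by
  induction t generalizing x with
  | zero =>
    rw [show x = 0 from funext fun j => hx j (Nat.zero_le j), smul_zero]
    exact AddSubgroup.zero_mem _
  | succ t ih =>
    have h1 := ih (x := (μ t : ℤ) • x - x t • rv μ t (rows t)) (fun u hu => hdiag u (by omega)) ?_
    · rw [show (rprod μ (t + 1) : ℤ) • x = (rprod μ t : ℤ) • ((μ t : ℤ) • x -
        x t • rv μ t (rows t)) + (rprod μ t * x t) • rv μ t (rows t) by
          rw [rprod_succ, smul_sub, smul_smul, smul_smul, sub_add_cancel]; push_cast; rfl]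
      exact AddSubgroup.add_mem _ (AddSubgroup.mem_sup_left h1)
        (AddSubgroup.zsmul_mem _ (rv_mem_relGroup (Nat.lt_succ_self t)) _)
    · intro j hj
      rcases hj.eq_or_lt with rfl | hj
      · simp [hdiag t (by omega), mul_comm]
      · simp [hx j (by omega), rv_eq_zero hj]

/-- Division with remainder from the highest coordinate down: the lower relations no longer affect a
coordinate once it is reduced. -/
theorem exists_reduced {t : ℕ} (hμ : ∀ j, 1 ≤ μ j) (hdiag : ∀ u < t, rv μ u (rows u) u = μ u)
    (x : ℕ → ℤ) : ∃ h ∈ relGroup μ rows t, ∀ j < t, 0 ≤ (x - h) j ∧ (x - h) j < μ j := by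
  induction t generalizing x with
  | zero => exact ⟨0, AddSubgroup.zero_mem _, fun j hj => absurd hj (Nat.not_lt_zero j)⟩
  | succ t ih =>
    obtain ⟨h, hh, hlt⟩ := ih (fun u hu => hdiag u (by omega))
      (x - (x t / μ t) • rv μ t (rows t))
    refine ⟨h + (x t / μ t) • rv μ t (rows t), AddSubgroup.add_mem _
      (AddSubgroup.mem_sup_left hh) (AddSubgroup.zsmul_mem _
        (rv_mem_relGroup (Nat.lt_succ_self t)) _), fun j hj => ?_⟩
    rw [show x - (h + (x t / μ t) • rv μ t (rows t)) =
      x - (x t / μ t) • rv μ t (rows t) - h by abel]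
    rcases Nat.lt_succ_iff_lt_or_eq.1 hj with hj | rfl
    · exact hlt j hj
    · have hpos : (0 : ℤ) < μ j := by exact_mod_cast hμ j
      simp only [Pi.sub_apply, Pi.smul_apply, smul_eq_mul, hdiag j (by omega),
        apply_eq_zero_of_mem_relGroup hh le_rfl, sub_zero]
      have := Int.emod_add_mul_ediv (x j) (μ j)
      have h1 := Int.emod_nonneg (x j) hpos.ne'
      have h2 := Int.emod_lt_of_pos (x j) hpos
      constructor <;> linarith [mul_comm (x j / (μ j : ℤ)) (μ j : ℤ)]

end Relations

/-! ## The sketch -/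

/-- Extension of a vector by zero. -/
def extend (n : ℕ) : (Fin n → ℤ) →+ (ℕ → ℤ) where
  toFun x j := if h : j < n then x ⟨j, h⟩ else 0
  map_zero' := by ext; simp
  map_add' x y := by ext j; by_cases h : j < n <;> simp [h]

theorem extend_single {n : ℕ} (i : Fin n) (z : ℤ) :
    extend n (Pi.single i z) = Pi.single (i : ℕ) z := by
  ext j
  by_cases h : j < n
  · simp [extend, h, Pi.single_apply, Fin.ext_iff]
  · have : j ≠ i := fun e => h (e ▸ i.2)
    simp [extend, h, this]

namespace Machine

variable {n T : ℕ} (M : Machine n T)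

/-- The group of all relations. -/
noncomputable def rels : AddSubgroup (ℕ → ℤ) := relGroup M.fin.μ M.fin.rows n

theorem fin_diag : ∀ u < n, rv M.fin.μ u (M.fin.rows u) u = M.fin.μ u := fun u hu =>
  M.inv_fin.row_diag u (by rwa [M.fin_k])

/-- The module of the sketch. -/
abbrev Sketch : Type := (Fin n → ℤ) ⧸ M.rels.comap (extend n)

theorem mk_eq_mk_iff {x y : Fin n → ℤ} :
    (QuotientAddGroup.mk x : M.Sketch) = QuotientAddGroup.mk y ↔
      extend n y - extend n x ∈ M.rels := by
  rw [QuotientAddGroup.eq, AddSubgroup.mem_comap, map_add, map_neg, neg_add_eq_sub]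

/-- The number of elements of the sketch. -/
noncomputable def size : ℕ := rprod M.fin.μ n

theorem size_le : M.size ≤ T := by
  have := M.inv_fin.rprod_le
  rwa [M.fin_k] at this

theorem size_pos : 0 < M.size := rprod_pos M.inv_fin.one_le n

theorem extend_wv {X : ℕ} (hX : X < M.size) :
    extend n (fun i => wv M.fin.μ n X i) = wv M.fin.μ n X := by
  ext j
  by_cases h : j < n
  · simp [extend, h]
  · simp [extend, h, wv, dgt_eq_dig hX]

theorem exists_code (x : Fin n → ℤ) :
    ∃ X, X < M.size ∧ wv M.fin.μ n X - extend n x ∈ M.rels := by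
  obtain ⟨h, hh, hlt⟩ := exists_reduced M.inv_fin.one_le M.fin_diag (extend n x)
  have hd : ∀ j < n, ((extend n x - h) j).toNat < M.fin.μ j := fun j hj => by
    have := hlt j hj; omega
  have hX := dsum_lt hd
  refine ⟨_, hX, ?_⟩
  rw [show wv M.fin.μ n (dsum M.fin.μ (fun j => ((extend n x - h) j).toNat) n) - extend n x = -h from
    ?_]
  · exact M.rels.neg_mem hh
  · ext j
    rw [Pi.sub_apply, Pi.neg_apply]
    change ((dgt _ _ _ _ : ℕ) : ℤ) - _ = _
    rw [dgt_eq_dig hX]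
    split_ifs with hj
    · rw [dig_dsum hd hj]
      have := hlt j hj
      simp only [Pi.sub_apply] at this ⊢
      omega
    · rw [apply_eq_zero_of_mem_relGroup hh (not_lt.1 hj)]
      simp [extend, hj]

theorem eq_of_wv_sub_mem {X Y : ℕ} (hX : X < M.size) (hY : Y < M.size)
    (h : wv M.fin.μ n X - wv M.fin.μ n Y ∈ M.rels) : X = Y := by
  have hpos : ∀ j, 0 < M.fin.μ j := M.inv_fin.one_le
  have h0 := eq_zero_of_mem_relGroup M.fin_diag h fun j hj => by
    simp only [Pi.sub_apply, wv, dgt_eq_dig hX, dgt_eq_dig hY, if_pos hj]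
    have h1 : dig M.fin.μ X j < M.fin.μ j := Nat.mod_lt _ (hpos j)
    have h2 : dig M.fin.μ Y j < M.fin.μ j := Nat.mod_lt _ (hpos j)
    rw [abs_lt]
    constructor <;> omega
  have hj : ∀ j < n, dig M.fin.μ X j = dig M.fin.μ Y j := by
    intro j hj
    have := congrFun h0 j
    simp only [Pi.sub_apply, wv, dgt_eq_dig hX, dgt_eq_dig hY, if_pos hj, Pi.zero_apply] at this
    omega
  have key : ∀ t ≤ n, X % rprod M.fin.μ t = Y % rprod M.fin.μ t := by
    intro t
    induction t with
    | zero => intro _; simp [rprod_zero, Nat.mod_one]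
    | succ t ih =>
      intro ht
      rw [rprod_succ, Nat.mod_mul, Nat.mod_mul, ih (by omega)]
      have := hj t (by omega)
      unfold dig at this
      rw [this]
  have := key n le_rfl
  rwa [Nat.mod_eq_of_lt (show X < rprod _ n from hX),
    Nat.mod_eq_of_lt (show Y < rprod _ n from hY)] at this

/-- The representation of the elements of the sketch. -/
noncomputable def codeNat (q : M.Sketch) : ℕ :=
  (M.exists_code q.out).choose

theorem codeNat_lt (q : M.Sketch) : M.codeNat q < M.size :=
  (M.exists_code q.out).choose_spec.1

theorem codeNat_injective : Function.Injective M.codeNat := by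
  have key : ∀ q, (QuotientAddGroup.mk (fun i => wv M.fin.μ n (M.codeNat q) i) : M.Sketch) = q := by
    intro q
    conv_rhs => rw [← QuotientAddGroup.out_eq' q]
    rw [eq_comm, M.mk_eq_mk_iff, M.extend_wv (M.codeNat_lt q)]
    exact (M.exists_code q.out).choose_spec.2
  intro q q' h
  rw [← key q, h, key q']

/-- By uniqueness of normal forms the code does not depend on the representative chosen in
`codeNat`, so any program that finds a congruent reduced word finds the code. -/
theorem codeNat_mk {x : Fin n → ℤ} {X : ℕ} (hX : X < M.size)
    (h : wv M.fin.μ n X - extend n x ∈ M.rels) : M.codeNat (QuotientAddGroup.mk x) = X := by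
  refine M.eq_of_wv_sub_mem (M.codeNat_lt _) hX ?_
  have h1 := (M.exists_code (QuotientAddGroup.mk x : M.Sketch).out).choose_spec.2
  have h2 := M.mk_eq_mk_iff.1 (QuotientAddGroup.out_eq' (QuotientAddGroup.mk x : M.Sketch))
  rw [show wv M.fin.μ n (M.codeNat (QuotientAddGroup.mk x)) - wv M.fin.μ n X =
    (wv M.fin.μ n (M.codeNat (QuotientAddGroup.mk x)) -
      extend n (QuotientAddGroup.mk x : M.Sketch).out) -
    (extend n x - extend n (QuotientAddGroup.mk x : M.Sketch).out) -
    (wv M.fin.μ n X - extend n x) by abel]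
  exact M.rels.sub_mem (M.rels.sub_mem h1 h2) h

/-- The difference between `x` and its normal form lies in the relations, hence in `H`, hence
reaches `p`. Walking along the normal form restores the missing part. -/
theorem R_of_code {x : Fin n → ℤ} {X : ℕ} (hX : X < M.size)
    (h : wv M.fin.μ n X - extend n x ∈ M.rels) :
    M.R (extend n x) (walk M.stp 0 M.fin.μ n X M.fin.p) := by
  obtain ⟨H, N, -, -, hR, hrows⟩ := M.inv_fin.exists_subgroup
  rw [M.fin_k] at hrows
  have hle : M.rels ≤ H := relGroup_le hrows
  have h1 := M.R_walk (b := 0) (k := n) (X := X) (μ := M.fin.μ) (fun t ht => ?_)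
    (hR _ (hle (M.rels.neg_mem h)))
  · convert h1 using 1
    rw [show sg 0 = 1 from rfl, one_smul]
    abel
  · by_contra hlt
    rw [dgt_eq_dig hX, if_neg hlt] at ht
    exact ht rfl

end Machine

/-! ## Programs for the list of radices -/

/-- Append the binary digits of `m` to the list `L` of digits in base `b`. -/
def pushBits (b m L : ℕ) : ℕ :=
  if m = 0 then L else pushBits b (m / 2) (L * b + m % 2)
decreasing_by omega

/-- The list of all radices `≠ 1` below `k`, as digits in base `n + 2`. -/
def enc (n : ℕ) (μ : ℕ → ℕ) : ℕ → ℕ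
  | 0 => 0
  | k + 1 => if μ k = 1 then enc n μ k else pushBits (n + 2) (μ k) (enc n μ k * (n + 2) + (k + 2))

theorem le_pushBits {b : ℕ} (hb : 1 ≤ b) (m L : ℕ) : L ≤ pushBits b m L := by
  induction m using Nat.strong_induction_on generalizing L with
  | _ m ih =>
    rw [pushBits]
    split_ifs with h
    · exact le_rfl
    · exact (Nat.le_add_right_of_le (Nat.le_mul_of_pos_right L hb)).trans (ih (m / 2) (by omega) _)

/-- Numbers whose value is bounded by that of a register. -/
def Ex.small : Ex → Bool
  | reg x => decide (x < 48 ∧ x ≠ 3)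
  | const k => decide (k ≤ 4)
  | op .sub a _ => a.small
  | op .div a _ => a.small
  | op .mod a _ => a.small
  | _ => false

theorem Ex.eval_le_of_small {Z : ℕ} (hZ : 4 ≤ Z) {σ : ℕ → ℕ} (hσ : ∀ v < 48, v ≠ 3 → σ v ≤ Z) :
    ∀ e : Ex, e.small = true → e.eval σ ≤ Z
  | reg x, h => by
    have := of_decide_eq_true h
    exact hσ x this.1 this.2
  | const k, h => (of_decide_eq_true h : k ≤ 4).trans hZ
  | op .sub a _, h => (Nat.sub_le _ _).trans (eval_le_of_small hZ hσ a h)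
  | op .div a _, h => (Nat.div_le_self _ _).trans (eval_le_of_small hZ hσ a h)
  | op .mod a _, h => (Nat.mod_le _ _).trans (eval_le_of_small hZ hσ a h)

theorem Ht.asg_small {Δ : ℤ} {Z S : ℕ} {σ : ℕ → ℕ} {Q : (ℕ → ℕ) → Prop} (hZ : 4 ≤ Z) {x : ℕ}
    {e : Ex} (he : (e.ok && decide (x < 48 ∧ x ≠ 3) && e.small) = true)
    (hQ : Q (upd σ x (e.eval σ))) : Ht Δ Z S (_root_.asg x e) σ Q := by
  rw [Bool.and_eq_true] at he
  exact .asg hZ he.1 (fun hσ => Ex.eval_le_of_small hZ hσ e he.2) hQ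

/-- Look up the radix of the letter in register `41` in the list in register `20`. -/
def getLoop : Cmd :=
  whl (reg 44)
    (asg 46 (reg 44 % (reg 0 + 2)) ;; asg 44 (reg 44 / (reg 0 + 2)) ;;
      -- A digit below 2 is a bit of the radix being assembled in register 45. A larger digit is the
      -- letter to which the assembled radix belongs.
      branch (2 - reg 46) (asg 45 (2 * reg 45 + reg 46))
        (branch (reg 46 - (reg 41 + 2) + (reg 41 + 2 - reg 46)) nop (asg 43 (reg 45)) ;; asg 45 0))

def getCmd : Cmd := asg 44 (reg 20) ;; asg 45 0 ;; asg 43 1 ;; getLoop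

/-- Append the letter in register `30` with the radix in register `31` to the list in
register `29`. -/
def pushCmd : Cmd :=
  branch (reg 31 - 1)
    (asg 29 (reg 29 * (reg 0 + 2) + (reg 30 + 2)) ;;
      whl (reg 31) (asg 29 (reg 29 * (reg 0 + 2) + reg 31 % 2) ;; asg 31 (reg 31 / 2)))
    nop

/-- A list of radices that fits into memory. -/
structure Radices (n T : ℕ) (μ : ℕ → ℕ) (k : ℕ) : Prop where
  k_le : k ≤ n
  one_le : ∀ j, 1 ≤ μ j
  eq_one : ∀ j, k ≤ j → μ j = 1
  rprod_le : rprod μ k ≤ T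

theorem Radices.le {n T k : ℕ} {μ : ℕ → ℕ} (h : Radices n T μ k) (j : ℕ) : μ j ≤ T := by
  have h1 : 1 ≤ T := (rprod_pos h.one_le k).trans_le h.rprod_le
  by_cases hj : j < k
  · exact (Finset.single_le_prod' (fun i _ => h.one_le i) (Finset.mem_range.2 hj)).trans h.rprod_le
  · rw [h.eq_one j (not_lt.1 hj)]; exact h1

/-! ### Correctness of the list programs -/

section Lists

variable {Δ : ℤ} {Z S : ℕ} {σ : ℕ → ℕ} {Q : (ℕ → ℕ) → Prop}

/-- The loop stops at an empty list, and a list ending in zero bits alone would look empty. The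
letter stored in front of the bits provides `L ≠ 0`. -/
theorem getLoop_digit (hZ : 4 ≤ Z) {L d : ℕ} (hd : d < 2) (hL : L ≠ 0)
    (h44 : σ 44 = L * (σ 0 + 2) + d) (hle : 2 * σ 45 + d ≤ Z)
    (h : ∀ σ', σ' 44 = L → σ' 45 = 2 * σ 45 + d → (∀ v < 44, σ' v = σ v) →
      Ht Δ Z S getLoop σ' Q) : Ht Δ Z S getLoop σ Q := by
  have e1 : (L * (σ 0 + 2) + d) % (σ 0 + 2) = d := by
    rw [mul_comm, Nat.mul_add_mod, Nat.mod_eq_of_lt (by omega)]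
  have e2 : (L * (σ 0 + 2) + d) / (σ 0 + 2) = L := by
    rw [mul_comm, Nat.mul_add_div (by omega), Nat.div_eq_of_lt (by omega), add_zero]
  refine Ht.whl_step hZ rfl ?_ ?_
  · rw [Ex.eval_reg, h44]
    have := Nat.mul_pos (Nat.pos_of_ne_zero hL) (show 0 < σ 0 + 2 by omega)
    omega
  refine Ht.seq (Ht.asg_small hZ rfl (Ht.seq (Ht.asg_small hZ rfl
    (Ht.branch hZ rfl (fun _ => Ht.asg hZ rfl ?_ ?_) fun h0 => ?_))))
  · intro _; simpa [upd, h44, e1] using hle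
  · refine h _ ?_ ?_ fun v hv => ?_
    · simp [upd, h44, e2]
    · simp [upd, h44, e1]
    · simp [upd, show v ≠ 44 by omega, show v ≠ 45 by omega, show v ≠ 46 by omega]
  · simp [upd, h44, e1] at h0
    omega

/-- Bits leave the list in the reverse of the order in which they entered: the bits of `m / 2` are
consumed first, and the parity of `m` completes the number. -/
theorem getLoop_bits (hZ : 4 ≤ Z) (m : ℕ) {L : ℕ} (hL : L ≠ 0) (h45 : σ 45 = 0)
    (h44 : σ 44 = pushBits (σ 0 + 2) m L) (hm : m ≤ Z)
    (h : ∀ σ', σ' 44 = L → σ' 45 = m → (∀ v < 44, σ' v = σ v) →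
      Ht Δ Z S getLoop σ' Q) : Ht Δ Z S getLoop σ Q := by
  induction m using Nat.strong_induction_on generalizing L with
  | _ m ih =>
    rw [pushBits] at h44
    split_ifs at h44 with h0
    · subst h0
      exact h σ h44 h45 fun _ _ => rfl
    · refine ih (m / 2) (by omega) (L := L * (σ 0 + 2) + m % 2) (fun h' => ?_) h44 (by omega)
        fun σ₁ h1 h2 h3 => ?_
      · have := Nat.mul_pos (Nat.pos_of_ne_zero hL) (show 0 < σ 0 + 2 by omega)
        omega
      · refine getLoop_digit hZ (d := m % 2) (by omega) hL (by rw [h1, h3 0 (by norm_num)])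
          (by omega) fun σ₂ g1 g2 g3 => h σ₂ g1 (by omega) fun v hv => ?_
        rw [g3 v hv, h3 v hv]

theorem getLoop_ht (hZ : 4 ≤ Z) {n k : ℕ} {μ : ℕ → ℕ} (hk : k ≤ n) (hμ : ∀ j, μ j ≤ Z)
    (h0 : σ 0 = n) (h44 : σ 44 = enc n μ k) (h45 : σ 45 = 0) (h41 : σ 41 ≤ n) :
    Ht Δ Z S getLoop σ fun σ' =>
      σ' 43 = (if σ 41 < k ∧ μ (σ 41) ≠ 1 then μ (σ 41) else σ 43) ∧ ∀ v < 43, σ' v = σ v := by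
  induction k generalizing σ with
  | zero => exact Ht.whl_done hZ rfl h44 ⟨by simp, fun _ _ => rfl⟩
  | succ k ih =>
    rw [enc] at h44
    split_ifs at h44 with h1
    · refine (ih (by omega) h0 h44 h45 h41).mono fun σ' h => ⟨h.1.trans ?_, h.2⟩
      by_cases hk : σ 41 = k
      · simp [hk, h1]
      · simp [show σ 41 < k ↔ σ 41 < k + 1 by omega]
    · rw [← h0] at h44
      refine getLoop_bits hZ _ (by omega) h45 h44 (hμ k) fun σ₁ g1 g2 g3 => ?_
      have f0 := g3 0 (by norm_num)
      have e1 : (enc n μ k * (σ 0 + 2) + (k + 2)) % (σ 0 + 2) = k + 2 := by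
        rw [mul_comm, Nat.mul_add_mod, Nat.mod_eq_of_lt (by omega)]
      have e2 : (enc n μ k * (σ 0 + 2) + (k + 2)) / (σ 0 + 2) = enc n μ k := by
        rw [mul_comm, Nat.mul_add_div (by omega), Nat.div_eq_of_lt (by omega), add_zero]
      rw [h0] at g1 e1 e2 f0
      have f41 := g3 41 (by norm_num)
      refine Ht.whl_step hZ rfl (by rw [Ex.eval_reg, g1]; omega) ?_
      refine Ht.seq (Ht.asg_small hZ rfl (Ht.seq (Ht.asg_small hZ rfl
        (Ht.branch hZ rfl (fun hne => ?_) fun _ => Ht.seq ?_))))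
      · simp [upd, g1, f0, e1] at hne
      · refine Ht.branch hZ rfl (fun hne => Ht.nop ?_) (fun heq => Ht.asg_small hZ rfl ?_)
        · simp [upd, g1, f0, e1, f41] at hne
          refine Ht.asg_small hZ rfl ((ih (by omega) ?_ ?_ ?_ ?_).mono fun σ' h => ⟨?_, ?_⟩)
          · simp [upd, f0]
          · simp [upd, f0, g1, e2]
          · simp [upd]
          · simp [upd, f41, h41]
          · rw [h.1]
            simp [upd, f41, g3 43 (by norm_num), show σ 41 < k ↔ σ 41 < k + 1 by omega]
          · intro v hv
            rw [h.2 v hv, ← g3 v (by omega)]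
            simp [upd, show v ≠ 44 by omega, show v ≠ 45 by omega, show v ≠ 46 by omega]
        · simp [upd, g1, f0, e1, f41] at heq
          have e : σ 41 = k := by omega
          refine Ht.asg_small hZ rfl ((ih (by omega) ?_ ?_ ?_ ?_).mono fun σ' h => ⟨?_, ?_⟩)
          · simp [upd, f0]
          · simp [upd, f0, g1, e2]
          · simp [upd]
          · simp [upd, f41, h41]
          · rw [h.1]
            simp [upd, f41, e, g2, h1]
          · intro v hv
            rw [h.2 v hv, ← g3 v (by omega)]
            simp [upd, show v ≠ 44 by omega, show v ≠ 45 by omega, show v ≠ 46 by omega,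
              show v ≠ 43 by omega]

/-- The initial value 1 of register 43 is the answer for every letter that is not listed, including
those from `k` on. -/
theorem getCmd_ht (hZ : 4 ≤ Z) {n T k : ℕ} {μ : ℕ → ℕ} (hμ : Radices n T μ k) (hT : T ≤ Z)
    (h0 : σ 0 = n) (h20 : σ 20 = enc n μ k) (h41 : σ 41 ≤ n) :
    Ht Δ Z S getCmd σ fun σ' => σ' 43 = μ (σ 41) ∧ ∀ v < 43, σ' v = σ v := by
  refine Ht.seq (Ht.asg_small hZ rfl (Ht.seq (Ht.asg_small hZ rfl (Ht.seq
    (Ht.asg_small hZ rfl ((getLoop_ht (n := n) (k := k) (μ := μ) hZ hμ.k_le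
      (fun j => (hμ.le j).trans hT) ?_ ?_ ?_ ?_).mono fun σ' h => ⟨?_, fun v hv => ?_⟩))))))
  · simp [upd, h0]
  · simp [upd, h20]
  · simp [upd]
  · simp [upd, h41]
  · rw [h.1]
    simp only [upd, Ex.eval_one]
    by_cases h1 : σ 41 < k
    · by_cases h2 : μ (σ 41) = 1 <;> simp [h1, h2]
    · simp [h1, hμ.eq_one _ (not_lt.1 h1)]
  · rw [h.2 v hv]
    simp [upd, show v ≠ 44 by omega, show v ≠ 45 by omega, show v ≠ 43 by omega]

theorem pushLoop_ht (hZ : 4 ≤ Z) (m : ℕ) {L : ℕ} (h31 : σ 31 = m) (h29 : σ 29 = L)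
    (hle : pushBits (σ 0 + 2) m L ≤ Z) :
    Ht Δ Z S (whl (reg 31) (asg 29 (reg 29 * (reg 0 + 2) + reg 31 % 2) ;; asg 31 (reg 31 / 2))) σ
      fun σ' => σ' 29 = pushBits (σ 0 + 2) m L ∧ ∀ v, v ≠ 29 → v ≠ 31 → σ' v = σ v := by
  induction m using Nat.strong_induction_on generalizing L σ with
  | _ m ih =>
    rw [pushBits] at hle ⊢
    split_ifs at hle ⊢ with h0
    · exact Ht.whl_done hZ rfl (by rw [Ex.eval_reg, h31, h0]) ⟨h29, fun _ _ _ => rfl⟩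
    · refine Ht.whl_step hZ rfl (by rw [Ex.eval_reg, h31]; exact h0)
        (Ht.seq (Ht.asg hZ rfl ?_ (Ht.asg_small hZ rfl
          ((ih (m / 2) (by omega) (L := L * (σ 0 + 2) + m % 2) ?_ ?_ ?_).mono fun σ' h =>
            ⟨h.1.trans ?_, fun v h1 h2 => (h.2 v h1 h2).trans ?_⟩))))
      · intro _
        have := le_pushBits (show 1 ≤ σ 0 + 2 by omega) (m / 2) (L * (σ 0 + 2) + m % 2)
        simp [h31, h29]
        omega
      · simp [upd, h31]
      · simp [upd, h31, h29]
      · simpa [upd] using hle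
      · simp [upd]
      · simp [upd, h1, h2]

theorem pushCmd_ht (hZ : 4 ≤ Z) {n k : ℕ} {μ : ℕ → ℕ} (h0 : σ 0 = n) (hk : σ 30 = k)
    (hμ : σ 31 = μ k) (h1 : 1 ≤ μ k) (h29 : σ 29 = enc n μ k) (hle : enc n μ (k + 1) ≤ Z) :
    Ht Δ Z S pushCmd σ fun σ' => σ' 29 = enc n μ (k + 1) ∧ ∀ v, v ≠ 29 → v ≠ 31 → σ' v = σ v := by
  rw [enc] at hle ⊢
  refine Ht.branch hZ rfl (fun h => Ht.seq (Ht.asg hZ rfl ?_ ((pushLoop_ht hZ (μ k)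
    (L := enc n μ k * (n + 2) + (k + 2)) ?_ ?_ ?_).mono fun σ' h => ⟨h.1.trans ?_,
      fun v h1 h2 => (h.2 v h1 h2).trans ?_⟩))) fun h => Ht.nop ⟨?_, fun _ _ _ => rfl⟩
  · simp [hμ] at h
    rw [if_neg (by omega)] at hle
    intro _
    have := le_pushBits (show 1 ≤ n + 2 by omega) (μ k) (enc n μ k * (n + 2) + (k + 2))
    simp [h0, hk, h29]
    omega
  · simp [upd, hμ]
  · simp [upd, h0, h29, hk]
  · simp [hμ] at h
    rw [if_neg (by omega)] at hle
    simpa [upd, h0] using hle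
  · rename_i h'
    simp [hμ] at h'
    rw [if_neg (by omega)]
    simp [upd, h0]
  · simp [upd, h1]
  · simp [hμ] at h
    rw [if_pos (by omega), h29]

end Lists

/-! ## The construction as a program -/

namespace Machine

variable {n T : ℕ} (M : Machine n T)

def Reach (y : ℕ) : Prop := ∃ x, M.R x y

variable {M}

theorem Reach.stp {b i y : ℕ} (h : M.Reach y) (hi : i < n) : M.Reach (M.stp b i y) :=
  let ⟨_, hx⟩ := h
  ⟨_, M.R_step hi hx⟩

theorem Reach.lt {y : ℕ} (h : M.Reach y) : y < T :=
  let ⟨_, hx⟩ := h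
  M.R_lt hx

theorem Reach.iterate {b i y : ℕ} (h : M.Reach y) (hi : i < n) (c : ℕ) :
    M.Reach ((M.stp b i)^[c] y) :=
  let ⟨_, hx⟩ := h
  ⟨_, M.R_iterate hi hx c⟩

theorem Reach.walkTo {b k X y : ℕ} {μ : ℕ → ℕ} (h : M.Reach y)
    (hk : ∀ t, dgt μ k X t ≠ 0 → t < n) (t : ℕ) : M.Reach (walkTo M.stp b μ k X y t) := by
  induction t with
  | zero => exact h
  | succ t ih =>
    rw [_root_.walkTo]
    by_cases h0 : dgt μ k X t = 0
    · rw [h0]; exact ih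
    · exact ih.iterate (hk t h0) _

theorem Reach.nxt {b k y : ℕ} {μ : ℕ → ℕ} (h : M.Reach y) (hb : b ≤ 1) (hk : k < n) :
    M.Reach (nxt M.stp b μ k y) :=
  let ⟨_, hx⟩ := h
  ⟨_, M.R_nxt hb hk hx⟩

end Machine

/-- Programs for the transition function and for the initial state of an automaton. -/
structure Env (Δ : ℤ) (Z S : ℕ) {n T : ℕ} (M : Machine n T) (stepC startC : Cmd) : Prop where
  four_le : 4 ≤ Z
  T_le : T + 1 ≤ Z
  n_le : n + 2 ≤ Z
  enc_le : ∀ μ k, Radices n T μ k → enc n μ k ≤ Z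
  step : ∀ σ : ℕ → ℕ, σ 0 = n → σ 41 < n → M.Reach (σ 42) → σ 33 ≤ 1 →
    ∀ Q : (ℕ → ℕ) → Prop, Q (upd σ 42 (M.stp (σ 33) (σ 41) (σ 42))) → Ht Δ Z S stepC σ Q
  start : ∀ σ : ℕ → ℕ, σ 0 = n → ∀ Q : (ℕ → ℕ) → Prop,
    (∀ σ', σ' 42 = M.init → (∀ v < 41, σ' v = σ v) → Q σ') → Ht Δ Z S startC σ Q

/-- Nonzero if and only if `a ≠ b`. -/
def Ex.ne (a b : Ex) : Ex := (a - b) + (b - a)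

theorem Ex.eval_ne {σ : ℕ → ℕ} {a b : Ex} : (a.ne b).eval σ ≠ 0 ↔ a.eval σ ≠ b.eval σ := by
  simp only [Ex.ne, eval_add, eval_sub]; omega

theorem Ex.eval_ne_eq_zero {σ : ℕ → ℕ} {a b : Ex} :
    (a.ne b).eval σ = 0 ↔ a.eval σ = b.eval σ := by
  simp only [Ex.ne, eval_add, eval_sub]; omega

/-- Walk from the state in register `42` along the word in register `38`. -/
def walkCmd (stepC : Cmd) : Cmd :=
  asg 39 (reg 38) ;; asg 41 0 ;;
    whl (reg 24 + 1 - reg 41)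
      -- Digit `k` is unbounded: a radix one larger than the remaining number makes the remainder
      -- equal to that whole number.
      (getCmd ;; branch (reg 24 - reg 41) nop (asg 43 (reg 39 + 1)) ;;
        asg 40 (reg 39 % reg 43) ;; asg 39 (reg 39 / reg 43) ;;
          whl (reg 40) (stepC ;; asg 40 (reg 40 - 1)) ;; asg 41 (reg 41 + 1))

/-- Find the first collision from the state in register `34`. -/
def collCmd (stepC : Cmd) : Cmd :=
  asg 35 0 ;; asg 36 0 ;;
    -- The guard is nonzero exactly when register 36 is at least register 35, that is, while no
    -- smaller word leads to the same state.
    whl (1 - (reg 35 - reg 36))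
      (asg 35 (reg 35 + 1) ;; asg 42 (reg 34) ;; asg 38 (reg 35) ;; walkCmd stepC ;;
        asg 37 (reg 42) ;; asg 36 0 ;; asg 42 (reg 34) ;;
          whl ((reg 42).ne (reg 37))
            (asg 36 (reg 36 + 1) ;; asg 42 (reg 34) ;; asg 38 (reg 36) ;; walkCmd stepC))

/-- A walk leaves register 38 intact, so the second walk uses the same word, with the sign flipped
and restored afterwards. -/
def nxtCmd (stepC : Cmd) : Cmd :=
  collCmd stepC ;; asg 42 (reg 34) ;; asg 38 (reg 35) ;; walkCmd stepC ;; asg 33 (1 - reg 33) ;;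
    walkCmd stepC ;; asg 33 (1 - reg 33)

/-- Register 31 is the slow pointer and register 32 the fast one. They start after one and two
applications, which ensures a positive index. -/
def floydCmd (stepC : Cmd) : Cmd :=
  asg 34 (reg 23) ;; nxtCmd stepC ;; asg 31 (reg 42) ;; asg 34 (reg 31) ;; nxtCmd stepC ;;
    asg 32 (reg 42) ;;
      whl ((reg 31).ne (reg 32))
        (asg 34 (reg 31) ;; nxtCmd stepC ;; asg 31 (reg 42) ;; asg 34 (reg 32) ;; nxtCmd stepC ;;
          asg 34 (reg 42) ;; nxtCmd stepC ;; asg 32 (reg 42))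

/-! ### Correctness of walks, collision search and cycle finding -/

section Programs

variable {Δ : ℤ} {Z S n T : ℕ} {M : Machine n T} {stepC startC : Cmd}
  (E : Env Δ Z S M stepC startC) {σ : ℕ → ℕ} {μ : ℕ → ℕ} {k b : ℕ} {y : ℕ}
include E

/-- The registers with the list of radices and the sign. -/
structure Ctx (n : ℕ) (μ : ℕ → ℕ) (k b : ℕ) (σ : ℕ → ℕ) : Prop where
  dim : σ 0 = n
  list : σ 20 = enc n μ k
  stage : σ 24 = k
  sign : σ 33 = b
  sign_le : b ≤ 1

omit E in
theorem Ctx.of_eq {σ' : ℕ → ℕ} (h : Ctx n μ k b σ) {m : ℕ} (hm : 34 ≤ m)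
    (hf : ∀ v < m, σ' v = σ v) : Ctx n μ k b σ' where
  dim := (hf _ (by omega)).trans h.dim
  list := (hf _ (by omega)).trans h.list
  stage := (hf _ (by omega)).trans h.stage
  sign := (hf _ (by omega)).trans h.sign
  sign_le := h.sign_le

omit E in
theorem Ctx.upd (h : Ctx n μ k b σ) {x : ℕ} (hx : 34 ≤ x) (v : ℕ) :
    Ctx n μ k b (upd σ x v) :=
  h.of_eq le_rfl fun w hw => if_neg (by omega)

theorem Env.stepLoop_ht {i m : ℕ} (h0 : σ 0 = n) (h41 : σ 41 = i) (h33 : σ 33 = b) (hb : b ≤ 1)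
    (hy : M.Reach (σ 42)) (h40 : σ 40 = m) (hi : m ≠ 0 → i < n) :
    Ht Δ Z S (whl (reg 40) (stepC ;; asg 40 (reg 40 - 1))) σ fun σ' =>
      σ' 42 = (M.stp b i)^[m] (σ 42) ∧ ∀ v, v ≠ 40 → v ≠ 42 → σ' v = σ v := by
  induction m generalizing σ with
  | zero => exact Ht.whl_done E.four_le rfl h40 ⟨rfl, fun _ _ _ => rfl⟩
  | succ m ih =>
    have hi' := hi (by omega)
    refine Ht.whl_step E.four_le rfl (by rw [Ex.eval_reg, h40]; omega)
      (Ht.seq (E.step σ h0 (h41 ▸ hi') hy (h33 ▸ hb) _ (Ht.asg_small E.four_le rfl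
        ((ih ?_ ?_ ?_ ?_ ?_ fun _ => hi').mono fun σ' h => ⟨h.1.trans ?_, fun v h1 h2 => ?_⟩))))
    · simp [upd, h0]
    · simp [upd, h41]
    · simp [upd, h33]
    · simpa [upd, h41] using hy.stp hi'
    · simp [upd, h40]
    · rw [Function.iterate_succ_apply]; simp [upd, h41, h33]
    · rw [h.2 v h1 h2]; simp [upd, h1, h2]

theorem Env.walkCmd_ht (hμ : Radices n T μ k) (hc : Ctx n μ k b σ) {X : ℕ} (hX : σ 38 = X)
    (hd : ∀ t, dgt μ k X t ≠ 0 → t < n) (hXT : X ≤ T) (h42 : σ 42 = y) (hy : M.Reach y) :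
    Ht Δ Z S (walkCmd stepC) σ fun σ' =>
      σ' 42 = walk M.stp b μ k X y ∧ ∀ v < 39, σ' v = σ v := by
  have hZ := E.four_le
  have hT := E.T_le
  have hn := E.n_le
  refine Ht.seq (Ht.asg_small hZ rfl (Ht.seq (Ht.asg_small hZ rfl (Ht.whl hZ rfl
    (fun m σ' => ∃ t, t + m = k + 1 ∧ σ' 41 = t ∧ σ' 42 = walkTo M.stp b μ k X y t ∧
      (t ≤ k → σ' 39 = X / rprod μ t) ∧ ∀ v < 39, σ' v = σ v) (m := k + 1) ?_ ?_ ?_))))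
  · refine ⟨0, by omega, by simp [upd], by simp [upd, h42, walkTo],
      by simp [upd, rprod_zero, hX], fun v hv => ?_⟩
    simp [upd, show v ≠ 41 by omega, show v ≠ 39 by omega]
  · rintro m σ₁ ⟨t, htm, h41, hw, h39, hf⟩ hne
    have hc₁ := hc.of_eq (by norm_num) hf
    simp only [Ex.eval_sub, Ex.eval_add, Ex.eval_reg, Ex.eval_one, hc₁.stage, h41] at hne
    have htk : t ≤ k := by omega
    have hkn := hμ.k_le
    specialize h39 htk
    have hRt := hy.walkTo (b := b) hd t
    refine Ht.seq ((getCmd_ht hZ hμ (by omega) hc₁.dim hc₁.list (by omega)).mono ?_)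
    rintro σ₂ ⟨g43, gf⟩
    have hdiv : X / rprod μ t ≤ T := (Nat.div_le_self _ _).trans hXT
    have key : ∀ σ₃ : ℕ → ℕ, (∀ v < 43, σ₃ v = σ₂ v) →
        σ₃ 43 = (if t < k then μ t else X / rprod μ t + 1) →
        Ht Δ Z S (asg 40 (reg 39 % reg 43) ;; asg 39 (reg 39 / reg 43) ;;
          whl (reg 40) (stepC ;; asg 40 (reg 40 - 1)) ;; asg 41 (reg 41 + 1)) σ₃ fun σ' =>
          ∃ m' < m, ∃ t, t + m' = k + 1 ∧ σ' 41 = t ∧ σ' 42 = walkTo M.stp b μ k X y t ∧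
          (t ≤ k → σ' 39 = X / rprod μ t) ∧ ∀ v < 39, σ' v = σ v := by
      intro σ₃ f₃ e₃
      have f : ∀ v < 43, σ₃ v = σ₁ v := fun v hv => (f₃ v hv).trans (gf v hv)
      have hdig : X / rprod μ t % σ₃ 43 = dgt μ k X t := by
        rw [e₃, dgt]
        split_ifs with h1 h2
        · rfl
        · exact Nat.mod_eq_of_lt (by omega)
        · omega
      have hc₃ := hc₁.of_eq (by norm_num) f
      refine Ht.seq (Ht.asg_small hZ rfl (Ht.seq (Ht.asg_small hZ rfl (Ht.seq
        ((E.stepLoop_ht (b := b) (i := t) (m := dgt μ k X t) ?_ ?_ ?_ hc.sign_le ?_ ?_ (hd t)).mono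
          fun σ₄ h₄ => Ht.asg hZ rfl (fun _ => ?_) ⟨m - 1, by omega, t + 1, by omega, ?_, ?_, ?_, ?_⟩)))))
      · simp [upd, hc₃.dim]
      · simp [upd, f, h41]
      · simp [upd, hc₃.sign]
      · simpa [upd, f, hw] using hRt
      · simp [upd, f, h39, hdig]
      · simp [h₄.2, upd, f, h41]; omega
      · simp [h₄.2, upd, f, h41]
      · rw [walkTo]; simp [h₄.1, upd, f, hw]
      · intro ht
        rw [div_rprod_succ]
        simp [h₄.2, upd, f, h39, e₃, show t < k by omega]
      · intro v hv
        simp [h₄.2, upd, f v (by omega), show v ≠ 39 by omega, show v ≠ 40 by omega,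
          show v ≠ 41 by omega, show v ≠ 42 by omega, hf v hv]
    have e24 : σ₂ 24 = k := (gf 24 (by norm_num)).trans hc₁.stage
    have e41 : σ₂ 41 = t := (gf 41 (by norm_num)).trans h41
    refine Ht.seq (Ht.branch hZ rfl (fun h => Ht.nop (key _ (fun _ _ => rfl) ?_))
      fun h => Ht.asg hZ rfl (fun _ => ?_) (key _ (fun v hv => ?_) ?_))
    · simp [e24, e41] at h
      rw [if_pos (by omega), g43, h41]
    · simp [gf, h39]; omega
    · simp [upd, show v ≠ 43 by omega]
    · simp [e24, e41] at h
      rw [if_neg (by omega)]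
      simp [upd, gf, h39]
  · rintro m σ₁ ⟨t, htm, h41, hw, h39, hf⟩ h0
    have hc₁ := hc.of_eq (by norm_num) hf
    simp only [Ex.eval_sub, Ex.eval_add, Ex.eval_reg, Ex.eval_one, hc₁.stage, h41] at h0
    have : t = k + 1 := by omega
    exact ⟨by rw [hw, this]; rfl, hf⟩

/-- Both loops are searches for an infimum, with the distance to it as variant. No table of states
is kept; every walk is repeated from `y`. -/
theorem Env.collCmd_ht (hμ : Radices n T μ k) (hk : k < n) (hc : Ctx n μ k b σ) (h34 : σ 34 = y)
    (hy : M.Reach y) : Ht Δ Z S (collCmd stepC) σ fun σ' =>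
      σ' 35 = collX M.stp b μ k y ∧
      σ' 36 = leastIdx M.stp b μ k y (collX M.stp b μ k y) ∧ ∀ v < 35, σ' v = σ v := by
  have hZ := E.four_le
  have hT := E.T_le
  have hd : ∀ X t, dgt μ k X t ≠ 0 → t < n := fun X t => Machine.lt_of_dgt_ne_zero hk
  obtain ⟨x, hx⟩ := hy
  have hcoll := M.leastIdx_collX_lt (b := b) (μ := μ) hk hx
  have hcT := M.collX_le (b := b) (μ := μ) hk hx
  have hleast : ∀ X, leastIdx M.stp b μ k y X ≤ X := fun X =>
    Nat.sInf_le (s := {X' | walk M.stp b μ k X' y = walk M.stp b μ k X y}) rfl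
  have h0 : leastIdx M.stp b μ k y 0 = 0 := Nat.le_zero.1 (hleast 0)
  refine Ht.seq (Ht.asg_small hZ rfl (Ht.seq (Ht.asg_small hZ rfl (Ht.whl hZ rfl
    (fun m σ' => ∃ i, i + m = collX M.stp b μ k y ∧ σ' 35 = i ∧
      σ' 36 = leastIdx M.stp b μ k y i ∧ ∀ v < 35, σ' v = σ v)
      (m := collX M.stp b μ k y) ?_ ?_ ?_))))
  · refine ⟨0, by omega, by simp [upd], by simp [upd, h0], fun v hv => ?_⟩
    simp [upd, show v ≠ 36 by omega, show v ≠ 35 by omega]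
  · rintro m σ₁ ⟨i, him, h35, h36, hf⟩ hne
    simp only [Ex.eval_sub, Ex.eval_reg, Ex.eval_one, h35, h36] at hne
    have hi : i ≠ collX M.stp b μ k y := by rintro rfl; omega
    have hc₁ := hc.of_eq (by norm_num) hf
    have f34 : σ₁ 34 = y := (hf 34 (by norm_num)).trans h34
    refine Ht.seq (Ht.asg hZ rfl (fun _ => ?_) (Ht.seq (Ht.asg_small hZ rfl (Ht.seq
      (Ht.asg_small hZ rfl (Ht.seq ((E.walkCmd_ht (X := i + 1) (y := y) hμ
        (((hc₁.upd ?_ _).upd ?_ _).upd ?_ _) ?_ (hd _) (by omega) ?_ ⟨x, hx⟩).mono ?_)))))))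
    any_goals norm_num
    · simp [h35]; omega
    · simp [upd, h35]
    · simp [upd, f34]
    rintro σ₂ w₂ f₂
    have hc₂ := (((hc₁.upd (x := 35) (by norm_num) _).upd (x := 42) (by norm_num) _).upd (x := 38)
      (by norm_num) _).of_eq (by norm_num) f₂
    have e35 : σ₂ 35 = i + 1 := by simp [f₂, upd, h35]
    have e34 : σ₂ 34 = y := by simp [f₂, upd, f34]
    have fr : ∀ v < 35, σ₂ v = σ v := fun v hv => by
      rw [f₂ v (by omega)]
      simp [upd, show v ≠ 35 by omega, show v ≠ 42 by omega, show v ≠ 38 by omega, hf v hv]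
    refine Ht.seq (Ht.asg_small hZ rfl (Ht.seq (Ht.asg_small hZ rfl (Ht.seq (Ht.asg_small hZ rfl
      (Ht.whl hZ rfl (fun m' σ' => ∃ j, j + m' = leastIdx M.stp b μ k y (i + 1) ∧ σ' 36 = j ∧
        σ' 42 = walk M.stp b μ k j y ∧ σ' 37 = walk M.stp b μ k (i + 1) y ∧
        ∀ v < 36, σ' v = σ₂ v) (m := leastIdx M.stp b μ k y (i + 1)) ?_ ?_ ?_))))))
    · refine ⟨0, by omega, by simp [upd], by simp [upd, e34, walk_zero], by simp [upd, w₂],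
        fun v hv => ?_⟩
      simp [upd, show v ≠ 36 by omega, show v ≠ 42 by omega, show v ≠ 37 by omega]
    · rintro m' σ₃ ⟨j, hjm, g36, g42, g37, gf⟩ hne'
      rw [Ex.eval_ne, Ex.eval_reg, Ex.eval_reg, g42, g37] at hne'
      have hj : j ≠ leastIdx M.stp b μ k y (i + 1) := by
        rintro rfl
        exact hne' (Machine.walk_leastIdx _ _ _ _ _ _)
      have hl := hleast (i + 1)
      have hc₃ := hc₂.of_eq (by norm_num) gf
      have g34 : σ₃ 34 = y := (gf 34 (by norm_num)).trans e34
      refine Ht.seq (Ht.asg hZ rfl (fun _ => ?_) (Ht.seq (Ht.asg_small hZ rfl (Ht.seq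
        (Ht.asg_small hZ rfl ((E.walkCmd_ht (X := j + 1) (y := y) hμ
          (((hc₃.upd ?_ _).upd ?_ _).upd ?_ _) ?_ (hd _) (by omega) ?_ ⟨x, hx⟩).mono ?_))))))
      any_goals norm_num
      · simp [g36]; omega
      · simp [upd, g36]
      · simp [upd, g34]
      rintro σ₄ w₄ f₄
      refine ⟨m' - 1, by omega, j + 1, by omega, ?_, w₄, ?_, fun v hv => ?_⟩
      · simp [f₄, upd, g36]
      · simp [f₄, upd, g37]
      · rw [f₄ v (by omega), ← gf v hv]
        simp [upd, show v ≠ 36 by omega, show v ≠ 42 by omega, show v ≠ 38 by omega]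
    · rintro m' σ₃ ⟨j, hjm, g36, g42, g37, gf⟩ heq
      rw [Ex.eval_ne_eq_zero, Ex.eval_reg, Ex.eval_reg, g42, g37] at heq
      have : leastIdx M.stp b μ k y (i + 1) ≤ j :=
        Nat.sInf_le (s := {X' | walk M.stp b μ k X' y = walk M.stp b μ k (i + 1) y}) heq
      refine ⟨m - 1, by omega, i + 1, by omega, (gf 35 (by norm_num)).trans e35, by omega,
        fun v hv => (gf v (by omega)).trans (fr v hv)⟩
  · rintro m σ₁ ⟨i, him, h35, h36, hf⟩ heq
    simp only [Ex.eval_sub, Ex.eval_reg, Ex.eval_one, h35, h36] at heq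
    have : collX M.stp b μ k y ≤ i :=
      Nat.sInf_le (s := {X | leastIdx M.stp b μ k y X < X}) (show leastIdx M.stp b μ k y i < i by omega)
    have e : i = collX M.stp b μ k y := by omega
    exact ⟨by rw [h35, e], by rw [h36, e], hf⟩

theorem Env.nxtCmd_ht (hμ : Radices n T μ k) (hk : k < n) (hc : Ctx n μ k b σ) (h34 : σ 34 = y)
    (hy : M.Reach y) : Ht Δ Z S (nxtCmd stepC) σ fun σ' =>
      σ' 42 = nxt M.stp b μ k y ∧ ∀ v < 35, σ' v = σ v := by
  have hZ := E.four_le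
  have hd : ∀ X t, dgt μ k X t ≠ 0 → t < n := fun X t => Machine.lt_of_dgt_ne_zero hk
  obtain ⟨x, hx⟩ := hy
  have hcT := M.collX_le (b := b) (μ := μ) hk hx
  have hb := hc.sign_le
  refine Ht.seq ((E.collCmd_ht hμ hk hc h34 ⟨x, hx⟩).mono ?_)
  rintro σ₁ ⟨h35, h36, hf⟩
  have hc₁ := hc.of_eq (by norm_num) hf
  have f34 : σ₁ 34 = y := (hf 34 (by norm_num)).trans h34
  refine Ht.seq (Ht.asg_small hZ rfl (Ht.seq (Ht.asg_small hZ rfl (Ht.seq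
    ((E.walkCmd_ht (X := collX M.stp b μ k y) (y := y) hμ ((hc₁.upd ?_ _).upd ?_ _) ?_ (hd _) hcT
      ?_ ⟨x, hx⟩).mono ?_)))))
  any_goals norm_num
  · simp [upd, h35]
  · simp [upd, f34]
  rintro σ₂ w₂ f₂
  have hc₂ := ((hc₁.upd (x := 42) (by norm_num) _).upd (x := 38) (by norm_num) _).of_eq
    (by norm_num) f₂
  refine Ht.seq (Ht.asg_small hZ rfl (Ht.seq ((E.walkCmd_ht (b := 1 - b)
    (X := collX M.stp b μ k y) hμ ⟨?_, ?_, ?_, ?_, by omega⟩ ?_ (hd _) hcT rfl ?_).mono ?_)))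
  · simp [upd, hc₂.dim]
  · simp [upd, hc₂.list]
  · simp [upd, hc₂.stage]
  · simp [upd, hc₂.sign]
  · simp [f₂, upd, h35]
  · simpa [upd, w₂, walk] using Machine.Reach.walkTo ⟨x, hx⟩ (hd _) _
  rintro σ₃ ⟨w₃, f₃⟩
  refine Ht.asg_small hZ rfl ⟨?_, fun v hv => ?_⟩
  · simp [upd, w₃, w₂, nxt]
  · by_cases hv33 : v = 33
    · subst hv33
      simp [upd, f₃, hc₂.sign, hc.sign]; omega
    · simp [upd, hv33, f₃ v (by omega), f₂ v (by omega), hf v hv, show v ≠ 42 by omega,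
        show v ≠ 38 by omega]

theorem Env.floydCmd_ht (hμ : Radices n T μ k) (hk : k < n) (hc : Ctx n μ k 0 σ) {p : ℕ}
    (h23 : σ 23 = p) (hp : M.Reach p) : Ht Δ Z S (floydCmd stepC) σ fun σ' =>
      σ' 31 = (nxt M.stp 0 μ k)^[floydIdx (nxt M.stp 0 μ k) p] p ∧
      ∀ v, v < 31 ∨ v = 33 → σ' v = σ v := by
  have hZ := E.four_le
  set f := nxt M.stp 0 μ k with hf
  have hR : ∀ j, M.Reach (f^[j] p) := by
    intro j
    induction j with
    | zero => exact hp
    | succ j ih => rw [Function.iterate_succ_apply']; exact ih.nxt (by norm_num) hk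
  obtain ⟨hj1, hj2⟩ := floydIdx_spec (f := f) (p := p) (T := T) fun j => (hR j).lt
  have hctx : ∀ {σ' : ℕ → ℕ}, (∀ v, v < 31 ∨ v = 33 → σ' v = σ v) → Ctx n μ k 0 σ' := fun h =>
    ⟨(h _ (by norm_num)).trans hc.dim, (h _ (by norm_num)).trans hc.list,
      (h _ (by norm_num)).trans hc.stage, (h _ (by norm_num)).trans hc.sign, by norm_num⟩
  have step : ∀ {j : ℕ} {x r : ℕ} {q : Cmd} {σ₁ : ℕ → ℕ} {Q : (ℕ → ℕ) → Prop},
      (∀ v, v < 31 ∨ v = 33 → σ₁ v = σ v) → σ₁ x = f^[j] p →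
      ((reg x).ok && decide (34 < 48 ∧ 34 ≠ 3) && (reg x).small) = true →
      (r = 31 ∨ r = 32 ∨ r = 34) →
      (∀ σ₂, σ₂ r = f^[j + 1] p → (∀ v, v < 34 → v ≠ r → σ₂ v = σ₁ v) → Ht Δ Z S q σ₂ Q) →
      Ht Δ Z S (asg 34 (reg x) ;; nxtCmd stepC ;; asg r (reg 42) ;; q) σ₁ Q := by
    intro j x r q σ₁ Q hf₁ hx hok hr h
    refine Ht.seq (Ht.asg_small hZ hok (Ht.seq ((E.nxtCmd_ht hμ hk
      ((hctx hf₁).upd (by norm_num) _) ?_ (hR j)).mono fun σ₂ h₂ => Ht.seq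
        (Ht.asg_small hZ (by rcases hr with rfl | rfl | rfl <;> rfl) (h _ ?_ fun v hv hvr => ?_)))))
    · simp [upd, hx]
    · rw [Function.iterate_succ_apply']; simp [upd, h₂.1, hf]
    · simp [upd, hvr, h₂.2 v (by omega), show v ≠ 34 by omega]
  have hinv : ∀ {σ₁ σ₂ : ℕ → ℕ} {r : ℕ}, (r = 31 ∨ r = 32 ∨ r = 34) →
      (∀ v, v < 31 ∨ v = 33 → σ₁ v = σ v) → (∀ v, v < 34 → v ≠ r → σ₂ v = σ₁ v) →
      ∀ v, v < 31 ∨ v = 33 → σ₂ v = σ v := fun hr h1 h2 v hv =>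
    (h2 v (by omega) (by omega)).trans (h1 v hv)
  refine step (j := 0) (r := 31) (fun _ _ => rfl) h23 rfl (by simp) fun σ₁ e₁ f₁ => ?_
  have i₁ := hinv (r := 31) (by simp) (fun _ _ => rfl) f₁
  refine step (j := 1) (r := 32) i₁ e₁ rfl (by simp) fun σ₂ e₂ f₂ => ?_
  have i₂ := hinv (r := 32) (by simp) i₁ f₂
  refine Ht.whl hZ rfl (fun m σ' => ∃ j, 1 ≤ j ∧ j + m = floydIdx f p ∧ σ' 31 = f^[j] p ∧
    σ' 32 = f^[2 * j] p ∧ ∀ v, v < 31 ∨ v = 33 → σ' v = σ v) (m := floydIdx f p - 1) ?_ ?_ ?_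
  · exact ⟨1, le_rfl, by omega, (f₂ 31 (by norm_num) (by norm_num)).trans e₁, e₂, i₂⟩
  · rintro m σ₃ ⟨j, hj, hjm, g31, g32, gf⟩ hne
    rw [Ex.eval_ne, Ex.eval_reg, Ex.eval_reg, g31, g32] at hne
    have hj' : j ≠ floydIdx f p := by rintro rfl; exact hne hj2
    refine step (j := j) (r := 31) gf g31 rfl (by simp) fun σ₄ e₄ f₄ => ?_
    have i₄ := hinv (r := 31) (by simp) gf f₄
    have e32 : σ₄ 32 = f^[2 * j] p := (f₄ 32 (by norm_num) (by norm_num)).trans g32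
    refine Ht.seq (Ht.asg_small hZ rfl (Ht.seq ((E.nxtCmd_ht hμ hk
      ((hctx i₄).upd (by norm_num) _) ?_ (hR (2 * j))).mono fun σ₅ h₅ => Ht.seq
        (Ht.asg_small hZ rfl (Ht.seq ((E.nxtCmd_ht hμ hk (((((hctx i₄).upd ?_ _).of_eq ?_ h₅.2)).upd
          ?_ _) ?_ (hR (2 * j + 1))).mono fun σ₆ h₆ => Ht.asg_small hZ rfl
          ⟨m - 1, by omega, j + 1, by omega, by omega, ?_, ?_, fun v hv => ?_⟩))))))
    any_goals norm_num
    · simp [upd, e32]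
    · rw [← Function.iterate_succ_apply, Function.iterate_succ_apply']; simp [upd, h₅.1, hf]
    · simp [upd, h₆.2, h₅.2, e₄]
    · rw [show 2 * (j + 1) = 2 * j + 1 + 1 by ring, Function.iterate_succ_apply']
      simp [upd, h₆.1, hf]
    · rw [← i₄ v hv]
      simp [upd, h₆.2 v (by omega), h₅.2 v (by omega), show v ≠ 32 by omega, show v ≠ 34 by omega]
  · rintro m σ₃ ⟨j, hj, hjm, g31, g32, gf⟩ heq
    rw [Ex.eval_ne_eq_zero, Ex.eval_reg, Ex.eval_reg, g31, g32] at heq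
    have : floydIdx f p ≤ j := Nat.sInf_le (s := {j | 1 ≤ j ∧ f^[j] p = f^[2 * j] p}) ⟨hj, heq⟩
    exact ⟨by rw [g31, show j = floydIdx f p by omega], gf⟩

end Programs

theorem enc_mono {n : ℕ} {μ : ℕ → ℕ} {j k : ℕ} (h : j ≤ k) : enc n μ j ≤ enc n μ k := by
  induction h with
  | refl => exact le_rfl
  | @step k _ ih =>
    rw [Nat.succ_eq_add_one, enc]
    split_ifs
    · exact ih
    · refine ih.trans (le_trans ?_ (le_pushBits (by omega) _ _))
      exact Nat.le_add_right_of_le (Nat.le_mul_of_pos_right _ (by omega))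

theorem Machine.Inv.radices {n T : ℕ} {M : Machine n T} {s : MState} (h : M.Inv s) :
    Radices n T s.μ s.k :=
  ⟨h.k_le, h.one_le, h.eq_one, h.rprod_le⟩

/-- Find the highest digit at which the words in registers `25` and `26` differ. -/
def topCmd : Cmd :=
  asg 41 0 ;;
    whl (reg 24 + 1 - reg 41)
      (branch ((reg 25).ne (reg 26)) (asg 27 (reg 41) ;; asg 28 (reg 25 - reg 26)) nop ;;
        getCmd ;; asg 25 (reg 25 / reg 43) ;; asg 26 (reg 26 / reg 43) ;; asg 41 (reg 41 + 1))

/-- Make the list of the radices below the letter in register `27`, and of that in register `28`. -/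
def listCmd : Cmd :=
  asg 29 0 ;; asg 30 0 ;;
    whl (reg 27 - reg 30)
      (asg 41 (reg 30) ;; getCmd ;; asg 31 (reg 43) ;; pushCmd ;; asg 30 (reg 30 + 1)) ;;
    asg 31 (reg 28) ;; pushCmd

/-- A new relation is kept only if its leading letter is the one requested in register 19. The new
list is built in register 29 because the old one is still consulted meanwhile. -/
def mstepCmd (stepC : Cmd) : Cmd :=
  floydCmd stepC ;; asg 23 (reg 31) ;; asg 34 (reg 23) ;; collCmd stepC ;; asg 25 (reg 35) ;;
    asg 26 (reg 36) ;; topCmd ;; branch ((reg 27).ne (reg 19)) nop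
      (asg 21 (reg 35) ;; asg 22 (reg 36)) ;; listCmd ;; asg 20 (reg 29) ;; asg 24 (reg 27 + 1)

/-- In the first loop the empty list encodes radices that are all 1, which turns `nxtCmd` into a
preliminary walk of one letter. Registers below 20 survive, so the construction can be repeated in
the middle of an update. -/
def mainCmd (stepC startC : Cmd) : Cmd :=
  startC ;; asg 20 0 ;; asg 24 0 ;;
    whl (reg 0 - reg 24)
      (asg 34 (reg 42) ;; asg 33 0 ;; nxtCmd stepC ;; asg 34 (reg 42) ;; asg 33 1 ;;
        nxtCmd stepC ;; asg 24 (reg 24 + 1)) ;;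
    asg 33 0 ;; asg 23 (reg 42) ;; asg 24 0 ;; asg 21 0 ;; asg 22 0 ;;
    whl (reg 0 - reg 24) (mstepCmd stepC)

theorem topCmd_ht {Δ : ℤ} {Z S n T k : ℕ} {μ σ : ℕ → ℕ} (hZ : 4 ≤ Z) (hn : n + 2 ≤ Z)
    (hT : T ≤ Z) (hμ : Radices n T μ k) (hk : k < n) (h0 : σ 0 = n) (h20 : σ 20 = enc n μ k)
    (h24 : σ 24 = k) {X X' : ℕ} (h25 : σ 25 = X) (h26 : σ 26 = X') (hlt : X' < X) :
    Ht Δ Z S topCmd σ fun σ' => σ' 27 = topIdx μ k X X' ∧ σ' 28 = topDiff μ k X X' ∧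
      ∀ v, v < 25 ∨ 28 < v ∧ v < 41 → σ' v = σ v := by
  refine Ht.seq (Ht.asg_small hZ rfl (Ht.whl hZ rfl (fun m σ' => ∃ t, t + m = k + 1 ∧ σ' 41 = t ∧
    σ' 25 = X / rprod μ t ∧ σ' 26 = X' / rprod μ t ∧
    (t ≠ 0 → σ' 27 < t ∧ X / rprod μ (σ' 27) ≠ X' / rprod μ (σ' 27) ∧
      (∀ u, σ' 27 < u → u < t → X / rprod μ u = X' / rprod μ u) ∧
      σ' 28 = X / rprod μ (σ' 27) - X' / rprod μ (σ' 27)) ∧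
    ∀ v, v < 25 ∨ 28 < v ∧ v < 41 → σ' v = σ v) (m := k + 1) ?_ ?_ ?_))
  · refine ⟨0, by omega, by simp [upd], by simp [upd, h25, rprod_zero],
      by simp [upd, h26, rprod_zero], fun h => absurd rfl h, fun v hv => ?_⟩
    simp [upd, show v ≠ 41 by omega]
  · rintro m σ₁ ⟨t, htm, g41, g25, g26, g27, gf⟩ hne
    have f24 : σ₁ 24 = k := (gf 24 (by norm_num)).trans h24
    have f20 := (gf 20 (by norm_num)).trans h20
    have f0 := (gf 0 (by norm_num)).trans h0
    simp [f24, g41] at hne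
    have key : ∀ σ₂ : ℕ → ℕ, (∀ v, v ≠ 27 → v ≠ 28 → σ₂ v = σ₁ v) →
        (σ₂ 27 < t + 1 ∧ X / rprod μ (σ₂ 27) ≠ X' / rprod μ (σ₂ 27) ∧
        (∀ u, σ₂ 27 < u → u < t + 1 → X / rprod μ u = X' / rprod μ u) ∧
        σ₂ 28 = X / rprod μ (σ₂ 27) - X' / rprod μ (σ₂ 27)) →
        Ht Δ Z S (getCmd ;; asg 25 (reg 25 / reg 43) ;; asg 26 (reg 26 / reg 43) ;;
          asg 41 (reg 41 + 1)) σ₂ fun σ' => ∃ m' < m, ∃ t, t + m' = k + 1 ∧ σ' 41 = t ∧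
            σ' 25 = X / rprod μ t ∧ σ' 26 = X' / rprod μ t ∧
            (t ≠ 0 → σ' 27 < t ∧ X / rprod μ (σ' 27) ≠ X' / rprod μ (σ' 27) ∧
              (∀ u, σ' 27 < u → u < t → X / rprod μ u = X' / rprod μ u) ∧
              σ' 28 = X / rprod μ (σ' 27) - X' / rprod μ (σ' 27)) ∧
            ∀ v, v < 25 ∨ 28 < v ∧ v < 41 → σ' v = σ v := by
      intro σ₂ f₂ h₂
      have e41 := (f₂ 41 (by norm_num) (by norm_num)).trans g41
      refine Ht.seq ((getCmd_ht hZ hμ hT ((f₂ 0 (by norm_num) (by norm_num)).trans f0)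
        ((f₂ 20 (by norm_num) (by norm_num)).trans f20) (by omega)).mono ?_)
      rintro σ₃ ⟨k43, kf⟩
      rw [e41] at k43
      refine Ht.seq (Ht.asg_small hZ rfl (Ht.seq (Ht.asg_small hZ rfl (Ht.asg hZ rfl (fun _ => ?_)
        ⟨m - 1, by omega, t + 1, by omega, ?_, ?_, ?_, fun _ => ?_, fun v hv => ?_⟩))))
      · simp [upd, kf, e41]; omega
      · simp [upd, kf, e41]
      · simp [upd, kf, k43, f₂, g25, div_rprod_succ]
      · simp [upd, kf, k43, f₂, g26, div_rprod_succ]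
      · simpa [upd, kf] using h₂
      · rw [← gf v hv, ← f₂ v (by omega) (by omega), ← kf v (by omega)]
        simp [upd, show v ≠ 41 by omega, show v ≠ 25 by omega, show v ≠ 26 by omega]
    refine Ht.seq (Ht.branch hZ rfl (fun h => Ht.seq (Ht.asg_small hZ rfl (Ht.asg_small hZ rfl
      (key _ (fun v h1 h2 => ?_) ?_)))) fun h => Ht.nop (key _ (fun _ _ _ => rfl) ?_))
    · simp [upd, h1, h2]
    · rw [Ex.eval_ne, Ex.eval_reg, Ex.eval_reg, g25, g26] at h
      simp only [upd, Ex.eval_reg, Ex.eval_sub, g41, g25, g26, reduceIte, Nat.reduceEqDiff]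
      exact ⟨by omega, h, fun u h1 h2 => by omega, trivial⟩
    · rw [Ex.eval_ne_eq_zero, Ex.eval_reg, Ex.eval_reg, g25, g26] at h
      -- At position 0 the quotients are the two words, which differ; so if they agree here, a
      -- difference has already been recorded.
      have ht : t ≠ 0 := by
        rintro rfl
        simp [rprod_zero] at h
        omega
      obtain ⟨a, b, c, d⟩ := g27 ht
      refine ⟨by omega, b, fun u h1 h2 => ?_, d⟩
      rcases Nat.lt_succ_iff_lt_or_eq.1 h2 with h3 | rfl
      · exact c u h1 h3
      · exact h
  · rintro m σ₁ ⟨t, htm, g41, g25, g26, g27, gf⟩ heq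
    have f24 : σ₁ 24 = k := (gf 24 (by norm_num)).trans h24
    simp [f24, g41] at heq
    obtain ⟨a, b, c, d⟩ := g27 (by omega)
    have e := topIdx_eq (μ := μ) (k := k) (X := X) (X' := X') (t := σ₁ 27) (by omega) b
      fun u h1 h2 => c u h1 (by omega)
    exact ⟨e.symm, by rw [d, topDiff, e], gf⟩

theorem listCmd_ht {Δ : ℤ} {Z S n T k t : ℕ} {μ ν σ : ℕ → ℕ} (hZ : 4 ≤ Z) (hn : n + 2 ≤ Z)
    (hT : T ≤ Z) (hμ : Radices n T μ k) (htk : t ≤ k) (hk : k < n) (h0 : σ 0 = n)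
    (h20 : σ 20 = enc n μ k) (h27 : σ 27 = t) (h28 : σ 28 = ν t) (hν : ∀ j < t, ν j = μ j)
    (h1 : ∀ j, 1 ≤ ν j) (hle : enc n ν (t + 1) ≤ Z) :
    Ht Δ Z S listCmd σ fun σ' => σ' 29 = enc n ν (t + 1) ∧
      ∀ v, v < 29 ∨ 31 < v ∧ v < 41 → σ' v = σ v := by
  refine Ht.seq (Ht.asg_small hZ rfl (Ht.seq (Ht.asg_small hZ rfl (Ht.seq (Ht.whl hZ rfl
    (fun m σ' => ∃ j, j + m = t ∧ σ' 30 = j ∧ σ' 29 = enc n ν j ∧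
      ∀ v, v < 29 ∨ 31 < v ∧ v < 41 → σ' v = σ v) (m := t)
      ?_ ?_ ?_)))))
  · refine ⟨0, by omega, by simp [upd], by simp [upd, enc], fun v hv => ?_⟩
    simp [upd, show v ≠ 29 by omega, show v ≠ 30 by omega]
  · rintro m σ₁ ⟨j, hjm, g30, g29, gf⟩ hne
    simp [gf, h27, g30] at hne
    refine Ht.seq (Ht.asg_small hZ rfl (Ht.seq ((getCmd_ht hZ hμ hT ?_ ?_ ?_).mono
      fun σ₂ k₂ => Ht.seq (Ht.asg_small hZ rfl (Ht.seq ((pushCmd_ht hZ (n := n) (k := j) (μ := ν)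
        ?_ ?_ ?_ (h1 j) ?_ ?_).mono fun σ₃ k₃ => Ht.asg hZ rfl (fun _ => ?_)
        ⟨m - 1, by omega, j + 1, by omega, ?_, ?_, fun v hv => ?_⟩))))))
    · simp [upd, gf, h0]
    · simp [upd, gf, h20]
    · simp [upd, g30]; omega
    · simp [upd, k₂.2, gf, h0]
    · simp [upd, k₂.2, g30]
    · simp [upd, k₂.1, g30, hν j (by omega)]
    · simp [upd, k₂.2, g29]
    · exact (enc_mono (by omega)).trans hle
    · simp [k₃.2, upd, k₂.2, g30]; omega
    · simp [k₃.2, upd, k₂.2, g30]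
    · simp [upd, k₃.1]
    · have := k₂.2 v (by omega)
      simp [upd, k₃.2 v (by omega) (by omega), this, gf v hv, show v ≠ 30 by omega,
        show v ≠ 31 by omega, show v ≠ 41 by omega]
  · rintro m σ₁ ⟨j, hjm, g30, g29, gf⟩ heq
    simp [gf, h27, g30] at heq
    obtain rfl : j = t := by omega
    refine Ht.seq (Ht.asg_small hZ rfl ((pushCmd_ht hZ (n := n) (k := j) (μ := ν)
      ?_ ?_ ?_ (h1 j) ?_ hle).mono fun σ₂ k₂ => ⟨k₂.1, fun v hv => ?_⟩))
    · simp [upd, gf, h0]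
    · simp [upd, g30]
    · simp [upd, gf, h28]
    · simp [upd, g29]
    · simp [upd, k₂.2 v (by omega) (by omega), gf v hv, show v ≠ 31 by omega]

/-- The registers hold the state `s` of the construction, and row `tg`. -/
structure MRep (n : ℕ) (s : MState) (σ : ℕ → ℕ) : Prop where
  dim : σ 0 = n
  list : σ 20 = enc n s.μ s.k
  row : (σ 21, σ 22) = s.rows (σ 19)
  state : σ 23 = s.p
  stage : σ 24 = s.k
  sign : σ 33 = 0

/-! ### Correctness of the construction as a program -/

section Programs

variable {Δ : ℤ} {Z S n T : ℕ} {M : Machine n T} {stepC startC : Cmd}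
  (E : Env Δ Z S M stepC startC) {σ : ℕ → ℕ}
include E

theorem Env.mstepCmd_ht {s : MState} (hs : M.Inv s) (hk : s.k < n) (h : MRep n s σ) :
    Ht Δ Z S (mstepCmd stepC) σ fun σ' =>
      MRep n (M.mstep s) σ' ∧ ∀ v < 20, σ' v = σ v := by
  have hZ := E.four_le
  have hT := E.T_le
  have hn := E.n_le
  have hs' := hs.mstep hk
  have hR : M.Reach s.p := ⟨0, hs.R_p⟩
  have hRc : M.Reach (M.cyc s) := ⟨0, M.R_cyc hk hs.R_p⟩
  refine Ht.seq ((E.floydCmd_ht hs.radices hk ⟨h.dim, h.list, h.stage, h.sign, by norm_num⟩ h.state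
    hR).mono ?_)
  rintro σ₁ ⟨e₁, f₁⟩
  have e₁ : σ₁ 31 = M.cyc s := e₁
  refine Ht.seq (Ht.asg_small hZ rfl (Ht.seq (Ht.asg_small hZ rfl (Ht.seq ((E.collCmd_ht hs.radices
    hk (b := 0) (y := M.cyc s) ⟨?_, ?_, ?_, ?_, by norm_num⟩ ?_ hRc).mono ?_)))))
  · simp [upd, f₁, h.dim]
  · simp [upd, f₁, h.list]
  · simp [upd, f₁, h.stage]
  · simp [upd, f₁, h.sign]
  · simp [upd, e₁]
  rintro σ₂ ⟨e₂, e₂', f₂⟩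
  have hcoll : M.coll s = (σ₂ 35, σ₂ 36) := by rw [e₂, e₂']; rfl
  have hlt := hs.coll_lt hk
  rw [hcoll] at hlt
  have F₂ : ∀ v, v < 31 → v ≠ 23 → σ₂ v = σ v := fun v hv h23 => by
    simp [f₂ v (by omega), upd, h23, f₁ v (by omega), show v ≠ 34 by omega]
  have p₂ : σ₂ 23 = M.cyc s := by simp [f₂, upd, e₁]
  have s₂ : σ₂ 33 = 0 := by simp [f₂, upd, f₁, h.sign]
  refine Ht.seq (Ht.asg_small hZ rfl (Ht.seq (Ht.asg_small hZ rfl (Ht.seq ((topCmd_ht hZ hn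
    (by omega) hs.radices hk ?_ ?_ ?_ ?_ ?_ hlt).mono ?_)))))
  · simp [upd, F₂, h.dim]
  · simp [upd, F₂, h.list]
  · simp [upd, F₂, h.stage]
  · simp [upd]
  · simp [upd]
  rintro σ₃ ⟨e₃, e₃', f₃⟩
  have htk := topIdx_le s.μ s.k (σ₂ 35) (σ₂ 36)
  have hk' : (M.mstep s).k = topIdx s.μ s.k (σ₂ 35) (σ₂ 36) + 1 := by
    simp [Machine.mstep, hcoll]
  have hμ' : ∀ j, (M.mstep s).μ j = if j < topIdx s.μ s.k (σ₂ 35) (σ₂ 36) then s.μ j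
    else if j = topIdx s.μ s.k (σ₂ 35) (σ₂ 36) then topDiff s.μ s.k (σ₂ 35) (σ₂ 36) else 1 := by
    intro j; simp [Machine.mstep, hcoll]
  have hrow' : ∀ j, (M.mstep s).rows j = if j = topIdx s.μ s.k (σ₂ 35) (σ₂ 36) then
      (σ₂ 35, σ₂ 36) else s.rows j := by
    intro j; simp [Machine.mstep, hcoll, Function.update_apply]
  have F₃ : ∀ v, v < 25 ∨ 28 < v ∧ v < 41 → σ₃ v = σ₂ v := fun v hv => by
    simp [f₃ v hv, upd, show v ≠ 25 by omega, show v ≠ 26 by omega]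
  have key : ∀ σ₄ : ℕ → ℕ, (∀ v, v ≠ 21 → v ≠ 22 → σ₄ v = σ₃ v) →
      (σ₄ 21, σ₄ 22) = (M.mstep s).rows (σ 19) →
      Ht Δ Z S (listCmd ;; asg 20 (reg 29) ;; asg 24 (reg 27 + 1)) σ₄ fun σ' =>
        MRep n (M.mstep s) σ' ∧ ∀ v < 20, σ' v = σ v := by
    intro σ₄ f₄ r₄
    have F₄ : ∀ v, v < 20 ∨ v = 20 ∨ v = 24 → σ₄ v = σ v := fun v hv => by
      rw [f₄ v (by omega) (by omega), F₃ v (by omega), F₂ v (by omega) (by omega)]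
    refine Ht.seq ((listCmd_ht (ν := (M.mstep s).μ) hZ hn (by omega) hs.radices htk hk
      ((F₄ _ (by norm_num)).trans h.dim) ((F₄ _ (by norm_num)).trans h.list)
      ((f₄ _ (by norm_num) (by norm_num)).trans e₃)
      (((f₄ _ (by norm_num) (by norm_num)).trans e₃').trans ?_) (fun j hj => ?_)
      hs'.one_le ?_).mono ?_)
    · rw [hμ', if_neg (lt_irrefl _), if_pos rfl]
    · rw [hμ', if_pos hj]
    · rw [← hk']; exact E.enc_le _ _ hs'.radices
    rintro σ₅ ⟨e₅, f₅⟩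
    refine Ht.seq (Ht.asg_small hZ rfl (Ht.asg hZ rfl (fun _ => ?_) ⟨⟨?_, ?_, ?_, ?_, ?_, ?_⟩,
      fun v hv => ?_⟩))
    · simp [upd, f₅, f₄, e₃]; omega
    · simp [upd, f₅, F₄, h.dim]
    · simp [upd, e₅, hk']
    · simpa [upd, f₅, F₄] using r₄
    · simp [upd, f₅, f₄, F₃, p₂]; rfl
    · simp [upd, f₅, f₄, e₃, hk']
    · simp [upd, f₅, f₄, F₃, s₂]
    · simp [upd, f₅ v (by omega), F₄ v (by omega), show v ≠ 20 by omega, show v ≠ 24 by omega]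
  refine Ht.seq (Ht.branch hZ rfl (fun hne => Ht.nop (key _ (fun _ _ _ => rfl) ?_)) fun heq =>
    Ht.seq (Ht.asg_small hZ rfl (Ht.asg_small hZ rfl (key _ (fun v h1 h2 => ?_) ?_))))
  · rw [Ex.eval_ne, Ex.eval_reg, Ex.eval_reg, e₃, F₃ 19 (by norm_num), F₂ 19 (by norm_num)
      (by norm_num)] at hne
    rw [hrow', if_neg hne.symm, ← h.row]
    simp [F₃, F₂]
  · simp [upd, h1, h2]
  · rw [Ex.eval_ne_eq_zero, Ex.eval_reg, Ex.eval_reg, e₃, F₃ 19 (by norm_num), F₂ 19 (by norm_num)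
      (by norm_num)] at heq
    rw [hrow', if_pos heq.symm]
    simp [upd, F₃]

omit E in
theorem Machine.reach_prelim {i : ℕ} (hi : i ≤ n) : M.Reach (M.prelim i) := by
  induction i with
  | zero => exact ⟨0, M.R_zero⟩
  | succ i ih => exact ((ih (by omega)).nxt (by norm_num) hi).nxt (by norm_num) hi

omit E in
theorem Machine.radices_one (M : Machine n T) {k : ℕ} (hk : k ≤ n) : Radices n T (fun _ => 1) k :=
  ⟨hk, fun _ => le_rfl, fun _ _ => rfl, by simpa [rprod] using M.one_le_T⟩

omit E in
theorem enc_one (k : ℕ) : enc n (fun _ => 1) k = 0 := by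
  induction k with
  | zero => rfl
  | succ k ih => rw [enc, if_pos rfl, ih]

theorem Env.mainCmd_ht (h0 : σ 0 = n) : Ht Δ Z S (mainCmd stepC startC) σ fun σ' =>
    MRep n M.fin σ' ∧ ∀ v < 20, σ' v = σ v := by
  have hZ := E.four_le
  have hn := E.n_le
  refine Ht.seq (E.start σ h0 _ fun σ₁ e₁ f₁ => ?_)
  refine Ht.seq (Ht.asg_small hZ rfl (Ht.seq (Ht.asg_small hZ rfl (Ht.seq (Ht.whl hZ rfl
    (fun m σ' => ∃ i, i + m = n ∧ σ' 24 = i ∧ σ' 42 = M.prelim i ∧ σ' 20 = 0 ∧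
      ∀ v < 20, σ' v = σ v) (m := n) ?_ ?_ ?_)))))
  · refine ⟨0, by omega, by simp [upd], by simp [upd, e₁, Machine.prelim], by simp [upd],
      fun v hv => ?_⟩
    simp [upd, f₁ v (by omega), show v ≠ 20 by omega, show v ≠ 24 by omega]
  · rintro m σ₂ ⟨i, him, g24, g42, g20, gf⟩ hne
    simp [gf, h0, g24] at hne
    have hμ := M.radices_one (k := i) (by omega)
    replace hne : i < n := by omega
    have hR := Machine.reach_prelim (M := M) (i := i) (by omega)
    refine Ht.seq (Ht.asg_small hZ rfl (Ht.seq (Ht.asg_small hZ rfl (Ht.seq ((E.nxtCmd_ht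
      (b := 0) (y := M.prelim i) hμ hne ⟨?_, ?_, ?_, ?_, by norm_num⟩ ?_ hR).mono fun σ₃ k₃ =>
      Ht.seq (Ht.asg_small hZ rfl (Ht.seq (Ht.asg_small hZ rfl (Ht.seq ((E.nxtCmd_ht
      (b := 1) hμ hne ⟨?_, ?_, ?_, ?_, by norm_num⟩ ?_ (hR.nxt (b := 0) (μ := fun _ => 1) (by norm_num) hne)).mono fun σ₄ k₄ =>
      Ht.asg hZ rfl (fun _ => ?_) ⟨m - 1, by omega, i + 1, by omega, ?_, ?_, ?_, fun v hv => ?_⟩))))))))))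
    · simp [upd, gf, h0]
    · simp [upd, g20, enc_one]
    · simp [upd, g24]
    · simp [upd]
    · simp [upd, g42]
    · simp [upd, k₃.2, gf, h0]
    · simp [upd, k₃.2, g20, enc_one]
    · simp [upd, k₃.2, g24]
    · simp [upd]
    · simp [upd, k₃.1]
    · simp [upd, k₄.2, k₃.2, g24]; omega
    · simp [upd, k₄.2, k₃.2, g24]
    · simp [upd, k₄.1, Machine.prelim]
    · simp [upd, k₄.2, k₃.2, g20]
    · simp [upd, k₄.2 v (by omega), k₃.2 v (by omega), gf v hv, show v ≠ 24 by omega,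
        show v ≠ 33 by omega, show v ≠ 34 by omega]
  · rintro m σ₂ ⟨i, him, g24, g42, g20, gf⟩ heq
    simp [gf, h0, g24] at heq
    obtain rfl : i = n := by omega
    refine Ht.seq (Ht.asg_small hZ rfl (Ht.seq (Ht.asg_small hZ rfl (Ht.seq (Ht.asg_small hZ rfl
      (Ht.seq (Ht.asg_small hZ rfl (Ht.seq (Ht.asg_small hZ rfl (Ht.whl hZ rfl
      (fun m σ' => ∃ j, j + m = M.msteps ∧ MRep i (M.mstep^[j] M.mstart) σ' ∧
        ∀ v < 20, σ' v = σ v) (m := M.msteps) ?_ ?_ ?_))))))))))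
    · refine ⟨0, by omega, ⟨?_, ?_, ?_, ?_, ?_, ?_⟩, fun v hv => ?_⟩
      · simp [upd, gf, h0]
      · simp [upd, g20]; rfl
      · simp [upd, Machine.mstart]
      · simp [upd, g42, Machine.mstart]
      · simp [upd, Machine.mstart]
      · simp [upd]
      · simp [upd, gf v hv, show v ≠ 22 by omega, show v ≠ 21 by omega, show v ≠ 24 by omega,
          show v ≠ 23 by omega, show v ≠ 33 by omega]
    · rintro m σ₃ ⟨j, hjm, hrep, kf⟩ hne
      have hj : j ≤ M.msteps := by omega
      simp [hrep.dim, hrep.stage] at hne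
      have hj' : j ≠ M.msteps := by
        rintro rfl
        exact hne (by have := M.fin_k; unfold Machine.fin at this; omega)
      refine (E.mstepCmd_ht (M.inv_iterate hj) (by omega) hrep).mono fun σ₄ k₄ =>
        ⟨m - 1, by omega, j + 1, by omega, ?_, fun v hv => (k₄.2 v hv).trans (kf v hv)⟩
      rw [Function.iterate_succ_apply']
      exact k₄.1
    · rintro m σ₃ ⟨j, hjm, hrep, kf⟩ heq
      simp [hrep.dim, hrep.stage] at heq
      have hj : j = M.msteps := by
        by_contra hj
        have := M.iterate_k_lt (j := j) (by omega)
        omega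
      exact ⟨by rw [hj] at hrep; exact hrep, kf⟩

end Programs

/-! ## Loops over all digits -/

/-- For each letter `j`, in register `41`, with its radix in register `43`, run `body`, which leaves
a digit in register `14` and its radix in register `15`.  The number with these digits is computed
in register `13`, and the product of their radices in register `12`. -/
def mapCmd (body : Cmd) : Cmd :=
  asg 41 0 ;; asg 12 1 ;; asg 13 0 ;;
    whl (reg 0 - reg 41)
      (getCmd ;; body ;; asg 13 (reg 13 + reg 14 * reg 12) ;; asg 12 (reg 12 * reg 15) ;;
        asg 41 (reg 41 + 1))

/-- Registers and radices that fit into memory. -/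
structure Fits (Z n T : ℕ) (μ : ℕ → ℕ) : Prop where
  four_le : 4 ≤ Z
  n_le : n + 2 ≤ Z
  T_le : T ^ 3 ≤ Z
  radices : Radices n T μ n

/-- The radices for digits that are not reduced. -/
def cube (μ : ℕ → ℕ) (j : ℕ) : ℕ := μ j * μ j * μ j

theorem rprod_cube (μ : ℕ → ℕ) (t : ℕ) : rprod (cube μ) t = rprod μ t ^ 3 := by
  simp only [rprod, cube, ← Finset.prod_pow]
  exact Finset.prod_congr rfl fun _ _ => by ring

section Maps

variable {Δ : ℤ} {Z S n T : ℕ} {μ σ : ℕ → ℕ}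

theorem Fits.T_le' (h : Fits Z n T μ) : T ≤ Z :=
  (Nat.le_self_pow (by norm_num) T).trans h.T_le

theorem Fits.rprod_cube_le (h : Fits Z n T μ) : rprod (cube μ) n ≤ Z := by
  rw [rprod_cube]
  exact (Nat.pow_le_pow_left h.radices.rprod_le 3).trans h.T_le

theorem Fits.one_le_cube (h : Fits Z n T μ) (j : ℕ) : 1 ≤ cube μ j :=
  Nat.mul_pos (Nat.mul_pos (h.radices.one_le j) (h.radices.one_le j)) (h.radices.one_le j)

theorem Fits.cube_le (h : Fits Z n T μ) (j : ℕ) : μ j * μ j * μ j ≤ Z := by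
  refine le_trans ?_ h.T_le
  calc μ j * μ j * μ j = μ j ^ 3 := by ring
    _ ≤ _ := Nat.pow_le_pow_left (h.radices.le j) 3

/-- Unreduced digits range over three times the usual interval. Cubed radices leave enough room for
them, cost nothing for letters of radix 1, and have a product of at most `T ^ 3`. -/
theorem lt_cube {m a : ℕ} (hm : 1 ≤ m) (h : a ≤ 3 * (m - 1)) : a < m * m * m := by
  obtain ⟨m, rfl⟩ := Nat.exists_eq_add_of_le' hm
  rw [Nat.add_sub_cancel] at h
  nlinarith [Nat.zero_le (m * m * m), Nat.zero_le (m * m)]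

/-- The invariant `I` belongs to the body. It must ignore registers 12 and 13 and those from 41 on,
which the surrounding loop and the lookup change. -/
theorem mapCmd_ht (hZ : Fits Z n T μ) {body : Cmd} (I : ℕ → (ℕ → ℕ) → Prop)
    (hI : ∀ j σ σ', (∀ v < 41, v ≠ 12 → v ≠ 13 → σ' v = σ v) → I j σ → I j σ')
    (hctx : ∀ j σ, I j σ → σ 0 = n ∧ σ 20 = enc n μ n) {d ρ : ℕ → ℕ} (hd : ∀ j < n, d j < ρ j)
    (hρ1 : ∀ j, 1 ≤ ρ j) (hρ : rprod ρ n ≤ Z) (hI0 : I 0 σ)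
    (hbody : ∀ j < n, ∀ σ, I j σ → σ 41 = j → σ 43 = μ j → Ht Δ Z S body σ fun σ' =>
      I (j + 1) σ' ∧ σ' 14 = d j ∧ σ' 15 = ρ j ∧ σ' 12 = σ 12 ∧ σ' 13 = σ 13 ∧ σ' 41 = σ 41) :
    Ht Δ Z S (mapCmd body) σ fun σ' =>
      I n σ' ∧ σ' 13 = dsum ρ d n ∧ σ' 12 = rprod ρ n := by
  have hn := hZ.n_le
  have hT := hZ.T_le'
  refine Ht.seq (Ht.asg_small hZ.four_le rfl (Ht.seq (Ht.asg_small hZ.four_le rfl (Ht.seq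
    (Ht.asg_small hZ.four_le rfl (Ht.whl hZ.four_le rfl (fun m σ' => ∃ j, j + m = n ∧ I j σ' ∧
      σ' 41 = j ∧ σ' 13 = dsum ρ d j ∧ σ' 12 = rprod ρ j) (m := n) ?_ ?_ ?_))))))
  · refine ⟨0, by omega, hI _ _ _ (fun v hv h1 h2 => ?_) hI0, ?_, ?_, ?_⟩
    · simp [upd, h1, h2, hv.ne]
    · simp [upd]
    · simp [upd, dsum]
    · simp [upd, rprod]
  · rintro m σ₁ ⟨j, hjm, hj, h41, h13, h12⟩ hne
    obtain ⟨h0, h20⟩ := hctx _ _ hj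
    simp [h0, h41] at hne
    have hjn : j < n := by omega
    refine Ht.seq ((getCmd_ht hZ.four_le hZ.radices hT h0 h20 (by omega)).mono ?_)
    rintro σ₂ ⟨g43, gf⟩
    rw [h41] at g43
    refine Ht.seq ((hbody j hjn σ₂ (hI _ _ _ (fun v hv _ _ => gf v (by omega)) hj)
      ((gf _ (by norm_num)).trans h41) g43).mono ?_)
    rintro σ₃ ⟨i₃, e14, e15, e12, e13, e41⟩
    rw [gf _ (by norm_num)] at e12 e13 e41
    have hle := rprod_mono hρ1 (show j + 1 ≤ n by omega)
    have hlt := dsum_lt fun i (hi : i < j + 1) => hd i (by omega)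
    have es := dsum_succ ρ d j
    have er := rprod_succ ρ j
    refine Ht.seq (Ht.asg hZ.four_le rfl (fun _ => ?_) (Ht.seq (Ht.asg hZ.four_le rfl (fun _ => ?_)
      (Ht.asg hZ.four_le rfl (fun _ => ?_) ⟨m - 1, by omega, j + 1, by omega,
        hI _ _ _ (fun v hv h1 h2 => ?_) i₃, ?_, ?_, ?_⟩))))
    · simp [e12, e13, e14, h13, h12]; omega
    · simp [upd, e12, e15, h12]; omega
    · simp [upd, e41, h41]; omega
    · simp [upd, h1, h2, hv.ne]
    · simp [upd, e41, h41]
    · simp [upd, e12, e13, e14, h13, h12, es]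
    · simp [upd, e12, e15, h12, er]
  · rintro m σ₁ ⟨j, hjm, hj, h41, h13, h12⟩ heq
    obtain ⟨h0, h20⟩ := hctx _ _ hj
    simp [h0, h41] at heq
    obtain rfl : j = n := by omega
    exact ⟨hj, h13, h12⟩

/-- Registers with the data on which all loops depend. -/
structure ListCtx (n : ℕ) (μ σ : ℕ → ℕ) : Prop where
  dim : σ 0 = n
  list : σ 20 = enc n μ n

def prodCmd : Cmd := mapCmd (asg 14 0 ;; asg 15 (reg 43))

theorem prodCmd_ht (hZ : Fits Z n T μ) (hc : ListCtx n μ σ) :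
    Ht Δ Z S prodCmd σ fun σ' => σ' 12 = rprod μ n ∧ ∀ v < 41, v < 11 ∨ 17 < v → σ' v = σ v := by
  have h4 := hZ.four_le
  refine (mapCmd_ht hZ (fun _ σ' => ∀ v < 41, v < 11 ∨ 17 < v → σ' v = σ v) (d := fun _ => 0) (ρ := μ)
    (fun _ σ₁ σ₂ h h' v hv hv' => (h v hv (by omega) (by omega)).trans (h' v hv hv'))
    (fun _ σ' h => ⟨(h 0 (by norm_num) (by norm_num)).trans hc.dim,
      (h 20 (by norm_num) (by norm_num)).trans hc.list⟩)
    (fun j _ => hZ.radices.one_le j) hZ.radices.one_le (hZ.radices.rprod_le.trans hZ.T_le')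
    (fun _ _ _ => rfl) ?_).mono fun σ' h => ⟨h.2.2, h.1⟩
  intro j hj σ₁ i₁ e41 e43
  refine Ht.seq (Ht.asg_small h4 rfl (Ht.asg_small h4 rfl ⟨fun v hv hv' => ?_, ?_⟩))
  · rw [← i₁ v hv hv']
    simp [upd, show v ≠ 14 by omega, show v ≠ 15 by omega]
  · simp [upd, e43]

/-- Spread the digits of the number in register `1`. -/
def encodeCmd : Cmd :=
  asg 11 (reg 1) ;;
    mapCmd (asg 14 (reg 11 % reg 43 + (reg 43 - 1)) ;; asg 11 (reg 11 / reg 43) ;;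
      asg 15 (reg 43 * reg 43 * reg 43)) ;; asg 5 (reg 13)

theorem encodeCmd_ht (hZ : Fits Z n T μ) (hc : ListCtx n μ σ) :
    Ht Δ Z S encodeCmd σ fun σ' => σ' 5 = dsum (cube μ) (fun j => dig μ (σ 1) j + (μ j - 1)) n ∧
      ∀ v < 41, v < 11 ∧ v ≠ 5 ∨ 17 < v → σ' v = σ v := by
  have h4 := hZ.four_le
  refine Ht.seq (Ht.asg_small h4 rfl (Ht.seq ((mapCmd_ht hZ (fun j σ' => σ' 11 = σ 1 / rprod μ j ∧
      ∀ v < 41, v < 11 ∨ 17 < v → σ' v = σ v)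
    (d := fun j => dig μ (σ 1) j + (μ j - 1)) (ρ := cube μ)
    (fun _ σ₁ σ₂ h h' => ⟨(h _ (by norm_num) (by norm_num) (by norm_num)).trans h'.1,
      fun v hv hv' => (h v hv (by omega) (by omega)).trans (h'.2 v hv hv')⟩)
    (fun _ σ' h => ⟨(h.2 0 (by norm_num) (by norm_num)).trans hc.dim,
      (h.2 20 (by norm_num) (by norm_num)).trans hc.list⟩)
    (fun j _ => ?_) hZ.one_le_cube hZ.rprod_cube_le
    ⟨?_, fun v hv hv' => ?_⟩ ?_).mono ?_)))
  · have h1 := hZ.radices.one_le j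
    have : dig μ (σ 1) j < μ j := Nat.mod_lt _ h1
    exact lt_cube h1 (by omega)
  · simp [upd, rprod_zero]
  · simp [upd, show v ≠ 11 by omega]
  · rintro j hj σ₁ ⟨e11, i₁⟩ e41 e43
    have h1 := hZ.radices.one_le j
    have hdig : dig μ (σ 1) j < μ j := Nat.mod_lt _ h1
    have hlt := lt_cube (a := dig μ (σ 1) j + (μ j - 1)) h1 (by omega)
    have hle := hZ.cube_le j
    refine Ht.seq (Ht.asg h4 rfl (fun _ => ?_) (Ht.seq (Ht.asg_small h4 rfl (Ht.asg h4 rfl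
      (fun _ => ?_) ⟨⟨?_, fun v hv hv' => ?_⟩, ?_, ?_, ?_⟩))))
    · simp [e11, e43]
      exact hlt.le.trans hle
    · simp [upd, e43, hle]
    · simp [upd, e11, e43, div_rprod_succ]
    · rw [← i₁ v hv hv']
      simp [upd, show v ≠ 14 by omega, show v ≠ 15 by omega, show v ≠ 11 by omega]
    · simp [upd, e11, e43]; rfl
    · simp [upd, e43, cube]
    · simp [upd]
  · rintro σ₁ ⟨⟨-, i₁⟩, e13, -⟩
    refine Ht.asg_small h4 rfl ⟨?_, fun v hv hv' => ?_⟩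
    · simp [upd, e13]
    · rw [← i₁ v hv (by omega)]
      simp [upd, show v ≠ 5 by omega]

/-- Recover a number from its spread digits. -/
def decodeCmd : Cmd :=
  asg 11 (reg 5) ;;
    mapCmd (asg 17 (reg 43 * reg 43 * reg 43) ;; asg 14 (reg 11 % reg 17 - (reg 43 - 1)) ;;
      asg 11 (reg 11 / reg 17) ;; asg 15 (reg 43)) ;; asg 1 (reg 13)

theorem decodeCmd_ht (hZ : Fits Z n T μ) (hc : ListCtx n μ σ) {u : ℕ → ℕ}
    (h5 : σ 5 = dsum (cube μ) u n) (hu : ∀ j < n, u j ≤ 2 * (μ j - 1)) :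
    Ht Δ Z S decodeCmd σ fun σ' => σ' 1 = dsum μ (fun j => u j - (μ j - 1)) n := by
  have h4 := hZ.four_le
  refine Ht.seq (Ht.asg_small h4 rfl (Ht.seq ((mapCmd_ht hZ (fun j σ' =>
      σ' 11 = σ 5 / rprod (cube μ) j ∧ ∀ v < 41, v < 11 ∨ 17 < v → σ' v = σ v)
    (d := fun j => u j - (μ j - 1)) (ρ := μ)
    (fun _ σ₁ σ₂ h h' => ⟨(h _ (by norm_num) (by norm_num) (by norm_num)).trans h'.1,
      fun v hv hv' => (h v hv (by omega) (by omega)).trans (h'.2 v hv hv')⟩)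
    (fun _ σ' h => ⟨(h.2 0 (by norm_num) (by norm_num)).trans hc.dim,
      (h.2 20 (by norm_num) (by norm_num)).trans hc.list⟩)
    (fun j hj => ?_) hZ.radices.one_le (hZ.radices.rprod_le.trans hZ.T_le')
    ⟨?_, fun v hv hv' => ?_⟩ ?_).mono ?_)))
  · have h1 := hZ.radices.one_le j
    have := hu j hj
    omega
  · simp [upd, rprod_zero]
  · simp [upd, show v ≠ 11 by omega]
  · rintro j hj σ₁ ⟨e11, i₁⟩ e41 e43
    have hdig : σ 5 / rprod (cube μ) j % (μ j * μ j * μ j) = u j := by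
      rw [h5]
      exact dig_dsum (fun i hi => lt_cube (hZ.radices.one_le i) (by have := hu i hi; omega)) hj
    refine Ht.seq (Ht.asg h4 rfl (fun _ => ?_) (Ht.seq (Ht.asg_small h4 rfl (Ht.seq
      (Ht.asg_small h4 rfl (Ht.asg_small h4 rfl ⟨⟨?_, fun v hv hv' => ?_⟩, ?_, ?_, ?_⟩))))))
    · simp [e43, hZ.cube_le j]
    · simp [upd, e11, e43, div_rprod_succ, cube]
    · rw [← i₁ v hv hv']
      simp [upd, show v ≠ 14 by omega, show v ≠ 15 by omega, show v ≠ 11 by omega,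
        show v ≠ 17 by omega]
    · simp [upd, e11, e43, hdig]
    · simp [upd, e43]
    · simp [upd]
  · rintro σ₁ ⟨-, e13, -⟩
    exact Ht.asg_small h4 rfl (by simp [upd, e13])

/-- Find the lowest letter whose digit is not reduced, and the digit of letter `i`. -/
def scanCmd : Cmd :=
  -- The value `n` in register 8 means that no digit in need of reduction has been found.
  asg 8 (reg 0) ;; asg 11 (reg 5) ;;
    mapCmd (asg 17 (reg 43 * reg 43 * reg 43) ;; asg 16 (reg 11 % reg 17) ;;
      asg 11 (reg 11 / reg 17) ;; asg 14 0 ;; asg 15 1 ;;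
      branch ((reg 41).ne (reg 2)) nop (asg 10 (reg 16)) ;;
      branch (reg 0 - reg 8) nop
        (branch ((reg 43 - 1 - reg 16) + (reg 16 - 2 * (reg 43 - 1)))
          (asg 8 (reg 41) ;; asg 9 (reg 16)) nop))

/-- A digit that is not reduced. -/
def Bad (μ u : ℕ → ℕ) (j : ℕ) : Prop := u j < μ j - 1 ∨ 2 * (μ j - 1) < u j

theorem scanCmd_ht (hZ : Fits Z n T μ) (hc : ListCtx n μ σ) {u : ℕ → ℕ}
    (h5 : σ 5 = dsum (cube μ) u n) (hu : ∀ j < n, u j ≤ 3 * (μ j - 1)) (h2 : σ 2 < n) :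
    Ht Δ Z S scanCmd σ fun σ' => σ' 10 = u (σ 2) ∧ (∀ j < n, j < σ' 8 → ¬ Bad μ u j) ∧
      (σ' 8 = n ∨ σ' 8 < n ∧ Bad μ u (σ' 8) ∧ σ' 9 = u (σ' 8)) ∧
      ∀ v < 41, v < 8 ∨ 17 < v → σ' v = σ v := by
  have h4 := hZ.four_le
  refine Ht.seq (Ht.asg_small h4 rfl (Ht.seq (Ht.asg_small h4 rfl ((mapCmd_ht hZ (fun j σ' =>
      σ' 11 = σ 5 / rprod (cube μ) j ∧ (∀ v < 41, v < 8 ∨ 17 < v → σ' v = σ v) ∧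
      (σ 2 < j → σ' 10 = u (σ 2)) ∧ (∀ i < j, i < σ' 8 → ¬ Bad μ u i) ∧
      (σ' 8 = n ∨ σ' 8 < j ∧ Bad μ u (σ' 8) ∧ σ' 9 = u (σ' 8)))
    -- Only the side effects of the body matter here, so it emits the trivial digit 0 with radix 1.
    (d := fun j => 0) (ρ := fun _ => 1)
    (fun _ σ₁ σ₂ h h' => ?_)
    (fun _ σ' h => ⟨(h.2.1 0 (by norm_num) (by norm_num)).trans hc.dim,
      (h.2.1 20 (by norm_num) (by norm_num)).trans hc.list⟩)
    (fun j hj => one_pos) (fun _ => le_rfl) (by simp [rprod]; omega)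
    ⟨?_, fun v hv hv' => ?_, fun h => ?_, fun i hi => ?_, ?_⟩ ?_).mono ?_))))
  · rw [h 11 (by norm_num) (by norm_num) (by norm_num), h 10 (by norm_num) (by norm_num)
      (by norm_num), h 8 (by norm_num) (by norm_num) (by norm_num), h 9 (by norm_num)
      (by norm_num) (by norm_num)]
    exact ⟨h'.1, fun v hv hv' => (h v hv (by omega) (by omega)).trans (h'.2.1 v hv hv'), h'.2.2⟩
  · simp [upd, rprod_zero]
  · simp [upd, show v ≠ 11 by omega, show v ≠ 8 by omega]
  · omega
  · omega
  · simp [upd, hc.dim]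
  · rintro j hj σ₁ ⟨e11, i₁, e10, e8, e8'⟩ e41 e43
    have hdig : σ 5 / rprod (cube μ) j % (μ j * μ j * μ j) = u j := by
      rw [h5]
      exact dig_dsum (fun i hi => lt_cube (hZ.radices.one_le i) (by have := hu i hi; omega)) hj
    refine Ht.seq (Ht.asg h4 rfl (fun _ => ?_) (Ht.seq (Ht.asg_small h4 rfl (Ht.seq
      (Ht.asg_small h4 rfl (Ht.seq (Ht.asg_small h4 rfl (Ht.seq (Ht.asg_small h4 rfl
      (Ht.seq (Ht.mono (Q := fun σ' => σ' 10 = (if j = σ 2 then u (σ 2) else σ₁ 10) ∧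
        σ' 11 = σ 5 / rprod (cube μ) (j + 1) ∧ σ' 16 = u j ∧ σ' 14 = 0 ∧ σ' 15 = 1 ∧
        ∀ v < 44, v < 10 ∨ 17 < v ∨ v = 12 ∨ v = 13 → σ' v = σ₁ v) ?_ ?_)))))))))))
    · simp [e43, hZ.cube_le j]
    · have f2 := i₁ 2 (by norm_num) (by norm_num)
      refine Ht.branch h4 rfl (fun hne => Ht.nop ?_) (fun heq => Ht.asg_small h4 rfl ?_)
      · rw [Ex.eval_ne] at hne
        simp [upd, e41, f2] at hne
        refine ⟨by simp [upd, hne], ?_, ?_, ?_, ?_, fun v hv hv' => ?_⟩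
        · simp [upd, e11, e43, div_rprod_succ, cube]
        · simp [upd, e11, e43, hdig]
        · simp [upd]
        · simp [upd]
        · simp [upd, show v ≠ 15 by omega, show v ≠ 14 by omega, show v ≠ 11 by omega,
            show v ≠ 16 by omega, show v ≠ 17 by omega]
      · rw [Ex.eval_ne_eq_zero] at heq
        simp [upd, e41, f2] at heq
        refine ⟨?_, ?_, ?_, ?_, ?_, fun v hv hv' => ?_⟩
        · rw [if_pos heq, ← heq]
          simp [upd, e11, e43, hdig]
        · simp [upd, e11, e43, div_rprod_succ, cube]
        · simp [upd, e11, e43, hdig]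
        · simp [upd]
        · simp [upd]
        · simp [upd, show v ≠ 15 by omega, show v ≠ 14 by omega, show v ≠ 11 by omega,
            show v ≠ 16 by omega, show v ≠ 17 by omega, show v ≠ 10 by omega]
    · rintro σ₂ ⟨g10, g11, g16, g14, g15, gf⟩
      have f0 : σ₂ 0 = n := by
        rw [gf 0 (by norm_num) (by norm_num), i₁ 0 (by norm_num) (by norm_num), hc.dim]
      have f8 := gf 8 (by norm_num) (by norm_num)
      have f9 := gf 9 (by norm_num) (by norm_num)
      have f10 : σ 2 < j + 1 → σ₂ 10 = u (σ 2) := fun h => by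
        rw [g10]
        split_ifs with h'
        · rfl
        · exact e10 (by omega)
      refine Ht.branch h4 rfl (fun hne => Ht.nop ⟨⟨g11, fun v hv hv' => ?_, f10, ?_, ?_⟩, g14, g15,
        gf 12 (by norm_num) (by norm_num), gf 13 (by norm_num) (by norm_num),
        gf 41 (by norm_num) (by norm_num)⟩) fun heq => Ht.branch h4 rfl (fun hne => Ht.seq
        (Ht.asg_small h4 rfl (Ht.asg_small h4 rfl ⟨⟨?_, fun v hv hv' => ?_, fun h => ?_, ?_, ?_⟩,
          ?_, ?_, ?_, ?_, ?_⟩))) fun heq' => Ht.nop ⟨⟨g11, fun v hv hv' => ?_, f10, ?_, ?_⟩, g14,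
        g15, gf 12 (by norm_num) (by norm_num), gf 13 (by norm_num) (by norm_num),
        gf 41 (by norm_num) (by norm_num)⟩
      · rw [gf v (by omega) (by omega), i₁ v hv hv']
      · simp [f0, f8] at hne
        rw [f8]
        intro i hi hi'
        exact e8 i (by omega) hi'
      · simp [f0, f8] at hne
        rw [f8, f9]
        rcases e8' with h | h
        · omega
        · exact Or.inr ⟨by omega, h.2⟩
      · simp [upd, g11]
      · rw [← i₁ v hv hv', ← gf v (by omega) (by omega)]
        simp [upd, show v ≠ 8 by omega, show v ≠ 9 by omega]
      · simp [upd, f10 h]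
      · simp [f0, f8] at heq
        have f41 := gf 41 (by norm_num) (by norm_num)
        simp only [upd, Ex.eval_reg, f41, e41, reduceIte, Nat.reduceEqDiff]
        intro i _ hi
        exact e8 i hi (by omega)
      · have f41 := gf 41 (by norm_num) (by norm_num)
        have f43 := gf 43 (by norm_num) (by norm_num)
        simp [g16, f43, e43] at hne
        simp only [upd, Ex.eval_reg, f41, e41, reduceIte, Nat.reduceEqDiff, g16]
        refine Or.inr ⟨by omega, ?_, trivial⟩
        unfold Bad; omega
      · simp [upd, g14]
      · simp [upd, g15]
      · simp [upd, gf]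
      · simp [upd, gf]
      · simp [upd, gf]
      · rw [gf v (by omega) (by omega), i₁ v hv hv']
      · have f43 := gf 43 (by norm_num) (by norm_num)
        simp [f0, f8] at heq
        simp [g16, f43, e43] at heq'
        intro i hi hi'
        rcases Nat.lt_succ_iff_lt_or_eq.1 hi with h | rfl
        · exact e8 i h (by omega)
        · unfold Bad; omega
      · simp [f0, f8] at heq
        rcases e8' with h | h
        · exact Or.inl (f8.trans h)
        · omega
  · rintro σ₁ ⟨⟨-, i₁, e10, e8, e8'⟩, -⟩
    exact ⟨e10 h2, e8, e8', i₁⟩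

/-- Subtract from the digits below letter `l`, in register `19`, those of the number in register
`21`, add those of the number in register `22`, and replace digit `l`. -/
def rowCmd : Cmd :=
  asg 11 (reg 5) ;;
    mapCmd (asg 17 (reg 43 * reg 43 * reg 43) ;; asg 16 (reg 11 % reg 17) ;;
      asg 11 (reg 11 / reg 17) ;; asg 15 (reg 17) ;;
      branch (reg 19 - reg 41)
        (asg 14 (reg 16 + reg 22 % reg 43 - reg 21 % reg 43) ;; asg 21 (reg 21 / reg 43) ;;
          asg 22 (reg 22 / reg 43))
        (branch (reg 41 - reg 19) (asg 14 (reg 16)) (asg 14 (reg 18)))) ;; asg 5 (reg 13)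

/-- The digits after the subtraction of a relation. -/
def rowDigits (μ u : ℕ → ℕ) (l a b w : ℕ) (j : ℕ) : ℕ :=
  if j < l then u j + b / rprod μ j % μ j - a / rprod μ j % μ j else if j = l then w else u j

theorem rowCmd_ht (hZ : Fits Z n T μ) (hc : ListCtx n μ σ) {u : ℕ → ℕ}
    (h5 : σ 5 = dsum (cube μ) u n) (hu : ∀ j < n, u j ≤ 3 * (μ j - 1))
    (hu' : ∀ j < n, rowDigits μ u (σ 19) (σ 21) (σ 22) (σ 18) j ≤ 3 * (μ j - 1)) :
    Ht Δ Z S rowCmd σ fun σ' =>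
      σ' 5 = dsum (cube μ) (rowDigits μ u (σ 19) (σ 21) (σ 22) (σ 18)) n ∧
      ∀ v < 21, v < 11 ∧ v ≠ 5 ∨ 17 < v → σ' v = σ v := by
  have h4 := hZ.four_le
  refine Ht.seq (Ht.asg_small h4 rfl (Ht.seq ((mapCmd_ht hZ (fun j σ' =>
      σ' 11 = σ 5 / rprod (cube μ) j ∧ (∀ v < 21, v < 11 ∨ 17 < v → σ' v = σ v) ∧
      (j ≤ σ 19 → σ' 21 = σ 21 / rprod μ j ∧ σ' 22 = σ 22 / rprod μ j))
    (d := rowDigits μ u (σ 19) (σ 21) (σ 22) (σ 18)) (ρ := cube μ)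
    (fun _ σ₁ σ₂ h h' => ?_)
    (fun _ σ' h => ⟨(h.2.1 0 (by norm_num) (by norm_num)).trans hc.dim,
      (h.2.1 20 (by norm_num) (by norm_num)).trans hc.list⟩)
    (fun j hj => lt_cube (hZ.radices.one_le j) (hu' j hj)) hZ.one_le_cube hZ.rprod_cube_le
    ⟨?_, fun v hv hv' => ?_, fun _ => ?_⟩ ?_).mono ?_)))
  · rw [h 11 (by norm_num) (by norm_num) (by norm_num), h 21 (by norm_num) (by norm_num)
      (by norm_num), h 22 (by norm_num) (by norm_num) (by norm_num)]
    exact ⟨h'.1, fun v hv hv' => (h v (by omega) (by omega) (by omega)).trans (h'.2.1 v hv hv'),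
      h'.2.2⟩
  · simp [upd, rprod_zero]
  · simp [upd, show v ≠ 11 by omega]
  · simp [upd, rprod_zero]
  · rintro j hj σ₁ ⟨e11, i₁, e21⟩ e41 e43
    have hdig : σ 5 / rprod (cube μ) j % (μ j * μ j * μ j) = u j := by
      rw [h5]
      exact dig_dsum (fun i hi => lt_cube (hZ.radices.one_le i) (by have := hu i hi; omega)) hj
    have f18 := i₁ 18 (by norm_num) (by norm_num)
    have f19 := i₁ 19 (by norm_num) (by norm_num)
    have h1 := hZ.radices.one_le j
    have hlt := (lt_cube h1 (hu' j hj)).le.trans (hZ.cube_le j)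
    refine Ht.seq (Ht.asg h4 rfl (fun _ => ?_) (Ht.seq (Ht.asg_small h4 rfl (Ht.seq
      (Ht.asg_small h4 rfl (Ht.seq (Ht.asg_small h4 rfl (Ht.branch h4 rfl (fun hne =>
        Ht.seq (Ht.asg h4 rfl (fun _ => ?_) (Ht.seq (Ht.asg_small h4 rfl (Ht.asg_small h4 rfl
          ⟨⟨?_, fun v hv hv' => ?_, fun h => ?_⟩, ?_, ?_, ?_⟩))))) (fun heq =>
        Ht.branch h4 rfl (fun hne => Ht.asg_small h4 rfl
          ⟨⟨?_, fun v hv hv' => ?_, fun h => ?_⟩, ?_, ?_, ?_⟩) fun heq' => Ht.asg_small h4 rfl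
          ⟨⟨?_, fun v hv hv' => ?_, fun h => ?_⟩, ?_, ?_, ?_⟩)))))))))
    · simp [e43, hZ.cube_le j]
    · simp [upd, e41, f19] at hne
      obtain ⟨g1, g2⟩ := e21 (by omega)
      simp only [rowDigits, if_pos (show j < σ 19 by omega)] at hlt
      simpa [upd, e11, e43, hdig, g1, g2] using hlt
    · simp [upd, e11, e43, div_rprod_succ, cube]
    · rw [← i₁ v hv hv']
      simp [upd, show v ≠ 15 by omega, show v ≠ 14 by omega, show v ≠ 11 by omega,
            show v ≠ 16 by omega, show v ≠ 17 by omega, show v ≠ 21 by omega, show v ≠ 22 by omega]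
    · obtain ⟨g1, g2⟩ := e21 (by omega)
      simp [upd, g1, g2, e43, div_rprod_succ]
    · simp [upd, e41, f19] at hne
      obtain ⟨g1, g2⟩ := e21 (by omega)
      simp [upd, e11, e43, hdig, g1, g2, rowDigits, show j < σ 19 by omega]
    · simp [upd, e43, cube]
    · simp [upd]
    · simp [upd, e11, e43, div_rprod_succ, cube]
    · rw [← i₁ v hv hv']
      simp [upd, show v ≠ 15 by omega, show v ≠ 14 by omega, show v ≠ 11 by omega,
            show v ≠ 16 by omega, show v ≠ 17 by omega]
    · simp [upd, e41, f19] at hne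
      omega
    · simp [upd, e41, f19] at hne
      simp [upd, e11, e43, hdig, rowDigits, show ¬ j < σ 19 by omega, show j ≠ σ 19 by omega]
    · simp [upd, e43, cube]
    · simp [upd]
    · simp [upd, e11, e43, div_rprod_succ, cube]
    · rw [← i₁ v hv hv']
      simp [upd, show v ≠ 15 by omega, show v ≠ 14 by omega, show v ≠ 11 by omega,
            show v ≠ 16 by omega, show v ≠ 17 by omega]
    · simp [upd, e41, f19] at heq
      omega
    · simp [upd, e41, f19] at heq heq'
      simp [upd, rowDigits, show j = σ 19 by omega, f18]
    · simp [upd, e43, cube]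
    · simp [upd]
  · rintro σ₁ ⟨⟨-, i₁, -⟩, e13, -⟩
    refine Ht.asg_small h4 rfl ⟨?_, fun v hv hv' => ?_⟩
    · simp [upd, e13]
    · rw [← i₁ v hv (by omega)]
      simp [upd, show v ≠ 5 by omega]

end Maps

/-! ## Reading the input tape -/

/-- Compute the integer on the input tape modulo the number in register `6`. -/
def tapeCmd : Cmd :=
  asg 4 0 ;; .instr (.read 7) ;; whl ((reg 7).ne 2) (.instr .moveRight ;; .instr (.read 7)) ;;
    .instr .moveLeft ;; .instr (.read 7) ;;
    -- The guard vanishes exactly on the sign symbols 3 and 4, that is, at the left end of the tape.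
    whl (3 - reg 7)
      (asg 4 ((2 * reg 4 + reg 7) % reg 6) ;; .instr .moveLeft ;; .instr (.read 7)) ;;
    branch (reg 7 - 3) (asg 4 (reg 6 - reg 4)) nop

theorem inputSymbol_eq_two_iff {Δ : ℤ} {h : ℕ} : inputSymbol Δ h = 2 ↔ Δ.natAbs.size < h := by
  unfold inputSymbol
  split_ifs with h1 h2 h3
  · omega
  · omega
  · have := Bool.toNat_le (Δ.natAbs.testBit (h - 1))
    omega
  · simp only [true_iff]; omega

theorem inputSymbol_of_le {Δ : ℤ} {h : ℕ} (hh : h + 1 ≤ Δ.natAbs.size) :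
    inputSymbol Δ (h + 1) = Δ.natAbs / 2 ^ h % 2 := by
  rw [inputSymbol, if_neg (by omega), if_pos hh, Nat.add_sub_cancel, Nat.testBit_eq_decide_div_mod_eq]
  have := Nat.mod_two_eq_zero_or_one (Δ.natAbs / 2 ^ h)
  rcases this with h | h <;> simp [h]

/-- Horner's rule from the most significant bit, reduced modulo `N` in every step, so the space does
not depend on `Δ`. A negative sign replaces r by N - r, which may equal `N`; a congruence is all
that is needed. -/
theorem tapeCmd_ht {Δ : ℤ} {Z S N : ℕ} {σ : ℕ → ℕ} (hZ : 4 ≤ Z) (h3 : σ 3 = 0) (h6 : σ 6 = N)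
    (hN : 1 ≤ N) (hNZ : N ≤ Z) : Ht Δ Z S tapeCmd σ fun σ' =>
      (∃ q : ℤ, (σ' 4 : ℤ) = Δ + q * N) ∧ ∀ v, v ≠ 3 → v ≠ 4 → v ≠ 7 → σ' v = σ v := by
  set s := Δ.natAbs.size with hs
  refine Ht.seq (Ht.asg_small hZ rfl (Ht.seq (Ht.read hZ (by norm_num) (Ht.seq (Ht.whl hZ rfl
    (fun m σ' => ∃ h, h + m = s + 1 ∧ σ' 3 = h ∧ σ' 7 = inputSymbol Δ h ∧ σ' 4 = 0 ∧
      ∀ v, v ≠ 3 → v ≠ 4 → v ≠ 7 → σ' v = σ v) (m := s + 1) ?_ ?_ ?_)))))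
  · refine ⟨0, by omega, by simp [upd, h3], by simp [upd, h3], by simp [upd], fun v a b c => ?_⟩
    simp [upd, b, c]
  · rintro m σ₁ ⟨h, hm, e3, e7, e4, f⟩ hne
    rw [Ex.eval_ne, Ex.eval_reg, Ex.eval_two, e7, Ne, inputSymbol_eq_two_iff] at hne
    refine Ht.seq (Ht.moveRight (Ht.read hZ (by norm_num) ⟨m - 1, by omega, h + 1, by omega,
      ?_, ?_, ?_, fun v a b c => ?_⟩))
    · simp [upd, e3]; omega
    · simp [upd, e3, show h ≤ Δ.natAbs.size by omega]
    · simp [upd, e4]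
    · simp [upd, a, c, f v a b c]
  · rintro m σ₁ ⟨h, hm, e3, e7, e4, f⟩ heq
    rw [Ex.eval_ne_eq_zero, Ex.eval_reg, Ex.eval_two, e7, inputSymbol_eq_two_iff] at heq
    refine Ht.seq (Ht.moveLeft (Ht.seq (Ht.read hZ (by norm_num) (Ht.seq (Ht.whl hZ rfl
      (fun m σ' => σ' 3 = m ∧ m ≤ s ∧ σ' 7 = inputSymbol Δ m ∧ σ' 4 = Δ.natAbs / 2 ^ m % N ∧
        ∀ v, v ≠ 3 → v ≠ 4 → v ≠ 7 → σ' v = σ v) (m := s) ?_ ?_ ?_)))))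
    · refine ⟨?_, le_rfl, ?_, ?_, fun v a b c => ?_⟩
      · simp [upd, e3]; omega
      · simp [upd, e3, show h - 1 = s by omega]
      · rw [Nat.div_eq_of_lt (Nat.lt_size_self _)]
        simp [upd, e4]
      · simp [upd, a, c, f v a b c]
    · rintro h σ₂ ⟨g3, hle, g7, g4, gf⟩ hne
      have g6 : σ₂ 6 = N := (gf 6 (by norm_num) (by norm_num) (by norm_num)).trans h6
      obtain ⟨h, rfl⟩ : ∃ h', h = h' + 1 := Nat.exists_eq_succ_of_ne_zero (by
        rintro rfl
        simp [g7, inputSymbol] at hne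
        split_ifs at hne <;> omega)
      refine Ht.seq (Ht.asg hZ rfl (fun _ => ?_) (Ht.seq (Ht.moveLeft (Ht.read hZ (by norm_num)
        ⟨h, by omega, ?_, by omega, ?_, ?_, fun v a b c => ?_⟩))))
      · simp [g6]
        exact (Nat.mod_lt _ hN).le.trans hNZ
      · simp [upd, g3]
      · simp [upd, g3]
      · simp only [upd, Ex.eval_mod, Ex.eval_add, Ex.eval_mul, Ex.eval_two, Ex.eval_reg, g4, g6, g7,
          reduceIte, Nat.reduceEqDiff, inputSymbol_of_le hle]
        rw [pow_succ, ← Nat.div_div_eq_div_mul]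
        conv_rhs => rw [← Nat.div_add_mod (Δ.natAbs / 2 ^ h) 2]
        rw [Nat.add_mod, Nat.mul_mod, Nat.mod_mod, ← Nat.mul_mod, ← Nat.add_mod]
      · simp [upd, a, b, c, gf v a b c]
    · rintro h σ₂ ⟨g3, hle, g7, g4, gf⟩ h0
      have g6 : σ₂ 6 = N := (gf 6 (by norm_num) (by norm_num) (by norm_num)).trans h6
      simp only [Ex.eval_sub, Ex.eval_three, Ex.eval_reg, g7] at h0
      obtain rfl : h = 0 := by
        by_contra hh
        obtain ⟨h, rfl⟩ := Nat.exists_eq_succ_of_ne_zero hh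
        rw [inputSymbol_of_le hle] at h0
        omega
      rw [pow_zero, Nat.div_one] at g4
      have hdm := congrArg (Nat.cast (R := ℤ)) (Nat.div_add_mod Δ.natAbs N)
      rw [Nat.cast_add, Nat.cast_mul] at hdm
      have hlt := Nat.mod_lt Δ.natAbs hN
      refine Ht.branch hZ rfl (fun hne => Ht.asg_small hZ rfl ⟨⟨(Δ.natAbs / N : ℕ) + 1, ?_⟩,
        fun v a b c => ?_⟩) fun heq => Ht.nop ⟨⟨-(Δ.natAbs / N : ℕ), ?_⟩, gf⟩
      · have hneg : Δ < 0 := by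
          by_contra hneg
          simp [g7, inputSymbol, hneg] at hne
        have e : Δ = -(Δ.natAbs : ℤ) := by omega
        simp only [upd, Ex.eval_sub, Ex.eval_reg, g4, g6, reduceIte]
        rw [Nat.cast_sub hlt.le]
        linarith
      · simp [upd, b, gf v a b c]
      · have hneg : ¬ Δ < 0 := by
          intro hneg
          simp [g7, inputSymbol, hneg] at heq
        have e : Δ = (Δ.natAbs : ℤ) := by omega
        rw [g4]
        linarith

/-! ## Reduction -/

/-- The vector that is represented by the digits `u`. -/
def digitVec (n : ℕ) (μ u : ℕ → ℕ) (j : ℕ) : ℤ := if j < n then (u j : ℤ) - (μ j - 1 : ℕ) else 0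

/-- The relation `r` is added, subtracted or not used, so that the digit `w` of letter `l` becomes
the reduced digit `w'`. -/
def Choice (m : ℕ) (r : ℕ × ℕ) (w a b w' : ℕ) : Prop :=
  (w < m - 1 ∧ w' = w + m ∧ a = r.2 ∧ b = r.1) ∨
  (2 * (m - 1) < w ∧ w' = w - m ∧ a = r.1 ∧ b = r.2) ∨
  (m - 1 ≤ w ∧ w ≤ 2 * (m - 1) ∧ w' = w ∧ a = 0 ∧ b = 0)

section Reduction

variable {n l w a b w' : ℕ} {μ u : ℕ → ℕ} {r : ℕ × ℕ}

/-- The term with `w - u l` accounts for an increment of digit `l` that is made in the same pass.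
The digits below `l` are not bad, hence at least `μ j - 1`, so the truncated subtraction in
`rowDigits` is exact. -/
theorem digitVec_rowDigits (h1 : ∀ j, 1 ≤ μ j) (hl : l < n) (hr : rv μ l r l = μ l)
    (hu : ∀ j < n, j < l → ¬ Bad μ u j) (h : Choice (μ l) r w a b w') :
    ∃ ε : ℤ, digitVec n μ (rowDigits μ u l a b w') =
      digitVec n μ u + ((w : ℤ) - u l) • Pi.single l 1 + ε • rv μ l r := by
  have hm : ∀ c j, c / rprod μ j % μ j < μ j := fun c j => Nat.mod_lt _ (h1 j)
  have hl1 := h1 l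
  have low : ∀ j < l, ((rowDigits μ u l a b w' j : ℕ) : ℤ) =
      u j + (b / rprod μ j % μ j : ℕ) - (a / rprod μ j % μ j : ℕ) := by
    intro j hj
    have := hu j (by omega) hj
    have := hm a j
    unfold Bad at *
    rw [rowDigits, if_pos hj, Nat.cast_sub (by omega)]
    push_cast; ring
  have top : rowDigits μ u l a b w' l = w' := by simp [rowDigits]
  have hi : ∀ j, l < j → rowDigits μ u l a b w' j = u j := fun j hj => by
    rw [rowDigits, if_neg (by omega), if_neg (by omega)]
  have key : ∀ ε : ℤ, (w' : ℤ) = w + ε * μ l →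
      (∀ j < l, ((b / rprod μ j % μ j : ℕ) : ℤ) - (a / rprod μ j % μ j : ℕ) =
        ε * ((r.1 / rprod μ j % μ j : ℕ) - (r.2 / rprod μ j % μ j : ℕ))) →
      digitVec n μ (rowDigits μ u l a b w') =
        digitVec n μ u + ((w : ℤ) - u l) • Pi.single l 1 + ε • rv μ l r := by
    intro ε e1 e2
    ext j
    simp only [Pi.add_apply, Pi.smul_apply, smul_eq_mul, digitVec]
    rcases lt_trichotomy j l with hj | rfl | hj
    · rw [if_pos (by omega), if_pos (by omega), low j hj, rv_of_lt hj, dig, dig, ← e2 j hj,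
        Pi.single_eq_of_ne hj.ne]
      ring
    · rw [if_pos hl, if_pos hl, top, hr, e1, Pi.single_eq_same]
      ring
    · rw [hi j hj, rv_eq_zero hj, Pi.single_eq_of_ne hj.ne']
      ring
  rcases h with ⟨_, rfl, rfl, rfl⟩ | ⟨_, rfl, rfl, rfl⟩ | ⟨_, _, rfl, rfl, rfl⟩
  · exact ⟨1, key 1 (by push_cast; ring) fun j _ => by ring⟩
  · exact ⟨-1, key (-1) (by rw [Nat.cast_sub (by omega)]; ring) fun j _ => by ring⟩
  · exact ⟨0, key 0 (by ring) fun j _ => by simp⟩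

/-- The lower digits lie in the middle third of the admissible range, and one relation moves each by
at most `μ j - 1`. The second alternative in `hw` is needed for radix 1, where an incremented digit
exceeds the range until it is reduced. -/
theorem rowDigits_le (h1 : ∀ j, 1 ≤ μ j) (hu : ∀ j < n, j < l → ¬ Bad μ u j)
    (hu' : ∀ j < n, u j ≤ 3 * (μ j - 1)) (hw : w ≤ 3 * (μ l - 1) ∨ w ≤ 2 * (μ l - 1) + 1)
    (h : Choice (μ l) r w a b w') (j : ℕ) (hj : j < n) :
    rowDigits μ u l a b w' j ≤ 3 * (μ j - 1) := by
  have h1j := h1 j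
  have ha : a / rprod μ j % μ j < μ j := Nat.mod_lt _ h1j
  have hb : b / rprod μ j % μ j < μ j := Nat.mod_lt _ h1j
  unfold rowDigits
  split_ifs with h2 h3
  · have := hu j hj h2
    unfold Bad at this
    omega
  · subst h3
    unfold Choice at h
    omega
  · exact hu' j hj

theorem not_bad_rowDigits (h1 : ∀ j, 1 ≤ μ j) (hw : w ≤ 3 * (μ l - 1) ∨ w ≤ 2 * (μ l - 1) + 1)
    (h : Choice (μ l) r w a b w') : ¬ Bad μ (rowDigits μ u l a b w') l := by
  have h1l := h1 l
  unfold Bad rowDigits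
  unfold Choice at h
  simp only [lt_irrefl, if_false, if_true]
  omega

instance (μ u : ℕ → ℕ) : DecidablePred (Bad μ u) := fun _ => by unfold Bad; infer_instance

/-- A measure that decreases in the reduction. -/
def badSum (n : ℕ) (μ u : ℕ → ℕ) : ℕ :=
  ∑ j ∈ (Finset.range n).filter (Bad μ u), 2 ^ j

theorem badSum_lt (n : ℕ) (μ u : ℕ → ℕ) : badSum n μ u < 2 ^ n :=
  Nat.geomSum_lt le_rfl fun _ hj => Finset.mem_range.1 (Finset.mem_filter.1 hj).1

/-- Repairing digit `l` may spoil all lower digits, but their weights together are less than `2 ^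
l`. -/
theorem badSum_lt_badSum {u' : ℕ → ℕ} (hl : l < n) (hbad : Bad μ u l) (hbad' : ¬ Bad μ u' l)
    (h : ∀ j, l < j → u' j = u j) : badSum n μ u' < badSum n μ u := by
  have hmem : l ∈ (Finset.range n).filter (Bad μ u) := by simp [hl, hbad]
  unfold badSum
  rw [← Finset.add_sum_erase _ _ hmem]
  have hsub : (Finset.range n).filter (Bad μ u') ⊆
      Finset.range l ∪ ((Finset.range n).filter (Bad μ u)).erase l := by
    intro j hj
    simp only [Finset.mem_filter, Finset.mem_union, Finset.mem_range, Finset.mem_erase] at hj ⊢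
    rcases lt_trichotomy j l with h' | rfl | h'
    · exact Or.inl h'
    · exact absurd hj.2 hbad'
    · refine Or.inr ⟨h'.ne', hj.1, ?_⟩
      have := hj.2
      unfold Bad at this ⊢
      rwa [h j h'] at this
  have hgeom : ∑ j ∈ Finset.range l, 2 ^ j < 2 ^ l :=
    Nat.geomSum_lt le_rfl fun j hj => Finset.mem_range.1 hj
  calc _ ≤ ∑ j ∈ Finset.range l ∪ ((Finset.range n).filter (Bad μ u)).erase l, 2 ^ j :=
        Finset.sum_le_sum_of_subset hsub
    _ ≤ ∑ j ∈ Finset.range l, 2 ^ j + ∑ j ∈ ((Finset.range n).filter (Bad μ u)).erase l, 2 ^ j := by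
        rw [← Finset.sum_union_inter]; exact Nat.le_add_right _ _
    _ < _ := Nat.add_lt_add_right hgeom _

end Reduction

/-- Add a unit vector, as often as register `4` says, and reduce. -/
def reduceCmd (stepC startC : Cmd) : Cmd :=
  scanCmd ;;
    whl ((reg 0 - reg 8) + reg 4)
      (branch (reg 0 - reg 8) (asg 19 (reg 8) ;; asg 18 (reg 9))
          (asg 19 (reg 2) ;; asg 18 (reg 10 + 1) ;; asg 4 (reg 4 - 1)) ;;
        -- The whole construction is repeated to obtain the single relation with leading letter
        -- register 19. Storing all relations would exceed the space.
        mainCmd stepC startC ;; asg 41 (reg 19) ;; getCmd ;;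
        branch (reg 43 - 1 - reg 18)
          -- Swapping the two words negates the relation, so that subtracting it amounts to adding
          -- the original.
          (asg 18 (reg 18 + reg 43) ;; asg 17 (reg 21) ;; asg 21 (reg 22) ;; asg 22 (reg 17))
          (branch (reg 18 - 2 * (reg 43 - 1)) (asg 18 (reg 18 - reg 43))
            (asg 21 0 ;; asg 22 0)) ;;
        rowCmd ;; scanCmd)

def updateCmd (stepC startC : Cmd) : Cmd :=
  mainCmd stepC startC ;; prodCmd ;; asg 6 (reg 12) ;; tapeCmd ;; encodeCmd ;;
    reduceCmd stepC startC ;; decodeCmd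

/-! ### Correctness of the reduction and of the update program -/

section Programs

variable {Δ : ℤ} {Z S n T : ℕ} {M : Machine n T} {stepC startC : Cmd}
  (E : Env Δ Z S M stepC startC) (hZ : T ^ 3 ≤ Z) {σ : ℕ → ℕ}
include E hZ

theorem Env.fits : Fits Z n T M.fin.μ where
  four_le := E.four_le
  n_le := E.n_le
  T_le := hZ
  radices := by
    have := M.inv_fin.radices
    rwa [M.fin_k] at this

omit E hZ in
theorem MRep.ctx (h : MRep n M.fin σ) : ListCtx n M.fin.μ σ :=
  ⟨h.dim, by rw [h.list, M.fin_k]⟩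

/-- The registers hold a vector that is congruent to `x` when the remaining unit vectors are
added. -/
structure Reducing (M : Machine n T) (x : ℕ → ℤ) (i : ℕ) (u σ : ℕ → ℕ) : Prop where
  ctx : ListCtx n M.fin.μ σ
  idx : σ 2 = i
  val : σ 5 = dsum (cube M.fin.μ) u n
  le : ∀ j < n, u j ≤ 3 * (M.fin.μ j - 1)
  mem : digitVec n M.fin.μ u + (σ 4 : ℤ) • Pi.single i 1 - x ∈ M.rels

theorem Env.scanCmd_ht {x : ℕ → ℤ} {i : ℕ} {u : ℕ → ℕ} (hi : i < n) (h : Reducing M x i u σ) :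
    Ht Δ Z S scanCmd σ fun σ' => Reducing M x i u σ' ∧ σ' 10 = u i ∧ σ' 4 = σ 4 ∧
      (∀ j < n, j < σ' 8 → ¬ Bad M.fin.μ u j) ∧
      (σ' 8 = n ∨ σ' 8 < n ∧ Bad M.fin.μ u (σ' 8) ∧ σ' 9 = u (σ' 8)) := by
  refine (_root_.scanCmd_ht (E.fits hZ) h.ctx h.val h.le (h.idx ▸ hi)).mono ?_
  rintro σ' ⟨h10, h8, h9, hf⟩
  refine ⟨⟨⟨?_, ?_⟩, ?_, ?_, h.le, ?_⟩, ?_, hf 4 (by norm_num) (by norm_num), h8, h9⟩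
  · rw [hf 0 (by norm_num) (by norm_num), h.ctx.dim]
  · rw [hf 20 (by norm_num) (by norm_num), h.ctx.list]
  · rw [hf 2 (by norm_num) (by norm_num), h.idx]
  · rw [hf 5 (by norm_num) (by norm_num), h.val]
  · rw [hf 4 (by norm_num) (by norm_num)]; exact h.mem
  · rw [h10, h.idx]

/-- The variant is lexicographic: first the number of unit vectors still to be added, weighted by `2
^ n`, then `badSum`, which is below `2 ^ n`. A unit vector is added only when no digit is bad. -/
theorem Env.reduceCmd_ht {x : ℕ → ℤ} {i : ℕ} {u : ℕ → ℕ} (hi : i < n) (h : Reducing M x i u σ) :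
    Ht Δ Z S (reduceCmd stepC startC) σ fun σ' => ∃ u', ListCtx n M.fin.μ σ' ∧
      σ' 5 = dsum (cube M.fin.μ) u' n ∧ (∀ j < n, ¬ Bad M.fin.μ u' j) ∧
      digitVec n M.fin.μ u' - x ∈ M.rels := by
  have h4 := E.four_le
  have hF := E.fits hZ
  set μ := M.fin.μ with hμ
  have h1 := hF.radices.one_le
  refine Ht.seq ((E.scanCmd_ht hZ hi h).mono fun σ₁ k₁ => Ht.whl h4 rfl
    (fun m σ' => ∃ u, Reducing M x i u σ' ∧ σ' 10 = u i ∧ σ' 4 * 2 ^ n + badSum n μ u = m ∧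
      (∀ j < n, j < σ' 8 → ¬ Bad μ u j) ∧ (σ' 8 = n ∨ σ' 8 < n ∧ Bad μ u (σ' 8) ∧ σ' 9 = u (σ' 8)))
    (m := σ₁ 4 * 2 ^ n + badSum n μ u) ⟨u, k₁.1, k₁.2.1, rfl, k₁.2.2.2⟩ ?_ ?_)
  · rintro m σ₂ ⟨u, hred, e10, em, e8, e8'⟩ hne
    -- One pass in both cases: digit `l` is taken to be `w`, and `D` unit vectors remain. For a
    -- repair `w` is the present digit; for an addition it is the digit plus one, which is reduced
    -- before it is stored.
    have key : ∀ (σ₃ : ℕ → ℕ) (l w D : ℕ), (∀ v < 18, v ≠ 4 → σ₃ v = σ₂ v) → σ₃ 19 = l →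
        σ₃ 18 = w → σ₃ 4 = D → l < n → (∀ j < n, j < l → ¬ Bad μ u j) →
        (w ≤ 3 * (μ l - 1) ∨ w ≤ 2 * (μ l - 1) + 1) →
        (∀ u', ¬ Bad μ u' l → (∀ j, l < j → u' j = u j) → D * 2 ^ n + badSum n μ u' < m) →
        ((w : ℤ) - u l) • Pi.single l 1 + (D : ℤ) • Pi.single i 1 =
          (σ₂ 4 : ℤ) • (Pi.single i 1 : ℕ → ℤ) →
        Ht Δ Z S (mainCmd stepC startC ;; asg 41 (reg 19) ;; getCmd ;;
          branch (reg 43 - 1 - reg 18)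
            (asg 18 (reg 18 + reg 43) ;; asg 17 (reg 21) ;; asg 21 (reg 22) ;; asg 22 (reg 17))
            (branch (reg 18 - 2 * (reg 43 - 1)) (asg 18 (reg 18 - reg 43))
              (asg 21 0 ;; asg 22 0)) ;;
          rowCmd ;; scanCmd) σ₃ fun σ' => ∃ m' < m, ∃ u, Reducing M x i u σ' ∧ σ' 10 = u i ∧
            σ' 4 * 2 ^ n + badSum n μ u = m' ∧ (∀ j < n, j < σ' 8 → ¬ Bad μ u j) ∧
            (σ' 8 = n ∨ σ' 8 < n ∧ Bad μ u (σ' 8) ∧ σ' 9 = u (σ' 8)) := by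
      intro σ₃ l w D f₃ e19 e18 e4 hl hgood hw hdec hvec
      refine Ht.seq ((E.mainCmd_ht ((f₃ 0 (by norm_num) (by norm_num)).trans hred.ctx.dim)).mono ?_)
      rintro σ₄ ⟨hrep, f₄⟩
      have g0 := hrep.ctx.dim
      have g20 := hrep.ctx.list
      have g19 : σ₄ 19 = l := (f₄ 19 (by norm_num)).trans e19
      have g18 : σ₄ 18 = w := (f₄ 18 (by norm_num)).trans e18
      have grow := hrep.row
      rw [g19] at grow
      have hdiag := M.fin_diag l hl
      rw [← grow] at hdiag
      refine Ht.seq (Ht.asg_small h4 rfl (Ht.seq ((getCmd_ht h4 hF.radices hF.T_le' ?_ ?_ ?_).mono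
        ?_)))
      · simp [upd, g0]
      · simp [upd, g20, hμ]
      · simp [upd, g19]; omega
      rintro σ₅ ⟨e43, f₅⟩
      replace e43 : σ₅ 43 = μ l := by rw [e43]; simp [upd, g19]
      have F₅ : ∀ v < 41, σ₅ v = σ₄ v := fun v hv => by
        simp [f₅ v (by omega), upd, show v ≠ 41 by omega]
      have key₂ : ∀ σ₆ : ℕ → ℕ, (∀ v < 21, v ≠ 17 → v ≠ 18 → σ₆ v = σ₅ v) →
          Choice (μ l) (σ₄ 21, σ₄ 22) w (σ₆ 21) (σ₆ 22) (σ₆ 18) →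
          Ht Δ Z S (rowCmd ;; scanCmd) σ₆ fun σ' => ∃ m' < m, ∃ u, Reducing M x i u σ' ∧
            σ' 10 = u i ∧ σ' 4 * 2 ^ n + badSum n μ u = m' ∧
            (∀ j < n, j < σ' 8 → ¬ Bad μ u j) ∧
            (σ' 8 = n ∨ σ' 8 < n ∧ Bad μ u (σ' 8) ∧ σ' 9 = u (σ' 8)) := by
        intro σ₆ f₆ hch
        have G : ∀ v < 18, v ≠ 4 → v ≠ 17 → σ₆ v = σ₂ v := fun v hv h4 h17 => by
          rw [f₆ v (by omega) h17 (by omega), F₅ v (by omega), f₄ v (by omega), f₃ v hv h4]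
        have k0 : σ₆ 0 = n := (G 0 (by norm_num) (by norm_num) (by norm_num)).trans hred.ctx.dim
        have k20 : σ₆ 20 = enc n μ n := by
          rw [f₆ 20 (by norm_num) (by norm_num) (by norm_num), F₅ 20 (by norm_num), g20]
        have k19 : σ₆ 19 = l := by
          rw [f₆ 19 (by norm_num) (by norm_num) (by norm_num), F₅ 19 (by norm_num), g19]
        have k4 : σ₆ 4 = D := by
          rw [f₆ 4 (by norm_num) (by norm_num) (by norm_num), F₅ 4 (by norm_num),
            f₄ 4 (by norm_num), e4]
        have k5 := (G 5 (by norm_num) (by norm_num) (by norm_num)).trans hred.val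
        have hle := rowDigits_le h1 hgood hred.le hw hch
        refine Ht.seq ((rowCmd_ht hF ⟨k0, k20⟩ k5 hred.le ?_).mono ?_)
        · rw [k19]; exact hle
        rintro σ₇ ⟨e5, f₇⟩
        rw [k19] at e5
        have hred' : Reducing M x i (rowDigits μ u l (σ₆ 21) (σ₆ 22) (σ₆ 18)) σ₇ := by
          refine ⟨⟨?_, ?_⟩, ?_, e5, hle, ?_⟩
          · rw [f₇ 0 (by norm_num) (by norm_num), k0]
          · rw [f₇ 20 (by norm_num) (by norm_num), k20]
          · rw [f₇ 2 (by norm_num) (by norm_num), G 2 (by norm_num) (by norm_num) (by norm_num),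
              hred.idx]
          · obtain ⟨ε, hε⟩ := digitVec_rowDigits h1 hl hdiag hgood hch
            rw [f₇ 4 (by norm_num) (by norm_num), k4, hε]
            have := M.rels.add_mem hred.mem (M.rels.zsmul_mem (rv_mem_relGroup hl) ε)
            rw [← hvec] at this
            convert this using 1
            rw [grow]
            abel
        refine (E.scanCmd_ht hZ hi hred').mono fun σ₈ k₈ =>
          ⟨σ₈ 4 * 2 ^ n + badSum n μ (rowDigits μ u l (σ₆ 21) (σ₆ 22) (σ₆ 18)), ?_, _,
            k₈.1, k₈.2.1, rfl, k₈.2.2.2⟩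
        rw [k₈.2.2.1, f₇ 4 (by norm_num) (by norm_num), k4]
        refine hdec _ (not_bad_rowDigits h1 hw hch) fun j hj => ?_
        rw [rowDigits, if_neg (by omega), if_neg (by omega)]
      have F18 : σ₅ 18 = w := (F₅ 18 (by norm_num)).trans g18
      have hl1 := h1 l
      refine Ht.seq (Ht.branch h4 rfl (fun hne => Ht.seq (Ht.asg h4 rfl (fun _ => ?_) (Ht.seq
        (Ht.asg_small h4 rfl (Ht.seq (Ht.asg_small h4 rfl (Ht.asg_small h4 rfl
          (key₂ _ (fun v hv h17 h18 => ?_) (Or.inl ⟨?_, ?_, ?_, ?_⟩))))))))) fun heq =>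
        Ht.branch h4 rfl (fun hne => Ht.asg_small h4 rfl
          (key₂ _ (fun v hv h17 h18 => ?_) (Or.inr (Or.inl ⟨?_, ?_, ?_, ?_⟩)))) fun heq' =>
        Ht.seq (Ht.asg_small h4 rfl (Ht.asg_small h4 rfl
          (key₂ _ (fun v hv h17 h18 => ?_) (Or.inr (Or.inr ⟨?_, ?_, ?_, ?_, ?_⟩))))))
      · simp [F18, e43] at hne ⊢
        have := lt_cube (a := w + μ l) hl1 (by omega)
        have := hF.cube_le l
        omega
      · simp [upd, h17, h18, hv.ne, show v ≠ 22 by omega]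
      · simp [F18, e43] at hne; omega
      · simp [upd, F18, e43]
      · simp [upd, F₅]
      · simp [upd, F₅]
      · simp [upd, h18]
      · simp [F18, e43] at hne; omega
      · simp [upd, F18, e43]
      · simp [upd, F₅]
      · simp [upd, F₅]
      · simp [upd, hv.ne, show v ≠ 22 by omega]
      · simp [F18, e43] at heq; omega
      · simp [F18, e43] at heq'; omega
      · simp [upd, F18]
      · simp [upd]
      · simp [upd]
    have f0 := hred.ctx.dim
    have f2 := hred.idx
    refine Ht.seq (Ht.branch h4 rfl (fun hlt => Ht.seq (Ht.asg_small h4 rfl (Ht.asg_small h4 rfl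
      (key _ (σ₂ 8) (u (σ₂ 8)) (σ₂ 4) (fun v hv h4 => ?_) ?_ ?_ ?_ ?_ e8 (Or.inl ?_) ?_ ?_))))
      fun hlt => Ht.seq (Ht.asg_small h4 rfl (Ht.seq (Ht.asg h4 rfl (fun _ => ?_)
      (Ht.asg_small h4 rfl (key _ i (u i + 1) (σ₂ 4 - 1) (fun v hv h4 => ?_) ?_ ?_ ?_ hi ?_
        (Or.inr ?_) ?_ ?_))))))
    · simp [upd, hv.ne, show v ≠ 19 by omega]
    · simp [upd]
    · simp [f0] at hlt
      rcases e8' with h | h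
      · omega
      · simp [upd, h.2.2]
    · simp [upd]
    · simp [f0] at hlt; omega
    · simp [f0] at hlt
      exact hred.le _ (by omega)
    · simp [f0] at hlt
      rcases e8' with h | h
      · omega
      · intro u' hb hu'
        have := badSum_lt_badSum h.1 h.2.1 hb hu'
        omega
    · rw [sub_self, zero_smul, zero_add]
    · simp [upd, e10]
      have := lt_cube (h1 i) (hred.le i hi)
      have := hF.cube_le i
      omega
    · simp [upd, h4, hv.ne, show v ≠ 19 by omega]
    · simp [upd, f2]
    · simp [upd, e10]
    · simp [upd]
    · simp [f0] at hlt
      exact fun j hj _ => e8 j hj (by omega)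
    · simp [f0] at hlt
      have := e8 i hi (by omega)
      unfold Bad at this
      omega
    · simp [f0] at hlt hne
      intro u' _ _
      have h5 := badSum_lt n μ u'
      have h6 : σ₂ 4 = σ₂ 4 - 1 + 1 := by
        have := hne (by omega); omega
      rw [h6, add_mul] at em
      omega
    · simp [f0] at hlt hne
      have h6 : ((σ₂ 4 - 1 : ℕ) : ℤ) = (σ₂ 4 : ℤ) - 1 := by
        have := hne (by omega); omega
      rw [h6]
      push_cast
      rw [← add_smul]
      congr 1
      ring
  · rintro m σ₂ ⟨u, hred, e10, em, e8, e8'⟩ heq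
    have f0 := hred.ctx.dim
    simp [f0] at heq
    have hmem := hred.mem
    rw [heq.2, Nat.cast_zero, zero_smul, add_zero] at hmem
    exact ⟨u, hred.ctx, hred.val, fun j hj => e8 j hj (by omega), hmem⟩

theorem Env.updateCmd_ht {X i : ℕ} (h0 : σ 0 = n) (h1 : σ 1 = X) (h2 : σ 2 = i) (h3 : σ 3 = 0)
    (hX : X < M.size) (hi : i < n) : Ht Δ Z S (updateCmd stepC startC) σ fun σ' =>
      σ' 1 < M.size ∧ wv M.fin.μ n (σ' 1) - (wv M.fin.μ n X + Δ • Pi.single i 1) ∈ M.rels := by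
  have h4 := E.four_le
  have hF := E.fits hZ
  set μ := M.fin.μ with hμ
  have hone := hF.radices.one_le
  refine Ht.seq ((E.mainCmd_ht h0).mono ?_)
  rintro σ₁ ⟨hrep, f₁⟩
  refine Ht.seq ((prodCmd_ht hF hrep.ctx).mono ?_)
  rintro σ₂ ⟨e12, f₂⟩
  refine Ht.seq (Ht.asg_small h4 rfl (Ht.seq ((tapeCmd_ht (N := M.size) h4 ?_ ?_ M.size_pos
    (M.size_le.trans hF.T_le')).mono ?_)))
  · simp [upd, f₂, f₁, h3]
  · simp [upd, e12, Machine.size, hμ]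
  rintro σ₃ ⟨⟨q, hq⟩, f₃⟩
  have F₃ : ∀ v, v < 3 ∨ v = 20 → σ₃ v = σ₁ v := fun v hv => by
    rw [f₃ v (by omega) (by omega) (by omega)]
    simp [upd, f₂ v (by omega) (by omega), show v ≠ 6 by omega]
  have hc₃ : ListCtx n μ σ₃ := ⟨(F₃ 0 (by norm_num)).trans hrep.ctx.dim,
    (F₃ 20 (by norm_num)).trans hrep.ctx.list⟩
  have e1 : σ₃ 1 = X := (F₃ 1 (by norm_num)).trans ((f₁ 1 (by norm_num)).trans h1)
  refine Ht.seq ((encodeCmd_ht hF hc₃).mono ?_)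
  rintro σ₄ ⟨e5, f₄⟩
  rw [e1] at e5
  have hvec : digitVec n μ (fun j => dig μ X j + (μ j - 1)) = wv μ n X := by
    ext j
    simp only [digitVec, wv, dgt_eq_dig (μ := μ) hX]
    split_ifs
    · push_cast; ring
    · rfl
  have hred : Reducing M (wv μ n X + Δ • Pi.single i 1) i (fun j => dig μ X j + (μ j - 1)) σ₄ := by
    refine ⟨⟨?_, ?_⟩, ?_, e5, fun j hj => ?_, ?_⟩
    · rw [f₄ 0 (by norm_num) (by norm_num), hc₃.dim]
    · rw [f₄ 20 (by norm_num) (by norm_num), hc₃.list]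
    · rw [f₄ 2 (by norm_num) (by norm_num), F₃ 2 (by norm_num), f₁ 2 (by norm_num), h2]
    · have : dig μ X j < μ j := Nat.mod_lt _ (hone j)
      change dig μ X j + (μ j - 1) ≤ 3 * (μ j - 1)
      omega
    · rw [← hμ, hvec, f₄ 4 (by norm_num) (by norm_num), hq]
      -- The residue read from the tape differs from `Δ` by `q` times the index, which annihilates
      -- the quotient.
      have := M.rels.zsmul_mem (rprod_smul_mem_relGroup M.fin_diag (x := Pi.single i 1)
        fun j hj => Pi.single_eq_of_ne (by omega) _) q
      convert this using 1
      rw [smul_smul, add_smul]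
      change _ + (_ + (q * (M.size : ℤ)) • _) - _ = (q * (M.size : ℤ)) • _
      abel
  refine Ht.seq ((E.reduceCmd_ht hZ hi hred).mono ?_)
  rintro σ₅ ⟨u, hc₅, g5, hgood, hmem⟩
  simp only [← hμ] at hgood
  refine (decodeCmd_ht hF hc₅ g5 fun j hj => ?_).mono fun σ₆ e => ?_
  · have := hgood j hj
    unfold Bad at this
    omega
  have hd : ∀ j < n, u j - (μ j - 1) < μ j := fun j hj => by
    have := hgood j hj
    have := hone j
    unfold Bad at *
    omega
  have hlt := dsum_lt hd
  refine ⟨by rw [e]; exact hlt, ?_⟩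
  rw [e]
  convert hmem using 2
  ext j
  simp only [digitVec, wv, ← hμ, dgt_eq_dig (μ := μ) hlt]
  split_ifs with hj
  · rw [dig_dsum hd hj]
    have := hgood j hj
    unfold Bad at this
    omega
  · rfl

end Programs

/-! ## The size of the lists -/

theorem pushBits_lt {b m L a : ℕ} (hb : 2 ≤ b) (h : L < b ^ a) :
    pushBits b m L < b ^ (a + m.size) := by
  induction m using Nat.strong_induction_on generalizing L a with
  | _ m ih =>
    rw [pushBits]
    split_ifs with h0
    · simpa [h0] using h
    · have hs : m.size = (m / 2).size + 1 := by
        obtain ⟨c, hc⟩ := Nat.exists_eq_succ_of_ne_zero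
          (show m.size ≠ 0 from fun h => h0 (Nat.size_eq_zero.1 h))
        refine le_antisymm ?_ ?_
        · rw [Nat.size_le, pow_succ]
          have := Nat.lt_size_self (m / 2)
          omega
        · rw [hc, Nat.succ_eq_add_one, Nat.add_le_add_iff_right, Nat.size_le]
          have := Nat.lt_size_self m
          rw [hc, Nat.succ_eq_add_one, pow_succ] at this
          omega
      rw [hs, show a + ((m / 2).size + 1) = a + 1 + (m / 2).size by ring]
      refine ih (m / 2) (by omega) ?_
      calc L * b + m % 2 < (L + 1) * b := by rw [add_mul]; omega
        _ ≤ b ^ a * b := Nat.mul_le_mul_right _ h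
        _ = b ^ (a + 1) := (pow_succ b a).symm

/-- A radix m ≥ 2 takes one digit for its letter and ⌊log₂ m⌋ + 1 for its bits, at most 3 ⌊log₂ m⌋
in all. The sum of these logarithms is bounded by that of the product. -/
theorem exists_enc_lt {n k : ℕ} {μ : ℕ → ℕ} (hk : k ≤ n) (h1 : ∀ j, 1 ≤ μ j) :
    ∃ e, enc n μ k < (n + 2) ^ (3 * e) ∧ 2 ^ e ≤ rprod μ k := by
  induction k with
  | zero => exact ⟨0, by simp [enc], by simp [rprod]⟩
  | succ k ih =>
    obtain ⟨e, he, he'⟩ := ih (by omega)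
    rw [enc, rprod_succ]
    split_ifs with hm
    · exact ⟨e, he, by rwa [hm, mul_one]⟩
    · have h2 : 2 ≤ μ k := by have := h1 k; omega
      obtain ⟨f, hf⟩ : ∃ f, (μ k).size = f + 1 + 1 := by
        have := Nat.lt_size.2 (show 2 ^ 1 ≤ μ k by omega)
        exact ⟨(μ k).size - 2, by omega⟩
      have hf' : 2 ^ (f + 1) ≤ μ k := Nat.lt_size.1 (by omega)
      refine ⟨e + (f + 1), ?_, ?_⟩
      · refine (pushBits_lt (a := 3 * e + 1) (by omega) ?_).trans_le
          (Nat.pow_le_pow_right (by omega) (by omega))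
        calc _ < (enc n μ k + 1) * (n + 2) := by rw [add_mul]; omega
          _ ≤ (n + 2) ^ (3 * e) * (n + 2) := Nat.mul_le_mul_right _ he
          _ = _ := (pow_succ _ _).symm
      · rw [pow_add]
        exact Nat.mul_le_mul he' hf'

/-- A bound on all registers. -/
def bound (n s : ℕ) : ℕ := 2 ^ (3 * (s * (n + 2).size) + 3 * s + (n + 2).size + 2)

theorem enc_le_bound {n s k : ℕ} {μ : ℕ → ℕ} (h : Radices n (2 ^ s) μ k) :
    enc n μ k ≤ bound n s := by
  obtain ⟨e, he, he'⟩ := exists_enc_lt h.k_le h.one_le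
  have hes : e ≤ s := (Nat.pow_le_pow_iff_right (by norm_num)).1 (he'.trans h.rprod_le)
  calc enc n μ k ≤ (n + 2) ^ (3 * s) :=
        he.le.trans (Nat.pow_le_pow_right (by omega) (by omega))
    _ ≤ (2 ^ (n + 2).size) ^ (3 * s) := Nat.pow_le_pow_left (Nat.lt_size_self _).le _
    _ = 2 ^ (3 * (s * (n + 2).size)) := by rw [← pow_mul]; congr 1; ring
    _ ≤ bound n s := Nat.pow_le_pow_right (by norm_num) (by omega)

theorem size_add_two_le {n : ℕ} (hn : 1 ≤ n) : (n + 2).size ≤ n.size + 1 := by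
  rw [Nat.size_le, pow_succ]
  have h1 := Nat.lt_size_self n
  have h2 : 2 ^ 1 ≤ 2 ^ n.size := Nat.pow_le_pow_right (by norm_num) (Nat.size_pos.2 hn)
  omega

theorem size_eq_log_add_one {n : ℕ} (hn : 1 ≤ n) : n.size = Nat.log 2 n + 1 := by
  refine le_antisymm (Nat.size_le.2 (Nat.lt_pow_succ_log_self (by norm_num) n)) ?_
  exact Nat.lt_size.2 (Nat.pow_log_le_self 2 (by omega))

/-- The terms linear in the state length are charged to `S`, since the log term vanishes for n = 1;
this is why `s' ≤ S` is required. As n ≥ 1 has at least one bit, `S` also absorbs the additive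
constants. -/
theorem space_bound {n s s' S : ℕ} (hn : 1 ≤ n) (hs : s' ≤ s) (hS : s' ≤ S) (hnS : n.size ≤ S) :
    58 * (bound n s' ^ 4).size + S ≤ 3200 * (S + s * Nat.log 2 n) := by
  have h1 := size_add_two_le hn
  have h2 := size_eq_log_add_one hn
  have h3 : s' * (n + 2).size ≤ s * Nat.log 2 n + 2 * S := by
    calc s' * (n + 2).size ≤ s' * (Nat.log 2 n + 2) := Nat.mul_le_mul_left _ (by omega)
      _ = s' * Nat.log 2 n + 2 * s' := by ring
      _ ≤ _ := Nat.add_le_add (Nat.mul_le_mul_right _ hs) (by omega)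
  rw [bound, ← pow_mul, Nat.size_pow]
  omega

/-! ## The automaton of an algorithm -/

theorem StreamAlg.Reaches.det {A : StreamAlg} {n S S' y y' : ℕ} {σ : TurnstileStream n}
    (h : A.Reaches n S σ y) (h' : A.Reaches n S' σ y') : y = y' := by
  induction h generalizing y' with
  | nil h =>
    generalize hσ : ([] : TurnstileStream n) = σ at h'
    cases h' with
    | nil g => rw [h.det g]
    | snoc => simp at hσ
  | @snoc σ₁ y i δ c _ hu ih =>
    generalize hσ : σ₁ ++ [(i, δ)] = σ at h'
    cases h' with
    | nil => simp at hσ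
    | snoc g gu =>
      obtain ⟨rfl, h2⟩ := List.append_inj' hσ rfl
      cases h2
      obtain rfl := ih g
      rw [hu.det gu]

theorem StreamAlg.Reaches.mono {A : StreamAlg} {n S S' y : ℕ} {σ : TurnstileStream n}
    (h : A.Reaches n S σ y) (hS : S ≤ S') : A.Reaches n S' σ y := by
  induction h with
  | nil h => exact .nil (h.mono hS)
  | snoc _ h' ih => exact .snoc ih (h'.mono hS)

theorem StreamAlg.Recovers.det {A : StreamAlg} {n S S' y : ℕ} {z z' : ℤ}
    (h : A.Recovers n S y z) (h' : A.Recovers n S' y z') : z = z' := by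
  obtain ⟨c, hc, rfl⟩ := h
  obtain ⟨c', hc', rfl⟩ := h'
  rw [hc.det hc']

/-- The value that a program leaves in register `1`. -/
noncomputable def runValue (Δ : ℤ) (p : Cmd) (c : Config) : ℕ := by
  classical exact if h : ∃ (S : ℕ) (c' : Config), Runs Δ S p c c' then h.choose_spec.choose.reg 1 else 0

theorem runValue_eq {Δ : ℤ} {S : ℕ} {p : Cmd} {c c' : Config} (h : Runs Δ S p c c') :
    runValue Δ p c = c'.reg 1 := by
  have h' : ∃ (S : ℕ) (c' : Config), Runs Δ S p c c' := ⟨S, c', h⟩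
  rw [runValue, dif_pos h', h'.choose_spec.choose_spec.det h]

theorem TurnstileStream.freq_append {n : ℕ} (σ : TurnstileStream n) (i : Fin n) (δ : ℤ) :
    TurnstileStream.freq (σ ++ [(i, δ)]) = σ.freq + Pi.single i δ := by
  simp [TurnstileStream.freq]

theorem extend_apply {n : ℕ} (x : Fin n → ℤ) (i : Fin n) : extend n x i = x i := by
  simp [extend]

namespace StreamAlg

variable {A : StreamAlg} {n s S : ℕ}

/-- The hypothesis is applied to the stream with the update appended, and determinism identifies the
state before the update with `y`. -/
theorem UsesSpace.exists_runs (h : A.UsesSpace n s S) {σ : TurnstileStream n} {y S' : ℕ}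
    (hy : A.Reaches n S' σ y) (i : Fin n) (δ : ℤ) :
    A.Reaches n S σ y ∧ ∃ c, Runs δ S A.update (startConfig n y i) c := by
  obtain ⟨y', z, -, h1, -⟩ := h (σ ++ [(i, δ)])
  generalize hσ : σ ++ [(i, δ)] = σ' at h1
  cases h1 with
  | nil => simp at hσ
  | @snoc _ y₁ _ _ c g gu =>
    obtain ⟨rfl, h2⟩ := List.append_inj' hσ rfl
    cases h2
    obtain rfl := hy.det g
    exact ⟨g, c, gu⟩

theorem UsesSpace.exists_start (h : A.UsesSpace n s S) :
    ∃ c, Runs 0 S A.start (startConfig n 0 0) c := by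
  obtain ⟨y', z, -, h1, -⟩ := h []
  generalize hσ : ([] : TurnstileStream n) = σ at h1
  cases h1 with
  | @nil c h => exact ⟨c, h⟩
  | snoc => simp at hσ

/-- Besides the bound `s`, the state fits into `S` bits because recovery starts with it in a
register. -/
theorem UsesSpace.lt (h : A.UsesSpace n s S) {σ : TurnstileStream n} {y S' : ℕ}
    (hy : A.Reaches n S' σ y) : y < 2 ^ min s S := by
  obtain ⟨y', z, hlt, h1, c, hc, -⟩ := h σ
  obtain rfl := hy.det h1
  rcases min_choice s S with e | e <;> rw [e]
  · exact hlt
  · have := (size_add_size_le_space n y 0).trans hc.space_start_le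
    exact Nat.size_le.1 (by omega)

/-- The automaton on unit updates. -/
noncomputable def toMachine (h : A.UsesSpace n s S) : Machine n (2 ^ min s S) where
  stp b i y := runValue (sg b) A.update (startConfig n y i)
  init := runValue 0 A.start (startConfig n 0 0)
  -- Only the existence of some stream is recorded; different streams of one frequency may end in
  -- different states.
  R x y := ∃ σ : TurnstileStream n, (∀ i : Fin n, σ.freq i = x i) ∧ A.Reaches n S σ y
  R_zero := by
    obtain ⟨c, hc⟩ := h.exists_start
    exact ⟨[], fun i => by simp [TurnstileStream.freq], by rw [runValue_eq hc]; exact .nil hc⟩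
  R_step := by
    rintro x y b i hi ⟨σ, hσ, hy⟩
    obtain ⟨-, c, hc⟩ := h.exists_runs hy ⟨i, hi⟩ (sg b)
    refine ⟨σ ++ [(⟨i, hi⟩, sg b)], fun j => ?_, by rw [runValue_eq hc]; exact .snoc hy hc⟩
    rw [TurnstileStream.freq_append, Pi.add_apply, Pi.add_apply, hσ]
    simp [Pi.single_apply, Fin.ext_iff]
  R_lt := by
    rintro x y ⟨σ, -, hy⟩
    exact h.lt hy
  R_congr := by
    rintro x x' y hx ⟨σ, hσ, hy⟩
    exact ⟨σ, fun i => (hσ i).trans (hx i i.2), hy⟩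

/-- The program for unit updates. -/
def stepCmd (A : StreamAlg) : Cmd := branch (reg 33) (call (-1) A.update) (call 1 A.update)

def startCmd (A : StreamAlg) : Cmd := asg 42 0 ;; asg 41 0 ;; call 0 A.start

/-- The linear sketching algorithm. -/
def linear (A : StreamAlg) : StreamAlg where
  -- The normal form of the zero vector is the word 0, so nothing has to be constructed at the
  -- start.
  start := asg 1 0
  update := updateCmd A.stepCmd A.startCmd
  -- The sketch is a word: walking along it from the constructed state gives a state of A. Then A's
  -- own recovery is simulated there, with index 0 and with its output enabled.
  recover := (mainCmd A.stepCmd A.startCmd ;; asg 42 (reg 23) ;; asg 38 (reg 1) ;;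
    walkCmd A.stepCmd ;; asg 41 0) ;; enter ;; simCmd 0 true A.recover

theorem four_le_bound (n s : ℕ) : 4 ≤ bound n s :=
  Nat.pow_le_pow_right (n := 2) (i := 2) (by norm_num) (by omega)

theorem two_pow_lt_bound (n s : ℕ) : 2 ^ s + 1 ≤ bound n s := by
  have h1 := Nat.one_le_two_pow (n := s)
  calc 2 ^ s + 1 ≤ 2 ^ (s + 1) := by rw [pow_succ]; omega
    _ ≤ _ := Nat.pow_le_pow_right (by norm_num) (by omega)

theorem add_two_le_bound (n s : ℕ) : n + 2 ≤ bound n s :=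
  (Nat.lt_size_self _).le.trans (Nat.pow_le_pow_right (by norm_num) (by omega))

theorem two_pow_pow_le_bound (n s : ℕ) : (2 ^ s) ^ 3 ≤ bound n s := by
  rw [← pow_mul]
  exact Nat.pow_le_pow_right (by norm_num) (by omega)

theorem env (h : A.UsesSpace n s S) (Δ : ℤ) :
    Env Δ (bound n (min s S)) S (toMachine h) A.stepCmd A.startCmd where
  four_le := four_le_bound _ _
  T_le := two_pow_lt_bound _ _
  n_le := add_two_le_bound _ _
  enc_le _ _ := enc_le_bound
  step := by
    intro σ h0 h41 hR h33 Q hQ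
    have hZ := four_le_bound n (min s S)
    have hT := two_pow_lt_bound n (min s S)
    have key : ∀ b, σ 33 = b → (sg b).natAbs ≤ 1 →
        Ht Δ (bound n (min s S)) S (call (sg b) A.update) σ Q := by
      rintro b rfl hb
      have hlt := (hR.stp (b := σ 33) h41).lt
      obtain ⟨x, σ', -, hy⟩ := hR
      obtain ⟨-, c, hc⟩ := h.exists_runs hy ⟨σ 41, h41⟩ (sg (σ 33))
      have e : (toMachine h).stp (σ 33) (σ 41) (σ 42) = c.reg 1 := runValue_eq hc
      rw [e] at hlt hQ
      exact Ht.call hZ hb (by rw [h0]; exact hc) (by omega) hQ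
    refine Ht.branch hZ rfl (fun hne => ?_) fun heq => ?_
    · rw [Ex.eval_reg] at hne
      exact key 1 (by omega) (by norm_num [sg])
    · exact key 0 heq (by norm_num [sg])
  start := by
    intro σ h0 Q hQ
    have hZ := four_le_bound n (min s S)
    have hT := two_pow_lt_bound n (min s S)
    obtain ⟨c, hc⟩ := h.exists_start
    have e : (toMachine h).init = c.reg 1 := runValue_eq hc
    have hlt := (toMachine h).R_lt (toMachine h).R_zero
    rw [e] at hlt
    refine Ht.seq (Ht.asg_small hZ rfl (Ht.seq (Ht.asg_small hZ rfl
      (Ht.call hZ (a := c) (by norm_num) ?_ (by omega) (hQ _ ?_ fun v hv => ?_)))))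
    · simpa [upd, h0] using hc
    · simp [upd, e]
    · simp [upd, show v ≠ 41 by omega, show v ≠ 42 by omega]

/-- The values of the registers at the start. -/
theorem exists_holds {Z n y i : ℕ} (hn : n ≤ Z) (hy : y ≤ Z) (hi : i ≤ Z) :
    ∃ σ : ℕ → ℕ, Holds Z (startConfig n y i) σ ∧ σ 0 = n ∧ σ 1 = y ∧ σ 2 = i ∧ σ 3 = 0 := by
  refine ⟨(startConfig n y i).reg, ⟨fun _ _ _ => rfl, fun v _ _ => ?_, ?_, fun v hv _ => ?_,
    fun r => ?_, ?_, rfl⟩, ?_, ?_, ?_, ?_⟩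
  · rw [startConfig_reg]; split_ifs <;> omega
  · simp [startConfig_reg]
  · rw [startConfig_reg, if_neg (by omega), if_neg (by omega), if_neg (by omega)]
    exact Nat.zero_le _
  · rw [startConfig_reg, if_neg (by omega), if_neg (by omega), if_neg (by omega)]
  · simp [startConfig]
  all_goals simp [startConfig_reg]

/-! ### Correctness of the linear sketching algorithm -/

variable (h : A.UsesSpace n s S)
include h

theorem UsesSpace.size_le : n.size ≤ S := by
  obtain ⟨c, hc⟩ := h.exists_start
  have := (size_add_size_le_space n 0 0).trans hc.space_start_le
  omega

/-- The state of the linear sketching algorithm. -/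
noncomputable def sketch (x : Fin n → ℤ) : ℕ :=
  (toMachine h).codeNat (QuotientAddGroup.mk x)

theorem sketch_lt (x : Fin n → ℤ) : sketch h x < (toMachine h).size :=
  (toMachine h).codeNat_lt _

theorem sketch_le (x : Fin n → ℤ) : sketch h x ≤ bound n (min s S) := by
  have := (sketch_lt h x).trans_le (toMachine h).size_le
  have := two_pow_lt_bound n (min s S)
  omega

theorem wv_sketch_sub_mem (x : Fin n → ℤ) :
    wv (toMachine h).fin.μ n (sketch h x) - extend n x ∈ (toMachine h).rels := by
  obtain ⟨X, hX, hmem⟩ := (toMachine h).exists_code x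
  rwa [sketch, (toMachine h).codeNat_mk hX hmem]

theorem linear_reaches (σ : TurnstileStream n) :
    A.linear.Reaches n (58 * (bound n (min s S) ^ 4).size + S) σ (sketch h σ.freq) := by
  have hZ := four_le_bound n (min s S)
  have hn := add_two_le_bound n (min s S)
  induction σ using List.reverseRecOn with
  | nil =>
    obtain ⟨σ₀, hσ₀, -⟩ := exists_holds (Z := bound n (min s S)) (n := n) (y := 0) (i := 0)
      (by omega) (by omega) (by omega)
    obtain ⟨c, σ', hr, hh, hv⟩ := Ht.asg_small (Δ := 0) (S := S) (Q := fun σ' => σ' 1 = 0)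
      (x := 1) (e := 0) hZ rfl (by simp [upd]) _ hσ₀
    have e : sketch h (TurnstileStream.freq []) = c.reg 1 := by
      rw [hh.val 1 (by norm_num) (by norm_num), hv]
      refine (toMachine h).codeNat_mk (toMachine h).size_pos ?_
      convert (toMachine h).rels.zero_mem using 1
      have : wv (toMachine h).fin.μ n 0 = 0 := by ext t; simp [wv, dgt_zero]
      rw [this]
      change 0 - extend n 0 = 0
      rw [map_zero, sub_zero]
    rw [e]
    exact .nil hr
  | append_singleton σ u ih =>
    obtain ⟨i, δ⟩ := u
    obtain ⟨σ₀, hσ₀, h0, h1, h2, h3⟩ := exists_holds (Z := bound n (min s S)) (n := n)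
      (y := sketch h (TurnstileStream.freq σ)) (i := i) (by omega) (sketch_le h _) (by omega)
    obtain ⟨c, σ', hr, hh, hlt, hmem⟩ := (env h δ).updateCmd_ht (two_pow_pow_le_bound _ _) h0 h1 h2
      h3 (sketch_lt h _) i.2 _ hσ₀
    have e : sketch h (TurnstileStream.freq (σ ++ [(i, δ)])) = c.reg 1 := by
      rw [hh.val 1 (by norm_num) (by norm_num)]
      refine (toMachine h).codeNat_mk hlt ?_
      have := (toMachine h).rels.add_mem hmem (wv_sketch_sub_mem h (TurnstileStream.freq σ))
      convert this using 1
      rw [TurnstileStream.freq_append, map_add, extend_single,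
        show (Pi.single (i : ℕ) δ : ℕ → ℤ) = δ • Pi.single (i : ℕ) 1 by
          rw [← Pi.single_smul]; simp]
      abel
    rw [e]
    exact .snoc ih hr

/-- The state on which A's recovery is run need not be that of A after `σ`. It belongs to another,
usually much longer stream `σ'` of the same frequency. -/
theorem linear_recovers (σ : TurnstileStream n) :
    ∃ (σ' : TurnstileStream n) (y : ℕ) (z : ℤ), σ'.freq = σ.freq ∧ A.Reaches n S σ' y ∧
      A.Recovers n S y z ∧
      A.linear.Recovers n (58 * (bound n (min s S) ^ 4).size + S) (sketch h σ.freq) z := by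
  have hZ := four_le_bound n (min s S)
  have hn := add_two_le_bound n (min s S)
  have hX := sketch_lt h σ.freq
  obtain ⟨σ', hfreq, hy⟩ := (toMachine h).R_of_code hX (wv_sketch_sub_mem h σ.freq)
  obtain ⟨y, hydef⟩ :
      ∃ y, y = walk (toMachine h).stp 0 (toMachine h).fin.μ n (sketch h σ.freq) (toMachine h).fin.p := ⟨_, rfl⟩
  rw [← hydef] at hy
  obtain ⟨y', z, -, hy', hrec⟩ := h σ'
  obtain rfl := hy'.det hy
  refine ⟨σ', _, z, funext fun i => (hfreq i).trans (extend_apply _ i), hy, hrec, ?_⟩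
  obtain ⟨a, ha, hout⟩ := hrec
  obtain ⟨σ₀, hσ₀, h0, h1, -, -⟩ := exists_holds (Z := bound n (min s S)) (n := n)
    (y := sketch h σ.freq) (i := 0) (by omega) (sketch_le h _) (by omega)
  have E := env h 0
  have hF := E.fits (two_pow_pow_le_bound _ _)
  have key : Ht 0 (bound n (min s S)) S (mainCmd A.stepCmd A.startCmd ;; asg 42 (reg 23) ;;
      asg 38 (reg 1) ;; walkCmd A.stepCmd ;; asg 41 0) σ₀ fun σ' =>
      σ' 0 = n ∧ σ' 42 = y' ∧ σ' 41 = 0 := by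
    refine Ht.seq ((E.mainCmd_ht h0).mono ?_)
    rintro σ₁ ⟨hrep, f₁⟩
    refine Ht.seq (Ht.asg_small hZ rfl (Ht.seq (Ht.asg_small hZ rfl (Ht.seq ((E.walkCmd_ht
      (b := 0) (k := n) (μ := (toMachine h).fin.μ) (X := sketch h σ.freq) (y := (toMachine h).fin.p) hF.radices
      ⟨?_, ?_, ?_, ?_, by norm_num⟩ ?_ (fun t ht => ?_) (hX.le.trans (toMachine h).size_le) ?_
      ⟨0, (toMachine h).inv_fin.R_p⟩).mono ?_)))))
    · simp [upd, hrep.dim]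
    · simpa [upd] using hrep.ctx.list
    · simp [upd, hrep.stage, (toMachine h).fin_k]
    · simp [upd, hrep.sign]
    · simp [upd, f₁, h1]
    · by_contra hlt
      rw [dgt_eq_dig hX, if_neg hlt] at ht
      exact ht rfl
    · simp [upd, hrep.state]
    · rintro σ₂ ⟨e₂, f₂⟩
      refine Ht.asg_small hZ rfl ⟨?_, ?_, ?_⟩
      · simp [upd, f₂, hrep.dim]
      · simp [upd, e₂, hydef]
      · simp [upd]
  obtain ⟨c₁, σ₁, r₁, hh, g0, g42, g41⟩ := key _ hσ₀
  have ha' : Runs 0 S A.recover (startConfig (σ₁ 0) (σ₁ 42) (σ₁ 41)) a := by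
    rw [g0, g42, g41]; exact ha
  obtain ⟨c₂, r₂, h₂⟩ := enter_runs (Δ := 0) true hh ha'.space_start_le
  obtain ⟨c₃, r₃, h₃⟩ := simCmd_runs (Δ := 0) (by norm_num)
    ((by omega : 3 ≤ bound n (min s S)).trans (Nat.le_self_pow (by norm_num) _))
    (fun r hr => hh.le_pow (by omega)) ha' h₂
  exact ⟨c₃, .seq r₁ (.seq r₂ r₃), by rw [h₃.out, if_pos rfl, hout]⟩

end StreamAlg

theorem mainTheorem1 :
    ∃ C : ℕ, ∀ A : StreamAlg, ∃ B : StreamAlg,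
      ∀ (n s S : ℕ) (P : StreamProblem n), 1 ≤ n →
        A.Solves n P → A.UsesSpace n s S →
          B.IsLinearSketching n s ∧ B.Solves n P ∧
            B.UsesSpace n s (C * (S + s * Nat.log 2 n)) := by
  refine ⟨3200, fun A => ⟨A.linear, fun n s S P hn hP h => ?_⟩⟩
  have hS := space_bound hn (min_le_left s S) (min_le_right s S) h.size_le
  have hlt : ∀ q, (StreamAlg.toMachine h).codeNat q < 2 ^ s := fun q =>
    ((StreamAlg.toMachine h).codeNat_lt q).trans_le ((StreamAlg.toMachine h).size_le.trans
      (Nat.pow_le_pow_right (by norm_num) (min_le_left s S)))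
  refine ⟨⟨(StreamAlg.toMachine h).Sketch, inferInstance,
    (QuotientAddGroup.mk' _).toIntLinearMap, ⟨fun q => ⟨_, hlt q⟩, fun q q' hq =>
      (StreamAlg.toMachine h).codeNat_injective (Fin.ext_iff.1 hq)⟩,
    fun σ => ⟨_, StreamAlg.linear_reaches h σ⟩⟩, fun σ => ?_, fun σ => ?_⟩
  · obtain ⟨σ', y, z, hσ', hy, hz, hB⟩ := StreamAlg.linear_recovers h σ
    -- This is where correctness of A on streams of every length enters: it is applied to `σ'`,
    -- whose length is not controlled.
    obtain ⟨S', y', z', hy', hz', hmem⟩ := hP σ'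
    obtain rfl := hy.det hy'
    obtain rfl := hz.det hz'
    exact ⟨_, _, z, StreamAlg.linear_reaches h σ, hB, hσ' ▸ hmem⟩
  · obtain ⟨σ', y, z, -, -, -, c, hc, hz⟩ := StreamAlg.linear_recovers h σ
    refine ⟨_, z, hlt _, ?_, c, hc.mono hS, hz⟩
    exact (StreamAlg.linear_reaches h σ).mono hS
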